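/- Let $\nu:[0,\infty)\to(0,\infty)$ be monotonically increasing (not necessarily strictly) with $\nu(0)=1$, such that $\varphi(s,t)=|t|\,\nu(|s/t|)$ for $t\neq0$, $\varphi(s,0)=|s|$, is a norm on $\mathbb{R}^2$, and let $\beta>0$. For $\Omega\subset\mathbb{R}^2$ and a smooth function $u:\Omega\to\mathbb{R}$, the amoeba distance of $p,q\in\Omega$ is $$d(p,q)=\inf_{c}\int_0^1\varphi\bigl(\|c'(t)\|_2,\ \beta\,|(u\circ c)'(t)|\bigr)\,dt ,$$ where $c:[0,1]\to\Omega$ runs over all regular $C^1$ curves with $c(0)=p$, $c(1)=q$, and the amoeba with radius $\varrho>0$ at $x$ is $\mathcal{A}_\varrho(x)=\{q\in\Omega : d(x,q)\le\varrho\}$. Define $g(0)=1$ and, for $z>0$, $$g(z)=\frac{3}{\beta^2z^2\,\nu\bigl(\tfrac1{\beta z}\bigr)^3}\int_0^1\xi^2\sqrt{\Bigl(\nu^{-1}\bigl(\tfrac1\xi\,\nu(\tfrac1{\beta z})\bigr)\Bigr)^2-\frac1{\beta^2z^2}}\;d\xi .$$ Then $g$ is a nonnegative, (weakly) decreasing function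 on $[0,\infty)$ with $\lim_{z\to0+}g(z)=1=g(0)$, and one step of amoeba median filtering with amoeba radius $\varrho$ approximates, as $\varrho\to0$, an explicit time step of size $\varrho^2/6$ of the self-snakes equation $u_t=|\nabla u|\,\mathrm{div}\bigl(g(|\nabla u|)\,\nabla u/|\nabla u|\bigr)$ in the following sense. For every $\Omega$ and $u$ as above and every interior point $x$ of $\Omega$ with $\nabla u(x)\neq0$, the vector field $g(|\nabla u|)\,\nabla u/|\nabla u|$ is differentiable at $x$; for all sufficiently small $\varrho>0$ the values of $u$ on $\mathcal{A}_\varrho(x)$ have a unique median $m(\varrho)$ with respect to area; and $$m(\varrho)=u(x)+\frac{\varrho^2}{6}\,|\nabla u(x)|\,\mathrm{div}\Bigl(g(|\nabla u|)\frac{\nabla u}{|\nabla u|}\Bigr)(x)+o(\varrho^2)\qquad(\varrho\to0+).$$ -/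

import Mathlib

open Set Filter Topology MeasureTheory Asymptotics
open scoped ENNReal ContDiff

/-- The image plane `ℝ²` with its Euclidean norm. -/
abbrev Plane : Type := EuclideanSpace ℝ (Fin 2)

/-- The function `φ(s, t) = |t| ν(|s / t|)` for `t ≠ 0`, and `φ(s, 0) = |s|`, which combines a
spatial distance `s` with a (scaled) grey-value distance `t`. -/
noncomputable def amoebaPhi (ν : ℝ → ℝ) (s t : ℝ) : ℝ :=
  if t = 0 then |s| else |t| * ν |s / t|

/-- The functions `ν : [0, ∞) → (0, ∞)` that generate amoeba metrics: increasing (in the weak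
sense, so that `ν z = max 1 z` is included), with `ν 0 = 1`, and such that `φ` is a norm on `ℝ²`.
Only the values of `ν` on `[0, ∞)` matter. -/
structure IsAmoebaProfile (ν : ℝ → ℝ) : Prop where
  monotoneOn : MonotoneOn ν (Ici 0)
  pos : ∀ z, 0 ≤ z → 0 < ν z
  map_zero : ν 0 = 1
  isNorm : ∃ N : Seminorm ℝ (ℝ × ℝ),
    (∀ p : ℝ × ℝ, N p = 0 → p = 0) ∧ ∀ s t : ℝ, N (s, t) = amoebaPhi ν s t

/-- `c` is a regular (`C¹`, with nowhere vanishing derivative) curve `[0, 1] → Ω` from `p` to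
`q`. -/
structure IsRegularCurve (Ω : Set Plane) (p q : Plane) (c : ℝ → Plane) : Prop where
  contDiffOn : ContDiffOn ℝ 1 c (Icc 0 1)
  deriv_ne_zero : ∀ t ∈ Icc (0 : ℝ) 1, derivWithin c (Icc 0 1) t ≠ 0
  mapsTo : MapsTo c (Icc 0 1) Ω
  source : c 0 = p
  target : c 1 = q

/-- The amoeba length `∫₀¹ φ(‖c'(t)‖, β |(u ∘ c)'(t)|) dt` of a curve `c` on the image `u`. -/
noncomputable def amoebaLength (ν : ℝ → ℝ) (β : ℝ) (u : Plane → ℝ) (c : ℝ → Plane) : ℝ :=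
  ∫ t in (0 : ℝ)..1,
    amoebaPhi ν ‖derivWithin c (Icc 0 1) t‖ (β * |derivWithin (u ∘ c) (Icc 0 1) t|)

/-- The amoeba distance of `p` and `q` on the image `u` over `Ω`: the infimum of the amoeba lengths
of the regular curves in `Ω` from `p` to `q` (it is `∞` if there is no such curve). -/
noncomputable def amoebaDist (ν : ℝ → ℝ) (β : ℝ) (Ω : Set Plane) (u : Plane → ℝ)
    (p q : Plane) : ℝ≥0∞ :=
  ⨅ (c : ℝ → Plane) (_ : IsRegularCurve Ω p q c), ENNReal.ofReal (amoebaLength ν β u c)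

/-- The amoeba with radius `ρ` and reference point `p`: the closed `ρ`-ball around `p` in the
amoeba metric. -/
def amoeba (ν : ℝ → ℝ) (β : ℝ) (Ω : Set Plane) (u : Plane → ℝ) (ρ : ℝ) (p : Plane) : Set Plane :=
  {q | q ∈ Ω ∧ amoebaDist ν β Ω u p q ≤ ENNReal.ofReal ρ}

/-- `m` is a median, with respect to area, of the values of `u` on `A`. -/
def IsMedianOn (u : Plane → ℝ) (A : Set Plane) (m : ℝ) : Prop :=
  volume A ≤ 2 * volume {q ∈ A | u q ≤ m} ∧ volume A ≤ 2 * volume {q ∈ A | m ≤ u q}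

/-- The edge-stopping function of the amoeba metric given by `ν` and `β`, on `[0, ∞)`. The inverse
of `ν` is only evaluated (up to the endpoint `ξ = 1`) at arguments greater than `1`, where it is
unique. The value at `0` is the limit from the right. -/
noncomputable def edgeStopping (ν : ℝ → ℝ) (β : ℝ) (z : ℝ) : ℝ :=
  if z = 0 then 1 else
    3 / (β ^ 2 * z ^ 2 * ν (1 / (β * z)) ^ 3) *
      ∫ ξ in (0 : ℝ)..1,
        ξ ^ 2 * √((Function.invFunOn ν (Ici 0) (1 / ξ * ν (1 / (β * z)))) ^ 2
          - 1 / (β ^ 2 * z ^ 2))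

/-- The divergence of a vector field on the plane. -/
noncomputable def planeDiv (X : Plane → Plane) (x : Plane) : ℝ :=
  ∑ i : Fin 2, (fderiv ℝ X x (EuclideanSpace.single i 1)) i

/-- The vector field `g(|∇u|) ∇u / |∇u|`. -/
noncomputable def snakesField (g : ℝ → ℝ) (u : Plane → ℝ) (x : Plane) : Plane :=
  (g ‖gradient u x‖ / ‖gradient u x‖) • gradient u x

/-- The right-hand side `|∇u| div (g(|∇u|) ∇u / |∇u|)` of the self-snakes equation. -/
noncomputable def selfSnakes (g : ℝ → ℝ) (u : Plane → ℝ) (x : Plane) : ℝ :=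
  ‖gradient u x‖ * planeDiv (snakesField g u) x

/-! Write N for φ, τ = β|∇u(x)| and G(t) = ∫₀^∞ N(√(1+y²), t)⁻³ dy (`ballMoment`). A layer-cake
computation identifies g(z) with G(βz) (`IsAmoebaProfile.edgeStopping_eq`). Sign, monotonicity and
the limit at 0 can be read off from G, because N increases in the modulus of each variable and N(s,
0) = |s|.

For the median, rescale by ρ around x in an orthonormal frame whose first vector is ∇u/|∇u|. Let Q
be the Hessian form of βu, with coefficients a along and c across the gradient. Up to errors O(ρ²)
in the gauge, the amoeba is caught between two models of {N(|v|, τv₁ + ρQ(v)/2) ≤ 1}. From outside: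
by Jensen's inequality no curve is shorter than N(|q - x|, β(u(q) - u(x))). From inside: along a
straight segment the rate of change of u is affine to leading order, so convexity of N bounds the
length by the mean of the two endpoint values. N may have corners, but on almost every ray both
models displace the boundary by the same first-order amount.

The area of a model amoeba above the level ρ²M of βu - βu(x) is then expanded to first order in ρ
(`QuadraticModel.tendsto_volume_level`). The strip between the level line and the axis v₁ = 0
contributes (c/3 - 2M)/τ. The displaced boundary contributes -∫ N⁻⁴ ∂ₜN Q(1, y)/2 dy over all slopes
y. In the latter the mixed term vanishes by parity, the zeroth moment gives G', and the second
moment is computed by an integration by parts based on Euler's identity for homogeneous functions.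
The sum is (τG'(τ)a + G(τ)c - 6M)/(3τ).

A point reflection turns the part below the level into a part above the level of a model with
opposite a, c and M. So the two parts have the same leading area and opposite corrections, and the
smaller one is decided by the sign of τG'a + Gc - 6M. The balanced value of M is one sixth of the
self-snakes operator written in the gradient frame. Levels slightly above and below it trap every
median, which gives the o(ρ²) estimate. Uniqueness holds because u takes all values near u(x) at
scale ρ² on open pieces of the amoeba. -/

/-! ### Absolute norms on the plane -/

/-- `N` is (the coordinate form of) an absolute normalized norm on `ℝ²`: it is invariant under sign
changes of the coordinates and takes the value `1` at both unit vectors. -/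
structure IsAbsoluteNorm (N : ℝ → ℝ → ℝ) : Prop where
  smul : ∀ c s t, N (c * s) (c * t) = |c| * N s t
  add_le : ∀ s t s' t', N (s + s') (t + t') ≤ N s t + N s' t'
  neg_left : ∀ s t, N (-s) t = N s t
  neg_right : ∀ s t, N s (-t) = N s t
  zero_right : ∀ s, N s 0 = |s|
  zero_left : ∀ t, N 0 t = |t|

namespace IsAbsoluteNorm

variable {N : ℝ → ℝ → ℝ}

lemma convex (h : IsAbsoluteNorm N) {l : ℝ} (hl0 : 0 ≤ l) (hl1 : l ≤ 1) (s t s' t' : ℝ) :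
    N ((1 - l) * s + l * s') ((1 - l) * t + l * t') ≤ (1 - l) * N s t + l * N s' t' := by
  have h1 := h.add_le ((1 - l) * s) ((1 - l) * t) (l * s') (l * t')
  rw [h.smul, h.smul, abs_of_nonneg hl0, abs_of_nonneg (by linarith)] at h1
  exact h1

/-- The point (s, t) is a convex combination of (s, t') and (s, -t'), at which N has the same value.
-/
lemma mono_right (h : IsAbsoluteNorm N) (s : ℝ) {t t' : ℝ} (ht : |t| ≤ |t'|) :
    N s t ≤ N s t' := by
  rcases eq_or_ne t' 0 with rfl | h0
  · have : t = 0 := by simpa using ht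
    rw [this]
  have hpos : 0 < |t'| := abs_pos.2 h0
  obtain ⟨c, hc, rfl⟩ : ∃ c : ℝ, |c| ≤ 1 ∧ t = c * t' :=
    ⟨t / t', by rw [abs_div]; exact div_le_one_of_le₀ ht hpos.le, by field_simp⟩
  have hc' := abs_le.1 hc
  have h1 := h.convex (l := (1 - c) / 2) (by linarith) (by linarith) s t' s (-t')
  rw [h.neg_right] at h1
  convert h1 using 2 <;> ring

lemma mono_left (h : IsAbsoluteNorm N) {s s' : ℝ} (hs : |s| ≤ |s'|) (t : ℝ) :
    N s t ≤ N s' t := by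
  rcases eq_or_ne s' 0 with rfl | h0
  · have : s = 0 := by simpa using hs
    rw [this]
  have hpos : 0 < |s'| := abs_pos.2 h0
  obtain ⟨c, hc, rfl⟩ : ∃ c : ℝ, |c| ≤ 1 ∧ s = c * s' :=
    ⟨s / s', by rw [abs_div]; exact div_le_one_of_le₀ hs hpos.le, by field_simp⟩
  have hc' := abs_le.1 hc
  have h1 := h.convex (l := (1 - c) / 2) (by linarith) (by linarith) s' t (-s') t
  rw [h.neg_left] at h1
  convert h1 using 2 <;> ring

lemma mono (h : IsAbsoluteNorm N) {s s' t t' : ℝ} (hs : |s| ≤ |s'|) (ht : |t| ≤ |t'|) :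
    N s t ≤ N s' t' :=
  (h.mono_right s ht).trans (h.mono_left hs t')

lemma abs_left_le (h : IsAbsoluteNorm N) (s t : ℝ) : |s| ≤ N s t := by
  rw [← h.zero_right s]; exact h.mono_right s (by simp)

lemma pos_of_left (h : IsAbsoluteNorm N) {s : ℝ} (hs : s ≠ 0) (t : ℝ) : 0 < N s t :=
  (abs_pos.2 hs).trans_le (h.abs_left_le s t)

lemma abs_right (h : IsAbsoluteNorm N) (s t : ℝ) : N s |t| = N s t := by
  rcases abs_choice t with h1 | h1 <;> rw [h1]
  exact h.neg_right s t

lemma le_add_right (h : IsAbsoluteNorm N) (s t t' : ℝ) : N s t ≤ N s t' + |t - t'| := by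
  have := h.add_le s t' 0 (t - t')
  rw [h.zero_left] at this
  simpa using this

lemma le_add_left (h : IsAbsoluteNorm N) (s s' t : ℝ) : N s t ≤ N s' t + |s - s'| := by
  have := h.add_le s' t (s - s') 0
  rw [h.zero_right] at this
  simpa using this

lemma abs_sub_right_le (h : IsAbsoluteNorm N) (s t t' : ℝ) : |N s t - N s t'| ≤ |t - t'| := by
  have h1 := h.le_add_right s t t'
  have h2 := h.le_add_right s t' t
  rw [abs_sub_comm t' t] at h2
  exact abs_le.2 ⟨by linarith, by linarith⟩

lemma abs_sub_left_le (h : IsAbsoluteNorm N) (s s' t : ℝ) : |N s t - N s' t| ≤ |s - s'| := by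
  have h1 := h.le_add_left s s' t
  have h2 := h.le_add_left s' s t
  rw [abs_sub_comm s' s] at h2
  exact abs_le.2 ⟨by linarith, by linarith⟩

lemma continuous (h : IsAbsoluteNorm N) : Continuous fun p : ℝ × ℝ => N p.1 p.2 := by
  have hl : LipschitzWith 2 fun p : ℝ × ℝ => N p.1 p.2 := by
    refine LipschitzWith.of_dist_le_mul fun p q => ?_
    have h1 := abs_sub_le (N p.1 p.2) (N p.1 q.2) (N q.1 q.2)
    have h2 := h.abs_sub_right_le p.1 p.2 q.2
    have h3 := h.abs_sub_left_le p.1 q.1 q.2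
    rw [Prod.dist_eq, Real.dist_eq, Real.dist_eq, Real.dist_eq, NNReal.coe_ofNat]
    have h4 := le_max_left |p.1 - q.1| |p.2 - q.2|
    have h5 := le_max_right |p.1 - q.1| |p.2 - q.2|
    linarith
  exact hl.continuous

lemma continuous_comp {X : Type*} [TopologicalSpace X] (h : IsAbsoluteNorm N) {f g : X → ℝ}
    (hf : Continuous f) (hg : Continuous g) : Continuous fun x => N (f x) (g x) :=
  h.continuous.comp (hf.prodMk hg)

lemma mul_left_of_nonneg (h : IsAbsoluteNorm N) {c : ℝ} (hc : 0 ≤ c) (s t : ℝ) :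
    N (c * s) (c * t) = c * N s t := by
  rw [h.smul, abs_of_nonneg hc]

end IsAbsoluteNorm

/-- The norm `φ` generated by an amoeba profile. -/
lemma IsAmoebaProfile.isAbsoluteNorm {ν : ℝ → ℝ} (hν : IsAmoebaProfile ν) :
    IsAbsoluteNorm (amoebaPhi ν) := by
  obtain ⟨p, -, hp⟩ := hν.isNorm
  refine ⟨fun c s t => ?_, fun s t s' t' => ?_, fun s t => ?_, fun s t => ?_, fun s => ?_,
    fun t => ?_⟩
  · rw [← hp, ← hp, ← Real.norm_eq_abs, ← map_smul_eq_mul]; simp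
  · rw [← hp, ← hp, ← hp, ← Prod.mk_add_mk]; exact map_add_le_add p _ _
  · simp [amoebaPhi, neg_div]
  · simp [amoebaPhi, div_neg]
  · simp [amoebaPhi]
  · by_cases h : t = 0 <;> simp [amoebaPhi, h, hν.map_zero]

/-! ### The moment of the unit ball, its derivative and an integration by parts -/

/-- The weight `√(1 + y²)`. -/
noncomputable def slopeWeight (y : ℝ) : ℝ := √(1 + y ^ 2)

lemma slopeWeight_sq (y : ℝ) : slopeWeight y ^ 2 = 1 + y ^ 2 := Real.sq_sqrt (by positivity)

lemma slopeWeight_pos (y : ℝ) : 0 < slopeWeight y := Real.sqrt_pos.2 (by positivity)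

lemma one_le_slopeWeight (y : ℝ) : 1 ≤ slopeWeight y := by
  rw [slopeWeight, Real.one_le_sqrt]; nlinarith [sq_nonneg y]

lemma abs_le_slopeWeight (y : ℝ) : |y| ≤ slopeWeight y :=
  Real.abs_le_sqrt (by linarith)

lemma slopeWeight_neg (y : ℝ) : slopeWeight (-y) = slopeWeight y := by simp [slopeWeight]

lemma continuous_slopeWeight : Continuous slopeWeight := by unfold slopeWeight; fun_prop

lemma lipschitzWith_slopeWeight : LipschitzWith 1 slopeWeight := by
  refine LipschitzWith.of_dist_le_mul fun y z => ?_
  rw [Real.dist_eq, Real.dist_eq, NNReal.coe_one, one_mul]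
  have h1 : (slopeWeight y - slopeWeight z) * (slopeWeight y + slopeWeight z) = (y - z) * (y + z) := by
    linear_combination slopeWeight_sq y - slopeWeight_sq z
  have hp := add_pos (slopeWeight_pos y) (slopeWeight_pos z)
  have h2 : |slopeWeight y - slopeWeight z| * (slopeWeight y + slopeWeight z)
      = |y - z| * |y + z| := by
    rw [← abs_mul, ← h1, abs_mul, abs_of_pos hp]
  have h3 : |y + z| ≤ slopeWeight y + slopeWeight z :=
    (abs_add_le y z).trans (add_le_add (abs_le_slopeWeight y) (abs_le_slopeWeight z))
  refine le_of_mul_le_mul_right ?_ hp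
  rw [h2]
  exact mul_le_mul_of_nonneg_left h3 (abs_nonneg _)

/-- The moment `∫₀^∞ N(√(1 + y²), t)⁻³ dy`, which is the first absolute moment (up to a factor) of
the unit ball of `v ↦ N(|v|, t v₁)`. -/
noncomputable def ballMoment (N : ℝ → ℝ → ℝ) (t : ℝ) : ℝ :=
  ∫ y in Ioi (0 : ℝ), (N (slopeWeight y) t ^ 3)⁻¹

/-- The partial derivative of `N` in the second variable at `(√(1 + y²), t)`. -/
noncomputable def slopeDeriv (N : ℝ → ℝ → ℝ) (t y : ℝ) : ℝ :=
  deriv (fun s => N (slopeWeight y) s) t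

lemma slopeDeriv_neg (N : ℝ → ℝ → ℝ) (t y : ℝ) : slopeDeriv N t (-y) = slopeDeriv N t y := by
  simp [slopeDeriv, slopeWeight_neg]

lemma abs_inv_cube_sub_inv_cube_le {p q w : ℝ} (hw : 0 < w) (hp : w ≤ p) (hq : w ≤ q) :
    |(p ^ 3)⁻¹ - (q ^ 3)⁻¹| ≤ 3 * (w ^ 4)⁻¹ * |p - q| := by
  have hp0 := hw.trans_le hp
  have hq0 := hw.trans_le hq
  have h1 : (p ^ 3)⁻¹ - (q ^ 3)⁻¹
      = ((p * q ^ 3)⁻¹ + (p ^ 2 * q ^ 2)⁻¹ + (p ^ 3 * q)⁻¹) * (q - p) := by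
    field_simp; ring
  rw [h1, abs_mul, abs_sub_comm q p, abs_of_pos (by positivity)]
  refine mul_le_mul_of_nonneg_right ?_ (abs_nonneg _)
  have e1 : (p * q ^ 3)⁻¹ ≤ (w ^ 4)⁻¹ := by
    rw [show w ^ 4 = w * w ^ 3 by ring]; gcongr
  have e2 : (p ^ 2 * q ^ 2)⁻¹ ≤ (w ^ 4)⁻¹ := by
    rw [show w ^ 4 = w ^ 2 * w ^ 2 by ring]; gcongr
  have e3 : (p ^ 3 * q)⁻¹ ≤ (w ^ 4)⁻¹ := by
    rw [show w ^ 4 = w ^ 3 * w by ring]; gcongr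
  linarith

lemma inv_slopeWeight_pow_le {k : ℕ} (hk : 2 ≤ k) (y : ℝ) :
    (slopeWeight y ^ k)⁻¹ ≤ (1 + y ^ 2)⁻¹ := by
  rw [← slopeWeight_sq]
  have := one_le_slopeWeight y
  gcongr

namespace IsAbsoluteNorm

variable {N : ℝ → ℝ → ℝ}

lemma slopeWeight_le (h : IsAbsoluteNorm N) (y t : ℝ) : slopeWeight y ≤ N (slopeWeight y) t :=
  (le_abs_self _).trans (h.abs_left_le _ _)

lemma slope_pos (h : IsAbsoluteNorm N) (y t : ℝ) : 0 < N (slopeWeight y) t :=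
  (slopeWeight_pos y).trans_le (h.slopeWeight_le y t)

lemma inv_slope_pow_le (h : IsAbsoluteNorm N) {k : ℕ} (hk : 2 ≤ k) (y t : ℝ) :
    (N (slopeWeight y) t ^ k)⁻¹ ≤ (1 + y ^ 2)⁻¹ := by
  refine le_trans ?_ (inv_slopeWeight_pow_le hk y)
  have := slopeWeight_pos y
  have := h.slopeWeight_le y t
  gcongr

lemma continuous_slope (h : IsAbsoluteNorm N) (t : ℝ) : Continuous fun y => N (slopeWeight y) t :=
  h.continuous_comp continuous_slopeWeight continuous_const

lemma continuous_inv_slope_pow (h : IsAbsoluteNorm N) (t : ℝ) (k : ℕ) :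
    Continuous fun y => (N (slopeWeight y) t ^ k)⁻¹ :=
  ((h.continuous_slope t).pow k).inv₀ fun y => (pow_pos (h.slope_pos y t) k).ne'

lemma integrable_inv_slope_pow (h : IsAbsoluteNorm N) {k : ℕ} (hk : 2 ≤ k) (t : ℝ) :
    Integrable fun y => (N (slopeWeight y) t ^ k)⁻¹ := by
  refine integrable_inv_one_add_sq.mono' (h.continuous_inv_slope_pow t k).aestronglyMeasurable
    (Eventually.of_forall fun y => ?_)
  have := h.slope_pos y t
  rw [Real.norm_of_nonneg (by positivity)]
  exact h.inv_slope_pow_le hk y t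

lemma abs_slopeDeriv_le (h : IsAbsoluteNorm N) (t y : ℝ) : |slopeDeriv N t y| ≤ 1 := by
  have hl : LipschitzWith 1 fun s => N (slopeWeight y) s :=
    LipschitzWith.of_dist_le_mul fun s s' => by
      simpa [Real.dist_eq] using h.abs_sub_right_le (slopeWeight y) s s'
  simpa [slopeDeriv] using norm_deriv_le_of_lipschitz (x₀ := t) hl

lemma measurable_slopeDeriv (h : IsAbsoluteNorm N) (t : ℝ) : Measurable (slopeDeriv N t) := by
  have hc : Continuous (Function.uncurry fun y s : ℝ => N (slopeWeight y) s) := by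
    simp only [Function.uncurry_def]
    exact h.continuous_comp (continuous_slopeWeight.comp continuous_fst) continuous_snd
  exact (measurable_deriv_with_param hc).comp (measurable_id.prodMk measurable_const)

lemma nonneg_ballMoment (h : IsAbsoluteNorm N) (t : ℝ) : 0 ≤ ballMoment N t :=
  integral_nonneg fun y => by have := h.slope_pos y t; positivity

lemma antitoneOn_ballMoment (h : IsAbsoluteNorm N) : AntitoneOn (ballMoment N) (Ici 0) := by
  intro t ht t' ht' htt
  refine integral_mono (h.integrable_inv_slope_pow (by norm_num) t').integrableOn
    (h.integrable_inv_slope_pow (by norm_num) t).integrableOn fun y => ?_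
  have h1 := h.slope_pos y t
  have h2 : N (slopeWeight y) t ≤ N (slopeWeight y) t' :=
    h.mono_right _ (by rwa [abs_of_nonneg ht, abs_of_nonneg ht'])
  dsimp only
  gcongr

lemma continuous_ballMoment (h : IsAbsoluteNorm N) : Continuous (ballMoment N) := by
  refine continuous_of_dominated (bound := fun y => (1 + y ^ 2)⁻¹)
    (fun t => (h.continuous_inv_slope_pow t 3).aestronglyMeasurable)
    (fun t => Eventually.of_forall fun y => ?_) integrable_inv_one_add_sq.integrableOn
    (Eventually.of_forall fun y => ?_)
  · have := h.slope_pos y t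
    rw [Real.norm_of_nonneg (by positivity)]
    exact h.inv_slope_pow_le (by norm_num) y t
  · exact ((h.continuous_comp continuous_const continuous_id).pow 3).inv₀
      fun t => (pow_pos (h.slope_pos y t) 3).ne'

lemma lipschitzWith_slope (h : IsAbsoluteNorm N) (t : ℝ) :
    LipschitzWith 1 fun y => N (slopeWeight y) t := by
  refine LipschitzWith.of_dist_le_mul fun y z => ?_
  have h1 := lipschitzWith_slopeWeight.dist_le_mul y z
  rw [Real.dist_eq] at h1
  exact (h.abs_sub_left_le _ _ t).trans h1

/-- For almost every `y` the function `N(√(1 + y²), ·)` is differentiable at `t`; by homogeneity,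
its derivative is determined by that of `y ↦ N(√(1 + y²), t)`. -/
lemma ae_hasDerivAt_slope (h : IsAbsoluteNorm N) {t : ℝ} (ht : 0 < t) :
    ∀ᵐ y : ℝ, HasDerivAt (fun s => N (slopeWeight y) s) (slopeDeriv N t y) t ∧
      DifferentiableAt ℝ (fun y => N (slopeWeight y) t) y ∧
      (1 + y ^ 2) * deriv (fun y => N (slopeWeight y) t) y
        = y * (N (slopeWeight y) t - t * slopeDeriv N t y) := by
  filter_upwards [(h.lipschitzWith_slope t).ae_differentiableAt_real,
    Measure.ae_ne volume (0 : ℝ)] with y hy hy0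
  set D := deriv (fun y => N (slopeWeight y) t) y with hD
  -- Everything is even in y. The slope 0 is excluded because the change of variables below divides
  -- by y.
  wlog hpos : 0 < y generalizing y
  · have hneg := this (y := -y)
    have e : (fun y => N (slopeWeight y) t) = fun y => N (slopeWeight (-y)) t := by
      simp [slopeWeight_neg]
    have hd : DifferentiableAt ℝ (fun y => N (slopeWeight y) t) (-y) := by
      rw [e]
      have : DifferentiableAt ℝ (fun y => N (slopeWeight y) t) (- -y) := by simpa using hy
      exact this.comp (-y) differentiableAt_id.neg
    have h1 := hneg hd (by simpa using hy0) rfl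
      (by have := lt_of_le_of_ne (not_lt.1 hpos) hy0; linarith)
    have hDn : deriv (fun y => N (slopeWeight y) t) (-y) = -D := by
      conv_lhs => rw [e]
      rw [deriv_comp_neg (fun y => N (slopeWeight y) t)]
      simp [hD]
    rw [slopeDeriv_neg, slopeWeight_neg, hDn] at h1
    exact ⟨h1.1, hy, by linarith [h1.2.2]⟩
  have hder : HasDerivAt (fun y => N (slopeWeight y) t) D y := hy.hasDerivAt
  have hw2 := slopeWeight_sq y
  have hw := slopeWeight_pos y
  set w := slopeWeight y with hwdef
  -- the slope `√((w t / s)² - 1)` of the point of the ray through `(w, s)` at height `t`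
  have hin : HasDerivAt (fun s : ℝ => (w * t / s) ^ 2 - 1) (-(2 * w ^ 2 / t)) t := by
    have h1 : HasDerivAt (fun s : ℝ => w * t / s) (w * t * -(t ^ 2)⁻¹) t := by
      simpa [div_eq_mul_inv] using (hasDerivAt_inv ht.ne').const_mul (w * t)
    have h2 := (h1.pow 2).sub_const 1
    refine h2.congr_deriv ?_
    field_simp
    norm_num
    ring
  have hval : (w * t / t) ^ 2 - 1 = y ^ 2 := by
    rw [mul_div_cancel_right₀ _ ht.ne']; linarith
  have hs : HasDerivAt (fun s : ℝ => √((w * t / s) ^ 2 - 1)) (-(w ^ 2 / (t * y))) t := by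
    have h1 := hin.sqrt (by rw [hval]; positivity)
    rw [hval, Real.sqrt_sq hpos.le] at h1
    convert h1 using 1
    field_simp
  have hsv : √((w * t / t) ^ 2 - 1) = y := by rw [hval, Real.sqrt_sq hpos.le]
  have hcomp : HasDerivAt (fun s : ℝ => N (slopeWeight √((w * t / s) ^ 2 - 1)) t)
      (D * -(w ^ 2 / (t * y))) t := by
    have h1 : HasDerivAt (fun y => N (slopeWeight y) t) D √((w * t / t) ^ 2 - 1) := by rwa [hsv]
    exact h1.comp t hs
  have hprod : HasDerivAt (fun s : ℝ => s / t * N (slopeWeight √((w * t / s) ^ 2 - 1)) t)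
      (1 / t * N w t + D * -(w ^ 2 / (t * y))) t := by
    have h1 := ((hasDerivAt_id t).div_const t).mul hcomp
    refine h1.congr_deriv ?_
    simp only [id, hsv, ← hwdef]
    field_simp
  -- Homogeneity gives N(w, s) = (s/t) N(wt/s, t), and wt/s is the weight of the slope √((wt/s)² -
  -- 1). Differentiability in the slope, which one-dimensional Rademacher provides almost
  -- everywhere, is thus carried over to the second argument of N.
  have hev : (fun s : ℝ => N w s)
      =ᶠ[𝓝 t] fun s : ℝ => s / t * N (slopeWeight √((w * t / s) ^ 2 - 1)) t := by
    have hpos' : ∀ᶠ s in 𝓝 t, 0 < (w * t / s) ^ 2 - 1 :=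
      hin.continuousAt.eventually (lt_mem_nhds (by simp only [hval]; positivity))
    filter_upwards [hpos', lt_mem_nhds ht] with s h1 h2
    have h3 : slopeWeight √((w * t / s) ^ 2 - 1) = w * t / s := by
      rw [slopeWeight, Real.sq_sqrt h1.le, add_sub_cancel, Real.sqrt_sq (by positivity)]
    rw [h3, ← h.mul_left_of_nonneg (by positivity)]
    congr 1 <;> field_simp
  have hfin := hprod.congr_of_eventuallyEq hev
  have hP : slopeDeriv N t y = 1 / t * N w t + D * -(w ^ 2 / (t * y)) := hfin.deriv
  refine ⟨hP ▸ hfin, hy, ?_⟩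
  rw [hP, ← hw2]
  field_simp
  ring

/-- The derivative of the moment of the unit ball. -/
lemma hasDerivAt_ballMoment (h : IsAbsoluteNorm N) {t : ℝ} (ht : 0 < t) :
    HasDerivAt (ballMoment N)
      (-3 * ∫ y in Ioi (0 : ℝ), (N (slopeWeight y) t ^ 4)⁻¹ * slopeDeriv N t y) t := by
  rw [← integral_const_mul]
  -- N may have corners. The integrand is therefore only used as a Lipschitz function of the
  -- parameter that is differentiable at t for almost every y.
  refine (hasDerivAt_integral_of_dominated_loc_of_lip (s := univ)
    (bound := fun y => 3 * (1 + y ^ 2)⁻¹) univ_mem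
    (Eventually.of_forall fun s => (h.continuous_inv_slope_pow s 3).aestronglyMeasurable)
    (h.integrable_inv_slope_pow (by norm_num) t).integrableOn ?_ ?_
    (integrable_inv_one_add_sq.const_mul 3).integrableOn ?_).2
  · exact (((h.continuous_inv_slope_pow t 4).measurable.mul
      (h.measurable_slopeDeriv t)).const_mul (-3)).aestronglyMeasurable
  · refine Eventually.of_forall fun y => LipschitzWith.lipschitzOnWith ?_
    refine LipschitzWith.of_dist_le_mul fun s s' => ?_
    rw [Real.dist_eq, Real.dist_eq, Real.coe_nnabs, abs_of_pos (show (0 : ℝ) < 3 * (1 + y ^ 2)⁻¹ by positivity)]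
    refine (abs_inv_cube_sub_inv_cube_le (slopeWeight_pos y) (h.slopeWeight_le y s)
      (h.slopeWeight_le y s')).trans ?_
    exact mul_le_mul (mul_le_mul_of_nonneg_left (inv_slopeWeight_pow_le (by norm_num) y)
      (by norm_num)) (h.abs_sub_right_le _ _ _) (abs_nonneg _) (by positivity)
  · filter_upwards [ae_restrict_of_ae (h.ae_hasDerivAt_slope ht)] with y hy
    have h0 := h.slope_pos y t
    have h1 := (hy.1.pow 3).inv (pow_pos h0 3).ne'
    refine h1.congr_deriv ?_
    simp only [Pi.pow_apply]
    field_simp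
    norm_num
    ring

lemma integrable_sq_mul_slopeDeriv (h : IsAbsoluteNorm N) (t : ℝ) :
    Integrable fun y => y ^ 2 * ((N (slopeWeight y) t ^ 4)⁻¹ * slopeDeriv N t y) := by
  refine integrable_inv_one_add_sq.mono' (((measurable_id.pow_const 2).mul
    ((h.continuous_inv_slope_pow t 4).measurable.mul
      (h.measurable_slopeDeriv t))).aestronglyMeasurable)
    (Eventually.of_forall fun y => ?_)
  have h0 := h.slope_pos y t
  have hw := slopeWeight_pos y
  have h1 : (N (slopeWeight y) t ^ 4)⁻¹ ≤ ((1 + y ^ 2) * (1 + y ^ 2))⁻¹ := by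
    rw [← slopeWeight_sq, ← pow_add]
    have := h.slopeWeight_le y t
    gcongr
  have h2 := h.abs_slopeDeriv_le t y
  rw [Real.norm_eq_abs, abs_mul, abs_mul, abs_of_nonneg (sq_nonneg y),
    abs_of_pos (show 0 < (N (slopeWeight y) t ^ 4)⁻¹ by positivity)]
  calc y ^ 2 * ((N (slopeWeight y) t ^ 4)⁻¹ * |slopeDeriv N t y|)
      ≤ (1 + y ^ 2) * (((1 + y ^ 2) * (1 + y ^ 2))⁻¹ * 1) := by gcongr; linarith
    _ = (1 + y ^ 2)⁻¹ := by field_simp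

lemma integrable_inv_mul_slopeDeriv (h : IsAbsoluteNorm N) (t : ℝ) :
    Integrable fun y => (N (slopeWeight y) t ^ 4)⁻¹ * slopeDeriv N t y := by
  refine integrable_inv_one_add_sq.mono' (((h.continuous_inv_slope_pow t 4).measurable.mul
      (h.measurable_slopeDeriv t)).aestronglyMeasurable)
    (Eventually.of_forall fun y => ?_)
  have h0 := h.slope_pos y t
  rw [Real.norm_eq_abs, abs_mul,
    abs_of_pos (show 0 < (N (slopeWeight y) t ^ 4)⁻¹ by positivity)]
  calc (N (slopeWeight y) t ^ 4)⁻¹ * |slopeDeriv N t y|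
      ≤ (1 + y ^ 2)⁻¹ * 1 :=
        mul_le_mul (h.inv_slope_pow_le (by norm_num) y t) (h.abs_slopeDeriv_le t y)
          (abs_nonneg _) (by positivity)
    _ = (1 + y ^ 2)⁻¹ := mul_one _

/-- The boundary term at infinity in the integration by parts. For y > 0 the value N(√(1+y²), t)
lies between y and y + |t| + 1, so its quotient by y tends to 1. -/
lemma tendsto_cube_div_slope (h : IsAbsoluteNorm N) (t : ℝ) :
    Tendsto (fun y => y * (1 + y ^ 2) * (N (slopeWeight y) t ^ 3)⁻¹) atTop (𝓝 1) := by
  have hinv : Tendsto (fun y : ℝ => y⁻¹) atTop (𝓝 0) := tendsto_inv_atTop_zero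
  have h1 : Tendsto (fun y => N (slopeWeight y) t / y) atTop (𝓝 1) := by
    rw [tendsto_iff_dist_tendsto_zero]
    have h2 : Tendsto (fun y : ℝ => (|t| + 1) * y⁻¹) atTop (𝓝 0) := by
      simpa using hinv.const_mul (|t| + 1)
    refine squeeze_zero' (Eventually.of_forall fun _ => dist_nonneg) ?_ h2
    filter_upwards [eventually_gt_atTop 0] with y hy
    have h3 : slopeWeight y ≤ y + 1 := by
      rw [slopeWeight]; exact Real.sqrt_le_iff.2 ⟨by linarith, by nlinarith⟩
    have h4 := (le_abs_self y).trans (abs_le_slopeWeight y)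
    have h5 := h.le_add_right (slopeWeight y) t 0
    rw [h.zero_right, abs_of_pos (slopeWeight_pos y), sub_zero] at h5
    have h6 := h.slopeWeight_le y t
    rw [Real.dist_eq, div_sub_one hy.ne', abs_div, abs_of_pos hy, div_eq_mul_inv]
    gcongr
    exact abs_le.2 ⟨by linarith [abs_nonneg t], by linarith⟩
  have h2 : Tendsto (fun y => ((y⁻¹) ^ 2 + 1) * ((N (slopeWeight y) t / y) ^ 3)⁻¹) atTop (𝓝 1) := by
    simpa using ((hinv.pow 2).add_const 1).mul ((h1.pow 3).inv₀ (by norm_num))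
  refine h2.congr' ?_
  filter_upwards [eventually_gt_atTop 0] with y hy
  have := h.slope_pos y t
  field_simp

/-- An integration by parts that expresses a second moment of the derivative. -/
lemma integral_sq_mul_slopeDeriv (h : IsAbsoluteNorm N) {t : ℝ} (ht : 0 < t) :
    3 * t * ∫ y in Ioi (0 : ℝ), y ^ 2 * ((N (slopeWeight y) t ^ 4)⁻¹ * slopeDeriv N t y)
      = 1 - ballMoment N t := by
  set f : ℝ → ℝ := fun y => N (slopeWeight y) t with hf
  -- The factor 1 + y² is what Euler's identity (1+y²)f' = y(f - t ∂ₜN) needs: the terms y²f⁻³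
  -- cancel in F', and what remains is the integrand of the moment plus that of the second moment of
  -- the derivative.
  set F : ℝ → ℝ := fun y => y * (1 + y ^ 2) * (f y ^ 3)⁻¹ with hF
  set F' : ℝ → ℝ := fun y => (f y ^ 3)⁻¹ + 3 * t * (y ^ 2 * ((f y ^ 4)⁻¹ * slopeDeriv N t y))
    with hF'
  have hint : Integrable F' := (h.integrable_inv_slope_pow (by norm_num) t).add
    ((h.integrable_sq_mul_slopeDeriv t).const_mul _)
  have hder : ∀ᵐ y, deriv F y = F' y := by
    filter_upwards [h.ae_hasDerivAt_slope ht] with y ⟨_, hd, he⟩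
    have h0 : 0 < f y := h.slope_pos y t
    have h1 : HasDerivAt f (deriv f y) y := hd.hasDerivAt
    have h2 : HasDerivAt (fun y : ℝ => y * (1 + y ^ 2)) (1 + 3 * y ^ 2) y := by
      have := (hasDerivAt_id y).mul (((hasDerivAt_id y).pow 2).const_add 1)
      refine this.congr_deriv ?_
      simp; ring
    have h3 := h2.mul ((h1.pow 3).inv (pow_pos h0 3).ne')
    rw [show F = (fun y : ℝ => y * (1 + y ^ 2)) * (f ^ 3)⁻¹ from rfl, h3.deriv, hF']
    simp only [Pi.inv_apply, Pi.pow_apply]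
    have h4 : (1 + y ^ 2) * deriv f y = y * (f y - t * slopeDeriv N t y) := he
    field_simp
    linear_combination (-3 * y * f y ^ 2) * h4
  -- F is differentiable only almost everywhere, so the fundamental theorem is used for absolutely
  -- continuous functions.
  have hac : ∀ R : ℝ, AbsolutelyContinuousOnInterval F 0 R := by
    intro R
    refine AbsolutelyContinuousOnInterval.fun_mul ?_ ?_
    · have hc : ContDiff ℝ 1 fun y : ℝ => y * (1 + y ^ 2) := by fun_prop
      obtain ⟨K, hK⟩ := hc.locallyLipschitz.locallyLipschitzOn.exists_lipschitzOnWith_of_compact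
        (isCompact_uIcc (a := (0 : ℝ)) (b := R))
      exact hK.absolutelyContinuousOnInterval
    · have hl : LipschitzWith 3 fun y => (f y ^ 3)⁻¹ := by
        refine LipschitzWith.of_dist_le_mul fun y z => ?_
        have h1 := abs_inv_cube_sub_inv_cube_le one_pos
          ((one_le_slopeWeight y).trans (h.slopeWeight_le y t))
          ((one_le_slopeWeight z).trans (h.slopeWeight_le z t))
        have h2 := (h.lipschitzWith_slope t).dist_le_mul y z
        simp only [one_pow, inv_one, mul_one] at h1
        rw [Real.dist_eq, NNReal.coe_one, one_mul] at h2
        rw [Real.dist_eq, NNReal.coe_ofNat]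
        linarith
      exact hl.lipschitzOnWith.absolutelyContinuousOnInterval
  have hR : ∀ R : ℝ, ∫ y in (0 : ℝ)..R, F' y = F R := by
    intro R
    rw [← intervalIntegral.integral_congr_ae (hder.mono fun y hy _ => hy),
      (hac R).integral_deriv_eq_sub]
    simp [hF]
  have hlim := intervalIntegral_tendsto_integral_Ioi 0 hint.integrableOn tendsto_id
  simp only [id, hR] at hlim
  have huniq := tendsto_nhds_unique hlim (h.tendsto_cube_div_slope t)
  rw [hF', integral_add (h.integrable_inv_slope_pow (by norm_num) t).integrableOn
    ((h.integrable_sq_mul_slopeDeriv t).const_mul _).integrableOn, integral_const_mul] at huniq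
  rw [ballMoment]
  linarith

end IsAbsoluteNorm

/-! ### The edge-stopping function as a moment -/

namespace IsAbsoluteNorm

variable {N : ℝ → ℝ → ℝ}

/-- For t = 0 the integrand is (1+y²)^(-3/2), which has the primitive y/√(1+y²). -/
lemma ballMoment_zero (h : IsAbsoluteNorm N) : ballMoment N 0 = 1 := by
  have hw : ∀ y, N (slopeWeight y) 0 = slopeWeight y := fun y => by
    rw [h.zero_right, abs_of_pos (slopeWeight_pos y)]
  have hlim := h.tendsto_cube_div_slope 0
  have hint := h.integrable_inv_slope_pow (k := 3) (by norm_num) 0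
  simp only [hw] at hlim hint
  have hF : ∀ y : ℝ, y * (1 + y ^ 2) * (slopeWeight y ^ 3)⁻¹ = y / slopeWeight y := fun y => by
    rw [← slopeWeight_sq]; have := slopeWeight_pos y; field_simp
  simp only [hF] at hlim
  have hder : ∀ y ∈ Ici (0 : ℝ),
      HasDerivAt (fun y => y / slopeWeight y) ((slopeWeight y ^ 3)⁻¹) y := fun y _ => by
    have h0 := slopeWeight_pos y
    have h1 : HasDerivAt slopeWeight (y / slopeWeight y) y := by
      have h2 := (((hasDerivAt_id y).pow 2).const_add 1).sqrt (x := y)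
        (by simp only [id, Pi.pow_apply]; positivity)
      refine h2.congr_deriv ?_
      simp only [id, Pi.pow_apply]
      rw [← slopeWeight]
      field_simp
      norm_num
    refine ((hasDerivAt_id y).div h1 h0.ne').congr_deriv ?_
    simp only [id]
    field_simp
    linarith [slopeWeight_sq y]
  have := integral_Ioi_of_hasDerivAt_of_tendsto' hder hint.integrableOn hlim
  simp only [ballMoment, hw, this]
  simp

/-- A layer-cake formula. -/
lemma integral_sq_mul_eq (h : IsAbsoluteNorm N) {b : ℝ} (hb : 0 < b) {V : ℝ → ℝ}
    (hV : ∀ ξ ∈ Ioo (0 : ℝ) 1, 0 ≤ V ξ ∧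
      ∀ w : ℝ, 0 < w → (w < V ξ ↔ ξ * N √(w ^ 2 + b ^ 2) 1 < N b 1)) :
    ∫ ξ in (0 : ℝ)..1, ξ ^ 2 * V ξ
      = ∫ w in Ioi (0 : ℝ), (N b 1 / N √(w ^ 2 + b ^ 2) 1) ^ 3 / 3 := by
  set M : ℝ → ℝ := fun w => N √(w ^ 2 + b ^ 2) 1 with hM
  have hMc : Continuous M := h.continuous_comp (by fun_prop) continuous_const
  have hn : 0 < N b 1 := h.pos_of_left hb.ne' 1
  have hMn : ∀ w, N b 1 ≤ M w := fun w => h.mono_left (by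
    rw [abs_of_pos hb, abs_of_nonneg (Real.sqrt_nonneg _)]
    exact Real.le_sqrt_of_sq_le (by nlinarith)) 1
  -- The weight ξ² is integrated over this region in both orders. The sections at fixed ξ are (0, V
  -- ξ), those at fixed w are (0, N b 1 / M w); the bound ξ < 1 is automatic in the latter because M
  -- ≥ N b 1.
  set A : Set (ℝ × ℝ) := {p | (0 < p.1 ∧ p.1 < 1) ∧ 0 < p.2 ∧ p.1 * M p.2 < N b 1} with hA
  have hAm : MeasurableSet A := by
    refine IsOpen.measurableSet ?_
    refine IsOpen.inter (IsOpen.inter ?_ ?_) (IsOpen.inter ?_ ?_)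
    · exact isOpen_lt continuous_const continuous_fst
    · exact isOpen_lt continuous_fst continuous_const
    · exact isOpen_lt continuous_const continuous_snd
    · exact isOpen_lt (continuous_fst.mul (hMc.comp continuous_snd)) continuous_const
  have hsec : ∀ ξ ∈ Ioo (0 : ℝ) 1, volume (Prod.mk ξ ⁻¹' A) = ENNReal.ofReal (V ξ) := by
    intro ξ hξ
    have : Prod.mk ξ ⁻¹' A = Ioo 0 (V ξ) := by
      ext w
      simp only [hA, mem_preimage, mem_ofPred_eq, mem_Ioo]
      constructor
      · rintro ⟨-, h1, h2⟩
        exact ⟨h1, ((hV ξ hξ).2 w h1).2 h2⟩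
      · rintro ⟨h1, h2⟩
        exact ⟨hξ, h1, ((hV ξ hξ).2 w h1).1 h2⟩
    rw [this, Real.volume_Ioo, sub_zero]
  set F : ℝ × ℝ → ℝ≥0∞ := A.indicator fun p => ENNReal.ofReal (p.1 ^ 2) with hF
  have hFm : Measurable F := Measurable.indicator (by fun_prop) hAm
  -- V is known only through its comparison property; its measurability is inherited from the
  -- section measures of A.
  have hVm : AEStronglyMeasurable V (volume.restrict (Ioo 0 1)) := by
    refine AEStronglyMeasurable.congr
      ((measurable_measure_prodMk_left (ν := volume) hAm).ennreal_toReal.aestronglyMeasurable) ?_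
    filter_upwards [ae_restrict_mem measurableSet_Ioo] with ξ hξ
    rw [hsec ξ hξ, ENNReal.toReal_ofReal (hV ξ hξ).1]
  have hL : ∫ ξ in (0 : ℝ)..1, ξ ^ 2 * V ξ = (∫⁻ ξ, ∫⁻ w, F (ξ, w)).toReal := by
    rw [intervalIntegral.integral_of_le zero_le_one, integral_Ioc_eq_integral_Ioo,
      integral_eq_lintegral_of_nonneg_ae]
    · congr 1
      rw [← lintegral_indicator measurableSet_Ioo]
      refine lintegral_congr fun ξ => ?_
      by_cases hξ : ξ ∈ Ioo (0 : ℝ) 1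
      · rw [indicator_of_mem hξ, ENNReal.ofReal_mul (sq_nonneg ξ), ← hsec ξ hξ,
          ← setLIntegral_const, ← lintegral_indicator (measurable_prodMk_left hAm)]
        rfl
      · rw [indicator_of_notMem hξ]
        symm
        refine lintegral_eq_zero_of_ae_eq_zero (Eventually.of_forall fun w => ?_)
        exact indicator_of_notMem (fun hm => hξ hm.1) _
    · filter_upwards [ae_restrict_mem measurableSet_Ioo] with ξ hξ
      exact mul_nonneg (sq_nonneg ξ) (hV ξ hξ).1
    · exact (continuous_pow 2).aestronglyMeasurable.mul hVm
  rw [hL, lintegral_lintegral_swap (f := fun ξ w => F (ξ, w)) hFm.aemeasurable, integral_eq_lintegral_of_nonneg_ae]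
  · congr 1
    rw [← lintegral_indicator measurableSet_Ioi]
    refine lintegral_congr fun w => ?_
    by_cases hw : w ∈ Ioi (0 : ℝ)
    · rw [indicator_of_mem hw]
      have hM0 : 0 < M w := hn.trans_le (hMn w)
      have hq1 : N b 1 / M w ≤ 1 := (div_le_one hM0).2 (hMn w)
      have hq0 : 0 < N b 1 / M w := div_pos hn hM0
      have hind : ∀ ξ, F (ξ, w)
          = (Ioo 0 (N b 1 / M w)).indicator (fun ξ => ENNReal.ofReal (ξ ^ 2)) ξ := by
        intro ξ
        have hiff : (ξ, w) ∈ A ↔ ξ ∈ Ioo 0 (N b 1 / M w) := by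
          simp only [hA, mem_ofPred_eq, mem_Ioo, lt_div_iff₀ hM0]
          constructor
          · rintro ⟨h1, -, h2⟩; exact ⟨h1.1, h2⟩
          · rintro ⟨h1, h2⟩
            exact ⟨⟨h1, ((lt_div_iff₀ hM0).2 h2).trans_le hq1⟩, hw, h2⟩
        by_cases hm : (ξ, w) ∈ A
        · rw [hF, indicator_of_mem hm, indicator_of_mem (hiff.1 hm)]
        · rw [hF, indicator_of_notMem hm, indicator_of_notMem (fun h' => hm (hiff.2 h'))]
      simp_rw [hind]
      rw [lintegral_indicator measurableSet_Ioo, ← ofReal_integral_eq_lintegral_ofReal]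
      · rw [← integral_Ioc_eq_integral_Ioo, ← intervalIntegral.integral_of_le hq0.le, integral_pow]
        norm_num [hM]
      · exact (continuous_pow 2).integrableOn_Icc.mono_set Ioo_subset_Icc_self
      · exact Eventually.of_forall fun ξ => sq_nonneg ξ
    · rw [indicator_of_notMem hw]
      exact lintegral_eq_zero_of_ae_eq_zero (Eventually.of_forall fun ξ =>
        indicator_of_notMem (fun hm => hw hm.2.1) _)
  · exact Eventually.of_forall fun w => by
      have := hn.trans_le (hMn w)
      simp only [Pi.zero_apply]
      positivity
  · exact (((continuous_const.div hMc fun w => (hn.trans_le (hMn w)).ne').pow 3).div_const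
      3).aestronglyMeasurable

end IsAbsoluteNorm

lemma amoebaPhi_one (ν : ℝ → ℝ) {y : ℝ} (hy : 0 ≤ y) : amoebaPhi ν y 1 = ν y := by
  simp [amoebaPhi, abs_of_nonneg hy]

/-- The inverse of an amoeba profile on values above `1`. -/
lemma IsAmoebaProfile.lt_invFunOn_iff {ν : ℝ → ℝ} (hν : IsAmoebaProfile ν) {r : ℝ} (hr : 1 < r) :
    0 ≤ Function.invFunOn ν (Ici 0) r ∧
      ∀ y, 0 ≤ y → (y < Function.invFunOn ν (Ici 0) r ↔ ν y < r) := by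
  have h := hν.isAbsoluteNorm
  have hex : ∃ y ∈ Ici (0 : ℝ), ν y = r := by
    have hr0 : 0 ≤ r := by linarith
    have hc : ContinuousOn ν (Icc 0 r) :=
      (h.continuous_comp continuous_id continuous_const).continuousOn.congr
        fun y hy => (amoebaPhi_one ν hy.1).symm
    have hle : r ≤ ν r := by
      rw [← amoebaPhi_one ν hr0]; exact (le_abs_self r).trans (h.abs_left_le r 1)
    obtain ⟨y, hy, hyr⟩ := intermediate_value_Icc hr0 hc ⟨hν.map_zero.le.trans hr.le, hle⟩
    exact ⟨y, hy.1, hyr⟩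
  have hi0 : 0 ≤ Function.invFunOn ν (Ici 0) r := Function.invFunOn_mem hex
  have hir : ν (Function.invFunOn ν (Ici 0) r) = r := Function.invFunOn_eq hex
  refine ⟨hi0, fun y hy => ⟨fun hlt => ?_, fun hlt => ?_⟩⟩
  · set i := Function.invFunOn ν (Ici 0) r
    have hip : 0 < i := hy.trans_lt hlt
    have hl1 : y / i < 1 := (div_lt_one hip).2 hlt
    -- Convexity yields the strict inequality: y < i lies on the chord from 0, where ν is 1 < r, to
    -- i, where ν is r. Weak monotonicity alone would not exclude a plateau at height r.
    have hc := h.convex (l := y / i) (by positivity) hl1.le 0 1 i 1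
    rw [amoebaPhi_one ν hi0, hir, h.zero_left, abs_one] at hc
    have e : amoebaPhi ν ((1 - y / i) * 0 + y / i * i) ((1 - y / i) * 1 + y / i * 1) = ν y := by
      rw [← amoebaPhi_one ν hy]
      congr 1
      · field_simp; ring
      · ring
    rw [e] at hc
    nlinarith
  · by_contra hle
    have := hν.monotoneOn hi0 hy (not_lt.1 hle)
    linarith

/-- The edge-stopping function is a moment of the amoeba of a linear function. -/
lemma IsAmoebaProfile.edgeStopping_eq {ν : ℝ → ℝ} (hν : IsAmoebaProfile ν) {β : ℝ} (hβ : 0 < β)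
    {z : ℝ} (hz : 0 ≤ z) : edgeStopping ν β z = ballMoment (amoebaPhi ν) (β * z) := by
  have h := hν.isAbsoluteNorm
  rcases hz.eq_or_lt with rfl | hz
  · simp [edgeStopping, h.ballMoment_zero]
  set b : ℝ := 1 / (β * z) with hbdef
  have hb : 0 < b := by positivity
  have hn1 : 1 ≤ ν b := by rw [← hν.map_zero]; exact hν.monotoneOn (by simp) hb.le hb.le
  have hV : ∀ ξ ∈ Ioo (0 : ℝ) 1,
      0 ≤ √((Function.invFunOn ν (Ici 0) (1 / ξ * ν b)) ^ 2 - 1 / (β ^ 2 * z ^ 2)) ∧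
      ∀ w : ℝ, 0 < w →
        (w < √((Function.invFunOn ν (Ici 0) (1 / ξ * ν b)) ^ 2 - 1 / (β ^ 2 * z ^ 2)) ↔
          ξ * amoebaPhi ν √(w ^ 2 + b ^ 2) 1 < amoebaPhi ν b 1) := by
    intro ξ hξ
    refine ⟨Real.sqrt_nonneg _, fun w hw => ?_⟩
    have hr : 1 < 1 / ξ * ν b := by
      have : 1 < 1 / ξ := by rw [lt_div_iff₀ hξ.1]; linarith [hξ.2]
      nlinarith
    obtain ⟨hi0, hi⟩ := hν.lt_invFunOn_iff hr
    have hb2 : 1 / (β ^ 2 * z ^ 2) = b ^ 2 := by rw [hbdef]; field_simp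
    rw [Real.lt_sqrt hw.le, hb2, lt_sub_iff_add_lt, ← Real.sqrt_lt' (lt_of_le_of_ne hi0 ?_), hi _
      (Real.sqrt_nonneg _), amoebaPhi_one ν (Real.sqrt_nonneg _), amoebaPhi_one ν hb.le,
      div_mul_eq_mul_div, one_mul, lt_div_iff₀ hξ.1, mul_comm]
    intro h0
    have := (hi 0 le_rfl).2 (by rwa [hν.map_zero])
    linarith
  have key := h.integral_sq_mul_eq hb hV
  rw [edgeStopping, if_neg hz.ne', key, ballMoment]
  -- Substitute w = by. As b = 1/(βz), homogeneity turns N(b√(1+y²), 1) into b N(√(1+y²), βz).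
  have hsub := integral_comp_mul_left_Ioi
    (fun w => (amoebaPhi ν b 1 / amoebaPhi ν √(w ^ 2 + b ^ 2) 1) ^ 3 / 3) 0 hb
  rw [mul_zero, smul_eq_mul] at hsub
  have hval : ∀ y : ℝ, (amoebaPhi ν b 1 / amoebaPhi ν √((b * y) ^ 2 + b ^ 2) 1) ^ 3 / 3
      = (ν b ^ 3 / (3 * b ^ 3)) * (amoebaPhi ν (slopeWeight y) (β * z) ^ 3)⁻¹ := by
    intro y
    have e1 : √((b * y) ^ 2 + b ^ 2) = b * slopeWeight y := by
      rw [slopeWeight, show (b * y) ^ 2 + b ^ 2 = b ^ 2 * (1 + y ^ 2) by ring,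
        Real.sqrt_mul (sq_nonneg b), Real.sqrt_sq hb.le]
    have e2 : amoebaPhi ν (b * slopeWeight y) 1 = b * amoebaPhi ν (slopeWeight y) (β * z) := by
      rw [← h.mul_left_of_nonneg hb.le]
      congr 1
      rw [hbdef]; field_simp
    have := h.slope_pos y (β * z)
    rw [e1, e2, amoebaPhi_one ν hb.le]
    field_simp
  simp only [hval, integral_const_mul] at hsub
  have hI : ∫ w in Ioi (0 : ℝ), (amoebaPhi ν b 1 / amoebaPhi ν √(w ^ 2 + b ^ 2) 1) ^ 3 / 3
      = b * ((ν b ^ 3 / (3 * b ^ 3)) *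
        ∫ y in Ioi (0 : ℝ), (amoebaPhi ν (slopeWeight y) (β * z) ^ 3)⁻¹) := by
    rw [hsub, mul_inv_cancel_left₀ hb.ne']
  rw [hI, ← hbdef, show β ^ 2 * z ^ 2 = (b ^ 2)⁻¹ by rw [hbdef]; field_simp]
  have : ν b ≠ 0 := by positivity
  field_simp

/-! ### Integration tools: scaling, signed lengths, rays in a half plane -/

lemma eventually_lt_of_hasDerivAt_pos {f : ℝ → ℝ} {d x : ℝ} (h : HasDerivAt f d x) (hd : 0 < d) :
    ∀ᶠ r in 𝓝[>] x, f x < f r := by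
  have h1 := (hasDerivWithinAt_iff_tendsto_slope' self_notMem_Ioi).1 (h.hasDerivWithinAt (s := Ioi x))
  filter_upwards [h1.eventually (lt_mem_nhds hd), self_mem_nhdsWithin] with r hr hxr
  have hxr' : 0 < r - x := sub_pos.2 hxr
  rw [slope_def_field, lt_div_iff₀ hxr', zero_mul] at hr
  linarith

lemma integral_eq_mul_integral_affine (f : ℝ → ℝ) (m : ℝ) {k : ℝ} (hk : 0 < k) :
    ∫ s, f s = k * ∫ x, f (m + k * x) := by
  have h1 := Measure.integral_comp_mul_left (fun s => f (m + s)) k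
  rw [integral_add_left_eq_self f m, abs_of_pos (inv_pos.2 hk), smul_eq_mul] at h1
  rw [h1, mul_inv_cancel_left₀ hk.ne']

lemma integral_prod_scale_fst (f : ℝ × ℝ → ℝ) {k : ℝ} (hk : 0 < k) :
    ∫ v, f v = k * ∫ v : ℝ × ℝ, f (k * v.1, v.2) := by
  let e : ℝ × ℝ ≃ₜ ℝ × ℝ := (Homeomorph.mulLeft₀ k hk.ne').prodCongr (Homeomorph.refl ℝ)
  have hmap : Measure.map e volume = ENNReal.ofReal k⁻¹ • (volume : Measure (ℝ × ℝ)) := by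
    have h1 : (e : ℝ × ℝ → ℝ × ℝ) = Prod.map (k * ·) id := rfl
    rw [h1, Measure.volume_eq_prod, ← Measure.map_prod_map _ _ (measurable_const_mul k) measurable_id,
      Real.map_volume_mul_left hk.ne', Measure.map_id, abs_of_pos (inv_pos.2 hk),
      Measure.prod_smul_left]
  have h2 := e.measurableEmbedding.integral_map (μ := volume) f
  rw [hmap, integral_smul_measure, ENNReal.toReal_ofReal (inv_pos.2 hk).le, smul_eq_mul] at h2
  have h3 : ∫ v : ℝ × ℝ, f (k * v.1, v.2) = ∫ v, f (e v) := rfl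
  rw [h3, ← h2, mul_inv_cancel_left₀ hk.ne']

/-- Up to sign the integrand is the indicator of the interval between 0 and k, counted negatively
when k > 0. This measures the width of the strip between a level line and the axis; the next lemma
does the same for the displacement of a boundary point on a ray. -/
lemma integral_indicator_Ioi_sub (k : ℝ) :
    ∫ w : ℝ, ((Ioi k).indicator 1 w - (Ioi (0 : ℝ)).indicator 1 w) = -k := by
  have e : ∀ w : ℝ, ((Ioi k).indicator (1 : ℝ → ℝ) w - (Ioi (0 : ℝ)).indicator 1 w)
      = (Ioc k 0).indicator 1 w - (Ioc 0 k).indicator 1 w := by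
    intro w
    simp only [indicator_apply, mem_Ioi, mem_Ioc, Pi.one_apply]
    split_ifs <;> grind
  simp_rw [e]
  rw [integral_sub, integral_indicator_one measurableSet_Ioc, integral_indicator_one measurableSet_Ioc,
    Real.volume_real_Ioc, Real.volume_real_Ioc]
  · rcases le_total 0 k with h | h
    · rw [max_eq_right (by linarith), max_eq_left (by linarith)]; ring
    · rw [max_eq_left (by linarith), max_eq_right (by linarith)]; ring
  · exact (integrable_indicator_iff measurableSet_Ioc).2 (by simp [integrableOn_const_iff, Pi.one_def])
  · exact (integrable_indicator_iff measurableSet_Ioc).2 (by simp [integrableOn_const_iff, Pi.one_def])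

lemma integral_indicator_Iio_sub (k : ℝ) :
    ∫ w : ℝ, ((Iio k).indicator 1 w - (Iic (0 : ℝ)).indicator 1 w) = k := by
  have h := integral_indicator_Ioi_sub (-k)
  rw [neg_neg, ← integral_neg_eq_self] at h
  refine (integral_congr_ae ?_).trans h
  filter_upwards [Measure.ae_ne volume (0 : ℝ)] with w hw
  have hle : w ≤ 0 ↔ w < 0 := hw.le_iff_lt
  simp only [indicator_apply, mem_Ioi, mem_Iio, mem_Iic, Pi.one_apply, neg_lt_neg_iff,
    neg_pos, hle]

/-- Integration over a half plane in the coordinates `(s, y) ↦ (s, s y)`. -/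
lemma integral_halfPlane {f : ℝ × ℝ → ℝ} (hf : Integrable f) (hf0 : ∀ v : ℝ × ℝ, v.1 ≤ 0 → f v = 0) :
    Integrable (fun y => ∫ s in Ioi (0 : ℝ), s * f (s, s * y)) ∧
      ∫ v, f v = ∫ y, ∫ s in Ioi (0 : ℝ), s * f (s, s * y) := by
  set U : Set (ℝ × ℝ) := Ioi 0 ×ˢ univ with hU
  have hUm : MeasurableSet U := measurableSet_Ioi.prod MeasurableSet.univ
  let Φ : ℝ × ℝ → ℝ × ℝ := fun p => (p.1, p.1 * p.2)
  let Φ' : ℝ × ℝ → ℝ × ℝ →L[ℝ] ℝ × ℝ := fun p => LinearMap.toContinuousLinearMap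
    (Matrix.toLin (Module.Basis.finTwoProd ℝ) (Module.Basis.finTwoProd ℝ) !![1, 0; p.2, p.1])
  have hder : ∀ p ∈ U, HasFDerivWithinAt Φ (Φ' p) U p := by
    intro p _
    refine HasFDerivAt.hasFDerivWithinAt ?_
    have : Φ' p = (ContinuousLinearMap.fst ℝ ℝ ℝ).prod
        (p.1 • ContinuousLinearMap.snd ℝ ℝ ℝ + p.2 • ContinuousLinearMap.fst ℝ ℝ ℝ) := by
      simp only [Φ', Matrix.toLin_finTwoProd_toContinuousLinearMap]
      ext <;> simp
    rw [this]
    exact hasFDerivAt_fst.prodMk (hasFDerivAt_fst.mul hasFDerivAt_snd)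
  have hinj : InjOn Φ U := by
    rintro ⟨s, y⟩ ⟨hs, -⟩ ⟨s', y'⟩ - he
    simp only [Φ, Prod.mk.injEq] at he
    obtain ⟨rfl, h2⟩ := he
    rw [mul_right_inj' (ne_of_gt hs)] at h2
    rw [h2]
  have himg : Φ '' U = U := by
    ext ⟨s, t⟩
    constructor
    · rintro ⟨⟨s', y⟩, ⟨hs, -⟩, he⟩
      simp only [Φ, Prod.mk.injEq] at he
      exact ⟨he.1 ▸ hs, trivial⟩
    · rintro ⟨hs, -⟩
      exact ⟨(s, t / s), ⟨hs, trivial⟩, by simp [Φ, mul_div_cancel₀ _ (show s ≠ 0 from ne_of_gt hs)]⟩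
  have hdet : ∀ p, (Φ' p).det = p.1 := by
    intro p
    simp [Φ', ContinuousLinearMap.det, Matrix.det_fin_two]
  have h1 := (integrableOn_image_iff_integrableOn_abs_det_fderiv_smul volume hUm hder hinj f).1
    hf.integrableOn
  have h2 := integral_image_eq_integral_abs_det_fderiv_smul volume hUm hder hinj f
  have hcongr : ∀ p ∈ U, |(Φ' p).det| • f (Φ p) = p.1 * f (p.1, p.1 * p.2) := by
    intro p hp
    rw [hdet, abs_of_pos hp.1, smul_eq_mul]
  rw [himg, setIntegral_congr_fun hUm hcongr, setIntegral_eq_integral_of_forall_compl_eq_zero] at h2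
  swap
  · intro v hv
    exact hf0 v (not_lt.1 fun h => hv ⟨h, trivial⟩)
  rw [integrableOn_congr_fun hcongr hUm, IntegrableOn, Measure.volume_eq_prod, hU,
    ← Measure.prod_restrict, Measure.restrict_univ] at h1
  refine ⟨h1.integral_prod_right, ?_⟩
  rw [h2, Measure.volume_eq_prod, hU, ← Measure.prod_restrict, Measure.restrict_univ,
    integral_prod_symm _ h1]

/-- The Euclidean norm on `ℝ × ℝ`. -/
noncomputable def planeNorm (v : ℝ × ℝ) : ℝ := √(v.1 ^ 2 + v.2 ^ 2)

lemma continuous_planeNorm : Continuous planeNorm := by unfold planeNorm; fun_prop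

lemma planeNorm_sq (v : ℝ × ℝ) : planeNorm v ^ 2 = v.1 ^ 2 + v.2 ^ 2 := Real.sq_sqrt (by positivity)

lemma planeNorm_nonneg (v : ℝ × ℝ) : 0 ≤ planeNorm v := Real.sqrt_nonneg _

lemma abs_fst_le_planeNorm (v : ℝ × ℝ) : |v.1| ≤ planeNorm v :=
  Real.abs_le_sqrt (by nlinarith [sq_nonneg v.2])

lemma abs_snd_le_planeNorm (v : ℝ × ℝ) : |v.2| ≤ planeNorm v :=
  Real.abs_le_sqrt (by nlinarith [sq_nonneg v.1])

lemma planeNorm_slope {s : ℝ} (hs : 0 ≤ s) (y : ℝ) : planeNorm (s, s * y) = s * slopeWeight y := by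
  rw [planeNorm, slopeWeight, show s ^ 2 + (s * y) ^ 2 = s ^ 2 * (1 + y ^ 2) by ring,
    Real.sqrt_mul (sq_nonneg s), Real.sqrt_sq hs]

lemma eventually_pos_le_one_mul_le_one (k : ℝ) :
    ∀ᶠ r in 𝓝[>] (0 : ℝ), 0 < r ∧ r ≤ 1 ∧ k * r ≤ 1 := by
  have h1 : ∀ᶠ r in 𝓝 (0 : ℝ), r < 1 := gt_mem_nhds one_pos
  have h2 : ∀ᶠ r in 𝓝 (0 : ℝ), k * r < 1 :=
    (continuous_const_mul k).continuousAt.eventually (gt_mem_nhds (by simp))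
  filter_upwards [self_mem_nhdsWithin, nhdsWithin_le_nhds h1, nhdsWithin_le_nhds h2] with r a b c
  exact ⟨a, b.le, c.le⟩

lemma ae_fst_ne_comp_snd {k : ℝ → ℝ} (hk : Continuous k) : ∀ᵐ p : ℝ × ℝ, p.1 ≠ k p.2 := by
  rw [ae_iff]
  have hm : MeasurableSet {p : ℝ × ℝ | ¬ p.1 ≠ k p.2} := by
    simp only [ne_eq, not_not]
    exact (isClosed_eq continuous_fst (hk.comp continuous_snd)).measurableSet
  rw [Measure.volume_eq_prod, Measure.prod_apply_symm hm]
  simp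

/-! ### The model amoeba, and the strip between level line and axis -/

/-- The data of a second-order model of an image at a regular point: the (scaled) gradient `slope`
along the first axis, the coefficients of the Hessian form, and two parameters for the model of the
amoeba metric: the gauge averages the values for two points placed symmetrically at
distance `spread` from the middle of a segment, and is lowered by a third-order `shift`. -/
structure QuadraticModel where
  slope : ℝ
  a : ℝ
  b : ℝ
  c : ℝ
  spread : ℝ
  shift : ℝ

namespace QuadraticModel

/-- The Hessian form. -/
def quad (D : QuadraticModel) (v : ℝ × ℝ) : ℝ := D.a * v.1 ^ 2 + 2 * D.b * v.1 * v.2 + D.c * v.2 ^ 2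

/-- A bound for the Hessian form. -/
def quadBound (D : QuadraticModel) : ℝ := |D.a| + 2 * |D.b| + |D.c|

/-- The rescaled amoeba distance from the origin, up to third-order terms. -/
noncomputable def gauge (D : QuadraticModel) (N : ℝ → ℝ → ℝ) (r : ℝ) (v : ℝ × ℝ) : ℝ :=
  (N (planeNorm v) (D.slope * v.1 + r * ((1 / 2 - D.spread) * D.quad v)) +
    N (planeNorm v) (D.slope * v.1 + r * ((1 / 2 + D.spread) * D.quad v))) / 2 - D.shift * r ^ 2

/-- The rescaled difference of the image and the level `r M + r² M'`. -/
noncomputable def level (D : QuadraticModel) (M M' r : ℝ) (v : ℝ × ℝ) : ℝ :=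
  D.slope * v.1 + r * (D.quad v / 2) - r * (M + M' * r)

/-- The model amoeba. -/
def ball (D : QuadraticModel) (N : ℝ → ℝ → ℝ) (r : ℝ) : Set (ℝ × ℝ) := {v | D.gauge N r v ≤ 1}

variable {D : QuadraticModel} {N : ℝ → ℝ → ℝ}

lemma quadBound_nonneg : 0 ≤ D.quadBound := by unfold quadBound; positivity

lemma continuous_quad : Continuous D.quad := by unfold quad; fun_prop

lemma abs_quad_le (v : ℝ × ℝ) : |D.quad v| ≤ D.quadBound * planeNorm v ^ 2 := by
  have h1 := abs_fst_le_planeNorm v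
  have h2 := abs_snd_le_planeNorm v
  have h0 := planeNorm_nonneg v
  have e1 : v.1 ^ 2 ≤ planeNorm v ^ 2 := by rw [← sq_abs]; gcongr
  have e2 : v.2 ^ 2 ≤ planeNorm v ^ 2 := by rw [← sq_abs]; gcongr
  have e3 : |v.1| * |v.2| ≤ planeNorm v ^ 2 := by rw [sq]; gcongr
  have t := abs_add_three (D.a * v.1 ^ 2) (2 * D.b * v.1 * v.2) (D.c * v.2 ^ 2)
  simp only [abs_mul, abs_pow, sq_abs, abs_two] at t
  unfold quad quadBound
  nlinarith [mul_le_mul_of_nonneg_left e1 (abs_nonneg D.a),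
    mul_le_mul_of_nonneg_left e2 (abs_nonneg D.c), mul_le_mul_of_nonneg_left e3 (abs_nonneg D.b)]

lemma continuous_gauge (h : IsAbsoluteNorm N) :
    Continuous fun p : ℝ × (ℝ × ℝ) => D.gauge N p.1 p.2 := by
  have h1 := continuous_planeNorm
  have h2 : Continuous D.quad := continuous_quad
  unfold gauge
  exact (((h.continuous_comp (by fun_prop) (by fun_prop)).add
    (h.continuous_comp (by fun_prop) (by fun_prop))).div_const 2).sub (by fun_prop)

lemma continuous_level (M M' : ℝ) :
    Continuous fun p : ℝ × (ℝ × ℝ) => D.level M M' p.1 p.2 := by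
  have h2 : Continuous D.quad := continuous_quad
  unfold level
  fun_prop

lemma measurableSet_ball (h : IsAbsoluteNorm N) (r : ℝ) : MeasurableSet (D.ball N r) :=
  (isClosed_le ((continuous_gauge h).comp (continuous_const.prodMk continuous_id))
    continuous_const).measurableSet

lemma measurableSet_level (M M' r : ℝ) : MeasurableSet {v | 0 < D.level M M' r v} :=
  (isOpen_lt continuous_const
    ((continuous_level M M').comp (continuous_const.prodMk continuous_id))).measurableSet

lemma measurableSet_fst_pos : MeasurableSet {v : ℝ × ℝ | 0 < v.1} :=
  (isOpen_lt continuous_const continuous_fst).measurableSet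

lemma planeNorm_le_gauge (h : IsAbsoluteNorm N) (r : ℝ) (v : ℝ × ℝ) :
    planeNorm v ≤ D.gauge N r v + D.shift * r ^ 2 := by
  have h1 := (le_abs_self _).trans (h.abs_left_le (planeNorm v)
    (D.slope * v.1 + r * ((1 / 2 - D.spread) * D.quad v)))
  have h2 := (le_abs_self _).trans (h.abs_left_le (planeNorm v)
    (D.slope * v.1 + r * ((1 / 2 + D.spread) * D.quad v)))
  unfold gauge
  linarith

/-- N is 1-Lipschitz in its second argument, and the bound on the spread keeps both weights 1/2 ±
spread in [0, 1]. -/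
lemma abs_gauge_sub_le (h : IsAbsoluteNorm N) (hD : |D.spread| ≤ 1 / 2) {r : ℝ} (hr : 0 ≤ r)
    (v : ℝ × ℝ) :
    |D.gauge N r v - N (planeNorm v) (D.slope * v.1)| ≤ r * |D.quad v| + |D.shift| * r ^ 2 := by
  have hs := abs_le.1 hD
  have h1 : ∀ l : ℝ, 0 ≤ l → l ≤ 1 → |N (planeNorm v) (D.slope * v.1 + r * (l * D.quad v))
      - N (planeNorm v) (D.slope * v.1)| ≤ r * |D.quad v| := by
    intro l hl0 hl1
    refine (h.abs_sub_right_le _ _ _).trans ?_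
    rw [add_sub_cancel_left, abs_mul, abs_mul, abs_of_nonneg hr, abs_of_nonneg hl0]
    exact mul_le_mul_of_nonneg_left (mul_le_of_le_one_left (abs_nonneg _) hl1) hr
  have e1 := abs_le.1 (h1 (1 / 2 - D.spread) (by linarith) (by linarith))
  have e2 := abs_le.1 (h1 (1 / 2 + D.spread) (by linarith) (by linarith))
  have e3 : |D.shift * r ^ 2| = |D.shift| * r ^ 2 := by rw [abs_mul, abs_of_nonneg (sq_nonneg r)]
  have e4 := abs_le.1 e3.le
  unfold gauge
  exact abs_le.2 ⟨by linarith, by linarith⟩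

lemma planeNorm_le_two (h : IsAbsoluteNorm N) {r : ℝ} (hr0 : 0 < r) (hr1 : r ≤ 1)
    (hr : |D.shift| * r ≤ 1) {v : ℝ × ℝ} (hv : v ∈ D.ball N r) : planeNorm v ≤ 2 := by
  have h1 := planeNorm_le_gauge (D := D) h r v
  have h2 : D.gauge N r v ≤ 1 := hv
  have h3 : D.shift * r ^ 2 ≤ |D.shift| * r * r := by
    rw [sq, ← mul_assoc]
    gcongr
    exact le_abs_self _
  nlinarith

lemma abs_quad_le_of_mem (h : IsAbsoluteNorm N) {r : ℝ} (hr0 : 0 < r) (hr1 : r ≤ 1)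
    (hr : |D.shift| * r ≤ 1) {v : ℝ × ℝ} (hv : v ∈ D.ball N r) :
    |D.quad v| ≤ 4 * D.quadBound := by
  have h1 := planeNorm_le_two h hr0 hr1 hr hv
  have h2 := abs_quad_le (D := D) v
  have h3 := quadBound_nonneg (D := D)
  have h4 := planeNorm_nonneg v
  nlinarith [mul_nonneg h3 (sub_nonneg.2 (show planeNorm v ^ 2 ≤ 4 by nlinarith))]

lemma volume_ball_ne_top (h : IsAbsoluteNorm N) {r : ℝ} (hr0 : 0 < r) (hr1 : r ≤ 1)
    (hr : |D.shift| * r ≤ 1) : volume (D.ball N r) ≠ ⊤ := by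
  have hsub : D.ball N r ⊆ Icc (-2) 2 ×ˢ Icc (-2) 2 := by
    intro v hv
    have h1 := planeNorm_le_two h hr0 hr1 hr hv
    exact ⟨abs_le.1 ((abs_fst_le_planeNorm v).trans h1), abs_le.1 ((abs_snd_le_planeNorm v).trans h1)⟩
  exact measure_ne_top_of_subset hsub ((isCompact_Icc.prod isCompact_Icc).measure_lt_top).ne

/-- The contribution of the strip between the level line and the second axis. -/
theorem tendsto_volume_level_sub (h : IsAbsoluteNorm N) (hτ : 0 < D.slope)
    (M M' : ℝ) :
    Tendsto (fun r => (volume.real (D.ball N r ∩ {v | 0 < D.level M M' r v})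
      - volume.real (D.ball N r ∩ {v | 0 < v.1})) / r) (𝓝[>] 0)
      (𝓝 ((D.c / 3 - 2 * M) / D.slope)) := by
  classical
  set τ := D.slope with hτdef
  set K := D.quadBound with hK
  have hK0 : 0 ≤ K := quadBound_nonneg
  -- On the ball |quad| ≤ 4K, so for |v₁| > rR the linear term decides the sign of the level
  -- function and the two sets agree.
  set R : ℝ := (2 * K + |M| + |M'|) / τ with hR
  have hR0 : 0 ≤ R := by rw [hR]; positivity
  set F : ℝ → ℝ × ℝ → ℝ := fun r v => (D.ball N r ∩ {v | 0 < D.level M M' r v}).indicator 1 v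
    - (D.ball N r ∩ {v | 0 < v.1}).indicator 1 v with hF
  have hm1 : ∀ r, MeasurableSet (D.ball N r ∩ {v | 0 < D.level M M' r v}) := fun r =>
    (measurableSet_ball h r).inter (measurableSet_level M M' r)
  have hm2 : ∀ r, MeasurableSet (D.ball N r ∩ {v | 0 < v.1}) := fun r =>
    (measurableSet_ball h r).inter measurableSet_fst_pos
  have hsmall := eventually_pos_le_one_mul_le_one |D.shift|
  -- The strip has width of order r. Stretching the first coordinate by 1/r makes the width of order
  -- one and absorbs the division by r.
  have hlhs : ∀ᶠ r in 𝓝[>] (0 : ℝ), ∫ p : ℝ × ℝ, F r (r * p.1, p.2)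
      = (volume.real (D.ball N r ∩ {v | 0 < D.level M M' r v})
        - volume.real (D.ball N r ∩ {v | 0 < v.1})) / r := by
    filter_upwards [hsmall] with r ⟨hr0, hr1, hr⟩
    have hfin := volume_ball_ne_top (D := D) h hr0 hr1 hr
    have h1 : ∫ v, F r v = volume.real (D.ball N r ∩ {v | 0 < D.level M M' r v})
        - volume.real (D.ball N r ∩ {v | 0 < v.1}) := by
      rw [hF, integral_sub, integral_indicator_one (hm1 r), integral_indicator_one (hm2 r)]
      · exact (integrable_indicator_iff (hm1 r)).2
          (integrableOn_const (measure_ne_top_of_subset inter_subset_left hfin))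
      · exact (integrable_indicator_iff (hm2 r)).2
          (integrableOn_const (measure_ne_top_of_subset inter_subset_left hfin))
    rw [← h1, integral_prod_scale_fst (F r) hr0, mul_div_cancel_left₀ _ hr0.ne']
  refine Tendsto.congr' hlhs ?_
  -- To leading order the level line is v₁ = r k(v₂).
  set k : ℝ → ℝ := fun y => (M - D.c * y ^ 2 / 2) / τ with hk
  have hkc : Continuous k := by rw [hk]; fun_prop
  -- The limit strip ends at |v₂| = 1 for every norm N, because N(|y|, 0) = |y| on the axis.
  set g : ℝ × ℝ → ℝ := fun p => (Ioo (-1) 1).indicator 1 p.2 *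
    ((Ioi (k p.2)).indicator 1 p.1 - (Ioi (0 : ℝ)).indicator 1 p.1) with hg
  set bound : ℝ × ℝ → ℝ := (Icc (-R) R ×ˢ Icc (-2) 2).indicator 1 with hbound
  have hbint : Integrable bound := by
    refine (integrable_indicator_iff (measurableSet_Icc.prod measurableSet_Icc)).2
      (integrableOn_const ?_)
    exact ((isCompact_Icc.prod isCompact_Icc).measure_lt_top).ne
  have hgval : ∫ p, g p = (D.c / 3 - 2 * M) / τ := by
    have hgm : Measurable g := by
      have e1 : (fun p : ℝ × ℝ => (Ioi (k p.2)).indicator (1 : ℝ → ℝ) p.1)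
          = {p : ℝ × ℝ | k p.2 < p.1}.indicator 1 := by
        ext p; simp [indicator_apply]
      have e2 : Measurable fun p : ℝ × ℝ => (Ioi (k p.2)).indicator (1 : ℝ → ℝ) p.1 := by
        rw [e1]
        exact measurable_one.indicator
          (isOpen_lt (hkc.comp continuous_snd) continuous_fst).measurableSet
      exact ((measurable_one.indicator measurableSet_Ioo).comp measurable_snd).mul
        (e2.sub ((measurable_one.indicator measurableSet_Ioi).comp measurable_fst))
    have hgint : Integrable g := by
      refine hbint.mono' hgm.aestronglyMeasurable (Eventually.of_forall fun p => ?_)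
      have hb0 : 0 ≤ bound p := indicator_nonneg (fun _ _ => zero_le_one) _
      by_cases hy : p.2 ∈ Ioo (-1 : ℝ) 1
      swap
      · simp only [hg, indicator_of_notMem hy, zero_mul, norm_zero]; exact hb0
      have hkR : |k p.2| ≤ R := by
        rw [hk, hR, abs_div, abs_of_pos hτ]
        gcongr
        have hc : |D.c| ≤ K := by rw [hK, quadBound]; linarith [abs_nonneg D.a, abs_nonneg D.b]
        have hy2 : p.2 ^ 2 ≤ 1 := by nlinarith [hy.1, hy.2]
        have h1 := abs_sub M (D.c * p.2 ^ 2 / 2)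
        rw [abs_div, abs_mul, abs_of_nonneg (sq_nonneg p.2), abs_two] at h1
        nlinarith [abs_nonneg D.c, abs_nonneg M', mul_le_mul_of_nonneg_left hy2 (abs_nonneg D.c)]
      by_cases hw : p.1 ∈ Icc (-R) R
      · have hp : p ∈ Icc (-R) R ×ˢ Icc (-2 : ℝ) 2 :=
          ⟨hw, by constructor <;> linarith [hy.1, hy.2]⟩
        rw [hbound, indicator_of_mem hp, hg]
        simp only [indicator_of_mem hy, Pi.one_apply, one_mul, indicator_apply]
        split_ifs <;> norm_num
      · have : g p = 0 := by
          have hkR' := abs_le.1 hkR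
          simp only [hg, indicator_apply, hy, if_true, Pi.one_apply, one_mul, mem_Ioi]
          rw [mem_Icc, not_and_or, not_le, not_le] at hw
          rcases hw with hw | hw
          · rw [if_neg (by linarith), if_neg (by linarith)]; simp
          · rw [if_pos (by linarith), if_pos (by linarith)]; simp
        rw [this, norm_zero]; exact hb0
    rw [Measure.volume_eq_prod] at hgint ⊢
    rw [integral_prod_symm g hgint]
    simp only [hg, integral_const_mul, integral_indicator_Ioi_sub]
    have e : ∀ y, (Ioo (-1 : ℝ) 1).indicator 1 y * -k y
        = (Ioo (-1 : ℝ) 1).indicator (fun y => -k y) y := fun y => by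
      simp only [indicator_apply]; split_ifs <;> simp
    simp only [e]
    rw [integral_indicator measurableSet_Ioo, ← integral_Ioc_eq_integral_Ioo,
      ← intervalIntegral.integral_of_le (by norm_num)]
    have e2 : ∀ y, -k y = (D.c / (2 * τ)) * y ^ 2 - M / τ := fun y => by rw [hk]; field_simp; ring
    simp only [e2]
    rw [intervalIntegral.integral_sub (by apply Continuous.intervalIntegrable; fun_prop)
      (by simp), intervalIntegral.integral_const_mul, integral_pow]
    simp
    field_simp
    ring
  rw [← hgval]
  refine tendsto_integral_filter_of_dominated_convergence bound ?_ ?_ hbint ?_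
  · refine Eventually.of_forall fun r => Measurable.aestronglyMeasurable ?_
    exact ((measurable_one.indicator (hm1 r)).sub (measurable_one.indicator (hm2 r))).comp
      (by fun_prop)
  · filter_upwards [hsmall] with r ⟨hr0, hr1, hr⟩
    refine Eventually.of_forall fun p => ?_
    set v : ℝ × ℝ := (r * p.1, p.2) with hv
    by_cases hmem : v ∈ D.ball N r
    swap
    · have h1 : F r v = 0 := by
        simp only [hF]
        rw [indicator_of_notMem (fun hm => hmem hm.1), indicator_of_notMem (fun hm => hmem hm.1),
          sub_zero]
      rw [h1, norm_zero]
      exact indicator_nonneg (fun _ _ => zero_le_one) _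
    by_cases hp : p ∈ Icc (-R) R ×ˢ Icc (-2 : ℝ) 2
    · rw [hbound, indicator_of_mem hp]
      simp only [hF, indicator_apply, Pi.one_apply]
      split_ifs <;> norm_num
    have hy : p.2 ∈ Icc (-2 : ℝ) 2 :=
      abs_le.1 ((abs_snd_le_planeNorm v).trans (planeNorm_le_two h hr0 hr1 hr hmem))
    have hw : R < |p.1| := by
      by_contra hcon
      exact hp ⟨abs_le.1 (not_lt.1 hcon), hy⟩
    have hq := abs_quad_le_of_mem h hr0 hr1 hr hmem
    have hiff : 0 < D.level M M' r v ↔ 0 < v.1 := by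
      have e1 : D.level M M' r v = r * (τ * p.1 + (D.quad v / 2 - (M + M' * r))) := by
        simp only [level, hv]; ring
      have e2 : |D.quad v / 2 - (M + M' * r)| ≤ τ * R := by
        have t1 := abs_sub (D.quad v / 2) (M + M' * r)
        have t2 := abs_add_le M (M' * r)
        rw [abs_div, abs_two] at t1
        rw [abs_mul, abs_of_pos hr0] at t2
        have t3 : |M'| * r ≤ |M'| := mul_le_of_le_one_right (abs_nonneg _) hr1
        rw [hR, mul_div_cancel₀ _ hτ.ne']
        linarith
      have e3 := abs_le.1 e2
      rw [e1, mul_pos_iff_of_pos_left hr0]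
      simp only [hv]
      rw [mul_pos_iff_of_pos_left hr0]
      rcases lt_abs.1 hw with h1 | h1
      · exact ⟨fun _ => by linarith, fun _ => by nlinarith⟩
      · exact ⟨fun _ => by nlinarith, fun _ => by nlinarith⟩
    have h1 : F r v = 0 := by
      simp only [hF, indicator_apply, mem_inter_iff, mem_ofPred_eq, hiff, sub_self]
    rw [h1, norm_zero]
    exact indicator_nonneg (fun _ _ => zero_le_one) _
  -- Pointwise convergence of the indicators can fail only where a limiting inequality is an
  -- equality: on |p.2| = 1 and on the limit level line, both null sets.
  · have hy1 : ∀ᵐ p : ℝ × ℝ, |p.2| ≠ 1 := by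
      have : ∀ᵐ y : ℝ, |y| ≠ 1 := by
        filter_upwards [Measure.ae_ne volume (1 : ℝ), Measure.ae_ne volume (-1 : ℝ)] with y h1 h2 h3
        rcases eq_or_eq_neg_of_abs_eq h3 with h4 | h4
        · exact h1 h4
        · exact h2 h4
      exact Measure.quasiMeasurePreserving_snd.ae this
    filter_upwards [hy1, ae_fst_ne_comp_snd hkc] with p hp1 hp2
    refine tendsto_const_nhds.congr' ?_
    have hball : Tendsto (fun r : ℝ => D.gauge N r (r * p.1, p.2)) (𝓝[>] 0) (𝓝 |p.2|) := by
      have hc : Continuous fun r : ℝ => D.gauge N r (r * p.1, p.2) :=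
        (continuous_gauge h).comp (by fun_prop : Continuous fun r : ℝ => (r, (r * p.1, p.2)))
      have h0 := hc.tendsto 0
      have e : D.gauge N 0 (0 * p.1, p.2) = |p.2| := by
        simp [gauge, planeNorm, h.zero_right, Real.sqrt_sq_eq_abs]
      rw [e] at h0
      exact h0.mono_left nhdsWithin_le_nhds
    have hlev : Tendsto (fun r : ℝ => τ * p.1 + D.quad (r * p.1, p.2) / 2 - (M + M' * r)) (𝓝[>] 0)
        (𝓝 (τ * (p.1 - k p.2))) := by
      have hc : Continuous fun r : ℝ => τ * p.1 + D.quad (r * p.1, p.2) / 2 - (M + M' * r) := by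
        have := continuous_quad (D := D)
        fun_prop
      have h0 := hc.tendsto 0
      have e : τ * p.1 + D.quad (0 * p.1, p.2) / 2 - (M + M' * 0) = τ * (p.1 - k p.2) := by
        simp only [quad, hk]; field_simp; ring
      rw [e] at h0
      exact h0.mono_left nhdsWithin_le_nhds
    have hlev' : ∀ r : ℝ, D.level M M' r (r * p.1, p.2)
        = r * (τ * p.1 + D.quad (r * p.1, p.2) / 2 - (M + M' * r)) := fun r => by
      simp only [level]; ring
    have hlev2 : ∀ᶠ r in 𝓝[>] (0 : ℝ), 0 < D.level M M' r (r * p.1, p.2) ↔ k p.2 < p.1 := by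
      rcases lt_or_gt_of_ne hp2 with hlt | hlt
      · have : τ * (p.1 - k p.2) < 0 := mul_neg_of_pos_of_neg hτ (by linarith)
        filter_upwards [hlev.eventually (gt_mem_nhds this), self_mem_nhdsWithin] with r h1 h2
        rw [hlev', mul_pos_iff_of_pos_left h2]
        exact ⟨fun h3 => absurd h3 (not_lt.2 h1.le), fun h3 => absurd h3 (not_lt.2 hlt.le)⟩
      · have : 0 < τ * (p.1 - k p.2) := mul_pos hτ (by linarith)
        filter_upwards [hlev.eventually (lt_mem_nhds this), self_mem_nhdsWithin] with r h1 h2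
        rw [hlev', mul_pos_iff_of_pos_left h2]
        exact ⟨fun _ => hlt, fun _ => h1⟩
    rcases lt_or_gt_of_ne hp1 with hlt | hlt
    · filter_upwards [hball.eventually (gt_mem_nhds hlt), hlev2, self_mem_nhdsWithin]
        with r h1 h2 (h3 : 0 < r)
      have hin : (r * p.1, p.2) ∈ D.ball N r := h1.le
      have hy : p.2 ∈ Ioo (-1 : ℝ) 1 := abs_lt.1 hlt
      simp only [hF, hg, indicator_apply, mem_inter_iff, mem_ofPred_eq, hin, true_and, h2, hy,
        mul_pos_iff_of_pos_left h3, if_true, Pi.one_apply, one_mul, mem_Ioi]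
    · filter_upwards [hball.eventually (lt_mem_nhds hlt)] with r h1
      have hin : (r * p.1, p.2) ∉ D.ball N r := fun h2 => absurd h1 (not_lt.2 h2)
      have hy : p.2 ∉ Ioo (-1 : ℝ) 1 := fun h2 => absurd (abs_lt.2 h2) (not_lt.2 hlt.le)
      simp only [hF, hg, indicator_apply, mem_inter_iff, hin, false_and, hy,
        if_false, zero_mul, sub_self]

end QuadraticModel

/-! ### The displacement of the boundary, and the expansion of the area -/

namespace QuadraticModel

variable {D : QuadraticModel} {N : ℝ → ℝ → ℝ}

/-- On the ray of slope `y`, the difference of the indicator functions of the model amoeba and of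
its limit shape, with the density of the coordinates `(s, y) ↦ (s, s y)`. -/
noncomputable def rayDiff (D : QuadraticModel) (N : ℝ → ℝ → ℝ) (r y s : ℝ) : ℝ :=
  (Ioi (0 : ℝ)).indicator (fun s => s * ((D.ball N r).indicator 1 (s, s * y)
    - (Iic (N (slopeWeight y) D.slope)⁻¹).indicator 1 s)) s

lemma measurable_rayDiff (h : IsAbsoluteNorm N) (r y : ℝ) : Measurable (D.rayDiff N r y) := by
  refine Measurable.indicator (measurable_id.mul (Measurable.sub ?_ ?_)) measurableSet_Ioi
  · exact (measurable_one.indicator (measurableSet_ball h r)).comp (by fun_prop)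
  · exact measurable_one.indicator measurableSet_Iic

lemma integral_rayDiff (h : IsAbsoluteNorm N) {r : ℝ} (hr0 : 0 < r) (hr1 : r ≤ 1)
    (hr : |D.shift| * r ≤ 1) (y : ℝ) :
    ∫ s, D.rayDiff N r y s = (∫ s in Ioi (0 : ℝ), s * (D.ball N r).indicator 1 (s, s * y))
      - (N (slopeWeight y) D.slope ^ 2)⁻¹ / 2 := by
  set s₀ := (N (slopeWeight y) D.slope)⁻¹ with hs₀
  have hs₀0 : 0 < s₀ := inv_pos.2 (h.slope_pos _ _)
  have hI : Integrable ((Icc (0 : ℝ) 2).indicator fun _ => (2 : ℝ)) :=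
    (integrable_indicator_iff measurableSet_Icc).2 (integrableOn_const measure_Icc_lt_top.ne)
  have h1 : IntegrableOn (fun s => s * (D.ball N r).indicator (1 : ℝ × ℝ → ℝ) (s, s * y))
      (Ioi 0) := by
    refine hI.integrableOn.mono' ?_ ?_
    · exact (measurable_id.mul ((measurable_one.indicator (measurableSet_ball h r)).comp
        (by fun_prop : Measurable fun s : ℝ => (s, s * y)))).aestronglyMeasurable
    · filter_upwards [ae_restrict_mem measurableSet_Ioi] with s (hs : 0 < s)
      by_cases hm : (s, s * y) ∈ D.ball N r
      · have h2 : s ≤ 2 := (le_abs_self _).trans ((abs_fst_le_planeNorm (s, s * y)).trans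
          (planeNorm_le_two h hr0 hr1 hr hm))
        rw [indicator_of_mem hm, indicator_of_mem (show s ∈ Icc (0 : ℝ) 2 from ⟨hs.le, h2⟩),
          Pi.one_apply, mul_one, Real.norm_of_nonneg hs.le]
        exact h2
      · rw [indicator_of_notMem hm, mul_zero, norm_zero]
        exact indicator_nonneg (fun _ _ => by norm_num) _
  have e2 : ∀ s : ℝ, s * (Iic s₀).indicator 1 s = (Iic s₀).indicator (fun s => s) s := fun s => by
    simp only [indicator_apply, Pi.one_apply]; split_ifs <;> simp
  have hIoc : IntegrableOn (fun s : ℝ => s) (Ioc 0 s₀) :=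
    continuous_id.integrableOn_Icc.mono_set Ioc_subset_Icc_self
  have h2 : IntegrableOn (fun s => s * (Iic s₀).indicator 1 s) (Ioi 0) := by
    simp only [e2]
    rw [IntegrableOn, integrable_indicator_iff measurableSet_Iic, IntegrableOn,
      Measure.restrict_restrict measurableSet_Iic, inter_comm, Ioi_inter_Iic]
    exact hIoc
  have h3 : ∫ s in Ioi (0 : ℝ), s * (Iic s₀).indicator 1 s
      = (N (slopeWeight y) D.slope ^ 2)⁻¹ / 2 := by
    simp only [e2]
    rw [setIntegral_indicator measurableSet_Iic, Ioi_inter_Iic,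
      ← intervalIntegral.integral_of_le hs₀0.le, integral_id, hs₀, inv_pow]
    ring
  unfold rayDiff
  rw [integral_indicator measurableSet_Ioi, ← h3, ← integral_sub h1 h2]
  simp only [mul_sub, hs₀]

/-- The form `quad` is homogeneous of degree two and the rest of degree one, so along a ray the
perturbation enters only through the product rs. -/
lemma gauge_slope (h : IsAbsoluteNorm N) (r : ℝ) {s : ℝ} (hs : 0 ≤ s) (y : ℝ) :
    D.gauge N r (s, s * y)
      = s * ((N (slopeWeight y) (D.slope + r * s * ((1 / 2 - D.spread) * D.quad (1, y)))
        + N (slopeWeight y) (D.slope + r * s * ((1 / 2 + D.spread) * D.quad (1, y)))) / 2)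
        - D.shift * r ^ 2 := by
  have e : ∀ l : ℝ, N (s * slopeWeight y) (D.slope * s + r * (l * D.quad (s, s * y)))
      = s * N (slopeWeight y) (D.slope + r * s * (l * D.quad (1, y))) := fun l => by
    rw [← h.mul_left_of_nonneg hs]
    congr 1
    simp only [quad]; ring
  simp only [gauge, planeNorm_slope hs, e]
  ring

/-- The dominating function for the limit on a ray. With n = N(√(1+y²), slope), the unperturbed
gauge at s = n⁻¹(1 + rx) equals 1 + rx. Where the two shapes can differ, the perturbation is at most
rC with C = 4 quadBound + |shift|, so they agree for |x| > C; for |x| ≤ C the density s is at most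
2n⁻¹. -/
lemma abs_rayDiff_le (h : IsAbsoluteNorm N) (hD : |D.spread| ≤ 1 / 2) {r : ℝ} (hr0 : 0 < r)
    (hr1 : r ≤ 1) (hr : |D.shift| * r ≤ 1) (hr' : (4 * D.quadBound + |D.shift|) * r ≤ 1) (y x : ℝ) :
    |D.rayDiff N r y ((N (slopeWeight y) D.slope)⁻¹ + (N (slopeWeight y) D.slope)⁻¹ * r * x)| ≤
      (Icc (-(4 * D.quadBound + |D.shift|)) (4 * D.quadBound + |D.shift|)).indicator
        (fun _ => 2 * (N (slopeWeight y) D.slope)⁻¹) x := by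
  set n := N (slopeWeight y) D.slope with hn
  have hn0 : 0 < n := h.slope_pos _ _
  set C := 4 * D.quadBound + |D.shift| with hC
  set s := n⁻¹ + n⁻¹ * r * x with hs
  have hnn : 0 ≤ (Icc (-C) C).indicator (fun _ => 2 * n⁻¹) x :=
    indicator_nonneg (fun _ _ => by positivity) _
  by_cases hs0 : s ∈ Ioi (0 : ℝ)
  swap
  · rw [rayDiff, indicator_of_notMem hs0, abs_zero]; exact hnn
  have hs0' : 0 < s := hs0
  have hns : n * s = 1 + r * x := by rw [hs]; field_simp
  have hlim : N (planeNorm (s, s * y)) (D.slope * s) = 1 + r * x := by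
    rw [planeNorm_slope hs0'.le, mul_comm D.slope, h.mul_left_of_nonneg hs0'.le, ← hns, mul_comm]
  have hg := abs_le.1 (abs_gauge_sub_le (D := D) h hD hr0.le (s, s * y))
  simp only [hlim] at hg
  have hiff : s ∈ Iic n⁻¹ ↔ 1 + r * x ≤ 1 := by
    rw [mem_Iic, ← hns, ← mul_le_mul_iff_right₀ hn0, mul_inv_cancel₀ hn0.ne']
  have hrr : |D.shift| * r ^ 2 ≤ |D.shift| * r := by
    gcongr; nlinarith
  have key : ¬((s, s * y) ∈ D.ball N r ↔ s ∈ Iic n⁻¹) → |x| ≤ C := by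
    intro hne
    by_cases hm : (s, s * y) ∈ D.ball N r
    · have hx : ¬ 1 + r * x ≤ 1 := fun h' => hne ⟨fun _ => hiff.2 h', fun _ => hm⟩
      have hq := abs_quad_le_of_mem h hr0 hr1 hr hm
      have hm' : D.gauge N r (s, s * y) ≤ 1 := hm
      have h1 : r * x ≤ r * C := by rw [hC]; nlinarith
      have h2 : x ≤ C := le_of_mul_le_mul_left h1 hr0
      have h3 : 0 < x := by nlinarith
      rwa [abs_of_pos h3]
    · have hx : 1 + r * x ≤ 1 := by
        by_contra h'
        exact hne ⟨fun h1 => absurd h1 hm, fun h1 => absurd (hiff.1 h1) h'⟩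
      have hm' : 1 < D.gauge N r (s, s * y) := not_le.1 hm
      have hp1 : planeNorm (s, s * y) ≤ 1 :=
        (le_abs_self _).trans ((h.abs_left_le _ (D.slope * s)).trans (hlim.le.trans hx))
      have hq := abs_quad_le (D := D) (s, s * y)
      have hp2 : planeNorm (s, s * y) ^ 2 ≤ 1 := pow_le_one₀ (planeNorm_nonneg _) hp1
      have hK := quadBound_nonneg (D := D)
      have hq' : |D.quad (s, s * y)| ≤ 4 * D.quadBound := by nlinarith
      have h1 : r * -x ≤ r * C := by rw [hC]; nlinarith
      have h2 : -x ≤ C := le_of_mul_le_mul_left h1 hr0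
      have h3 : x ≤ 0 := by nlinarith
      rwa [abs_of_nonpos h3]
  rw [rayDiff, indicator_of_mem hs0]
  by_cases hcase : ((s, s * y) ∈ D.ball N r ↔ s ∈ Iic n⁻¹)
  · have : (D.ball N r).indicator (1 : ℝ × ℝ → ℝ) (s, s * y)
        - (Iic n⁻¹).indicator (1 : ℝ → ℝ) s = 0 := by
      by_cases hm : s ∈ Iic n⁻¹
      · rw [indicator_of_mem hm, indicator_of_mem (hcase.2 hm)]; simp
      · rw [indicator_of_notMem hm, indicator_of_notMem (fun h' => hm (hcase.1 h'))]; simp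
    rw [this, mul_zero, abs_zero]; exact hnn
  · have hx := abs_le.1 (key hcase)
    rw [indicator_of_mem (show x ∈ Icc (-C) C from hx), abs_mul, abs_of_pos hs0']
    have h1 : |(D.ball N r).indicator (1 : ℝ × ℝ → ℝ) (s, s * y)
        - (Iic n⁻¹).indicator (1 : ℝ → ℝ) s| ≤ 1 := by
      classical
      simp only [indicator_apply, Pi.one_apply]
      split_ifs <;> norm_num
    have h2 : s ≤ 2 * n⁻¹ := by
      have : r * x ≤ 1 := by nlinarith
      rw [hs, mul_assoc]
      nlinarith [inv_pos.2 hn0]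
    calc s * _ ≤ s * 1 := by gcongr
      _ ≤ 2 * n⁻¹ := by linarith

/-- The radial displacement of the boundary of the model amoeba. -/
lemma tendsto_integral_rayDiff (h : IsAbsoluteNorm N) (hD : |D.spread| ≤ 1 / 2) {y P : ℝ}
    (hy : HasDerivAt (fun s => N (slopeWeight y) s) P D.slope) :
    Tendsto (fun r => ∫ x, D.rayDiff N r y
        ((N (slopeWeight y) D.slope)⁻¹ + (N (slopeWeight y) D.slope)⁻¹ * r * x)) (𝓝[>] 0)
      (𝓝 ((N (slopeWeight y) D.slope)⁻¹ *
        -((N (slopeWeight y) D.slope ^ 2)⁻¹ * (P * (D.quad (1, y) / 2))))) := by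
  classical
  set n := N (slopeWeight y) D.slope with hn
  have hn0 : 0 < n := h.slope_pos _ _
  set C := 4 * D.quadBound + |D.shift| with hC
  set k := (n ^ 2)⁻¹ * (P * (D.quad (1, y) / 2)) with hk
  -- In the stretched coordinate x the limit shape ends at 0 and the model amoeba at -k,
  -- asymptotically. The limit is written as the integral of this difference of indicators.
  rw [← integral_indicator_Iio_sub (-k), ← integral_const_mul]
  refine tendsto_integral_filter_of_dominated_convergence
    ((Icc (-C) C).indicator (fun _ => 2 * n⁻¹)) ?_ ?_ ?_ ?_
  · exact Eventually.of_forall fun r =>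
      ((measurable_rayDiff h r y).comp (by fun_prop)).aestronglyMeasurable
  · filter_upwards [eventually_pos_le_one_mul_le_one |D.shift|,
      eventually_pos_le_one_mul_le_one C] with r ⟨hr0, hr1, hr⟩ ⟨_, _, hr'⟩
    exact Eventually.of_forall fun x => abs_rayDiff_le h hD hr0 hr1 hr hr' y x
  · exact (integrable_indicator_iff measurableSet_Icc).2 (integrableOn_const measure_Icc_lt_top.ne)
  · filter_upwards [Measure.ae_ne volume (-k)] with x hx
    set S : ℝ → ℝ := fun r => n⁻¹ + n⁻¹ * r * x with hS
    have hSd : HasDerivAt S (n⁻¹ * x) 0 := by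
      have h1 := (((hasDerivAt_id (0 : ℝ)).const_mul n⁻¹).mul_const x).const_add n⁻¹
      refine h1.congr_deriv ?_
      ring
    have hS0 : S 0 = n⁻¹ := by simp [hS]
    have hSlim : Tendsto S (𝓝[>] 0) (𝓝 n⁻¹) := by
      have := hSd.continuousAt.tendsto
      rw [hS0] at this
      exact this.mono_left nhdsWithin_le_nhds
    have hSpos : ∀ᶠ r in 𝓝[>] (0 : ℝ), 0 < S r := hSlim.eventually (lt_mem_nhds (inv_pos.2 hn0))
    -- The gauge along the moving point with fixed x. Since ψ(0) = 1, the sign of ψ'(0) = x + k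
    -- decides membership for small r. The spread cancels in ψ'(0), which is why the outer and the
    -- inner model have the same first-order area, and the shift is of second order.
    set ψ : ℝ → ℝ := fun r =>
      S r * ((N (slopeWeight y) (D.slope + r * S r * ((1 / 2 - D.spread) * D.quad (1, y)))
        + N (slopeWeight y) (D.slope + r * S r * ((1 / 2 + D.spread) * D.quad (1, y)))) / 2)
        - D.shift * r ^ 2 with hψ
    have hin : ∀ l : ℝ, HasDerivAt
        (fun r => N (slopeWeight y) (D.slope + r * S r * (l * D.quad (1, y))))
        (P * (n⁻¹ * (l * D.quad (1, y)))) 0 := by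
      intro l
      have h1 : HasDerivAt (fun r => D.slope + r * S r * (l * D.quad (1, y)))
          (n⁻¹ * (l * D.quad (1, y))) 0 := by
        have h2 := ((hasDerivAt_id (0 : ℝ)).mul hSd).mul_const (l * D.quad (1, y))
        refine (h2.const_add D.slope).congr_deriv ?_
        simp [hS0]
      exact HasDerivAt.comp_of_eq (h₂ := fun s => N (slopeWeight y) s) 0 hy h1 (by simp)
    have hψd : HasDerivAt ψ (x + k) 0 := by
      have h1 := (hSd.mul (((hin (1 / 2 - D.spread)).add (hin (1 / 2 + D.spread))).div_const 2)).sub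
        (((hasDerivAt_id (0 : ℝ)).pow 2).const_mul D.shift)
      refine h1.congr_deriv ?_
      simp only [Pi.add_apply, hS0, zero_mul, add_zero, ← hn, id, hk]
      field_simp
      ring
    have hψ0 : ψ 0 = 1 := by
      simp only [hψ, hS0, zero_mul, add_zero, ← hn]
      field_simp
      ring
    have hball : ∀ᶠ r in 𝓝[>] (0 : ℝ), ((S r, S r * y) ∈ D.ball N r ↔ x < -k) := by
      have hmem : ∀ᶠ r in 𝓝[>] (0 : ℝ), ((S r, S r * y) ∈ D.ball N r ↔ ψ r ≤ 1) := by
        filter_upwards [hSpos] with r hr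
        change D.gauge N r (S r, S r * y) ≤ 1 ↔ _
        rw [gauge_slope h r hr.le]
      rcases lt_or_gt_of_ne hx with hlt | hlt
      · have h1 := eventually_lt_of_hasDerivAt_pos hψd.neg (by linarith)
        filter_upwards [hmem, h1] with r h2 h3
        simp only [Pi.neg_apply, hψ0] at h3
        exact h2.trans ⟨fun _ => hlt, fun _ => by linarith⟩
      · have h1 := eventually_lt_of_hasDerivAt_pos hψd (by linarith)
        filter_upwards [hmem, h1] with r h2 h3
        rw [hψ0] at h3
        exact h2.trans ⟨fun h4 => absurd h4 (not_le.2 h3), fun h4 => absurd h4 (not_lt.2 hlt.le)⟩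
    have hlim : Tendsto (fun r => S r * ((Iio (-k)).indicator 1 x - (Iic (0 : ℝ)).indicator 1 x))
        (𝓝[>] 0) (𝓝 (n⁻¹ * ((Iio (-k)).indicator 1 x - (Iic (0 : ℝ)).indicator 1 x))) :=
      hSlim.mul_const _
    refine hlim.congr' ?_
    filter_upwards [hSpos, hball, self_mem_nhdsWithin] with r h1 h2 (h3 : 0 < r)
    have hle : S r ≤ n⁻¹ ↔ x ≤ 0 := by
      have : 0 < n⁻¹ * r := by positivity
      simp only [hS]
      constructor
      · intro h4; nlinarith
      · intro h4; nlinarith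
    rw [rayDiff, indicator_of_mem (show S r ∈ Ioi (0 : ℝ) from h1)]
    simp only [indicator_apply, h2, mem_Iio, mem_Iic, ← hn, hle, Pi.one_apply]

/-- The contribution of the displacement of the boundary of the amoeba. -/
theorem tendsto_volume_half_sub (h : IsAbsoluteNorm N) (hτ : 0 < D.slope)
    (hD : |D.spread| ≤ 1 / 2) :
    Tendsto (fun r => (volume.real (D.ball N r ∩ {v | 0 < v.1})
      - ∫ y, (N (slopeWeight y) D.slope ^ 2)⁻¹ / 2) / r) (𝓝[>] 0)
      (𝓝 (-∫ y, (N (slopeWeight y) D.slope ^ 4)⁻¹ * slopeDeriv N D.slope y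
        * (D.quad (1, y) / 2))) := by
  set τ := D.slope with hτdef
  set C := 4 * D.quadBound + |D.shift| with hC
  set f : ℝ → ℝ → ℝ := fun r y => ∫ s in Ioi (0 : ℝ), s * (D.ball N r).indicator 1 (s, s * y)
    with hf
  have hsmall := eventually_pos_le_one_mul_le_one |D.shift|
  have hV0 : Integrable fun y => (N (slopeWeight y) τ ^ 2)⁻¹ / 2 :=
    (h.integrable_inv_slope_pow le_rfl τ).div_const 2
  have hchart : ∀ᶠ r in 𝓝[>] (0 : ℝ), Integrable (f r) ∧
      volume.real (D.ball N r ∩ {v | 0 < v.1}) = ∫ y, f r y := by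
    filter_upwards [hsmall] with r ⟨hr0, hr1, hr⟩
    have hm : MeasurableSet (D.ball N r ∩ {v | 0 < v.1}) :=
      (measurableSet_ball h r).inter measurableSet_fst_pos
    have hfin := measure_ne_top_of_subset (inter_subset_left (t := {v : ℝ × ℝ | 0 < v.1}))
      (volume_ball_ne_top (D := D) h hr0 hr1 hr)
    have hint : Integrable ((D.ball N r ∩ {v | 0 < v.1}).indicator (1 : ℝ × ℝ → ℝ)) :=
      (integrable_indicator_iff hm).2 (integrableOn_const hfin)
    have h1 := integral_halfPlane hint fun v hv =>
      indicator_of_notMem (fun h' => absurd h'.2 (not_lt.2 hv)) _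
    have h2 : ∀ y, ∫ s in Ioi (0 : ℝ), s * (D.ball N r ∩ {v | 0 < v.1}).indicator 1 (s, s * y)
        = f r y := by
      intro y
      refine setIntegral_congr_fun measurableSet_Ioi fun s (hs : 0 < s) => ?_
      classical
      simp [indicator_apply, hs]
    simp only [h2, integral_indicator_one hm] at h1
    exact h1
  have hlhs : ∀ᶠ r in 𝓝[>] (0 : ℝ),
      ∫ y, (f r y - (N (slopeWeight y) τ ^ 2)⁻¹ / 2) / r
        = (volume.real (D.ball N r ∩ {v | 0 < v.1})
          - ∫ y, (N (slopeWeight y) τ ^ 2)⁻¹ / 2) / r := by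
    filter_upwards [hchart] with r ⟨h1, h2⟩
    rw [integral_div, integral_sub h1 hV0, h2]
  refine Tendsto.congr' hlhs ?_
  -- On each ray the substitution s = n⁻¹ + n⁻¹rx, with n = N(√(1+y²), τ), produces the factor r
  -- that cancels the division.
  have hray : ∀ᶠ r in 𝓝[>] (0 : ℝ), ∀ y, (f r y - (N (slopeWeight y) τ ^ 2)⁻¹ / 2) / r
      = (N (slopeWeight y) τ)⁻¹ * ∫ x, D.rayDiff N r y
        ((N (slopeWeight y) τ)⁻¹ + (N (slopeWeight y) τ)⁻¹ * r * x) := by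
    filter_upwards [hsmall] with r ⟨hr0, hr1, hr⟩ y
    have h0 : 0 < (N (slopeWeight y) τ)⁻¹ := inv_pos.2 (h.slope_pos _ _)
    have h1 := integral_rayDiff (D := D) h hr0 hr1 hr y
    rw [integral_eq_mul_integral_affine _ (N (slopeWeight y) τ)⁻¹ (mul_pos h0 hr0)] at h1
    rw [hf, ← h1]
    field_simp
  rw [← integral_neg]
  refine tendsto_integral_filter_of_dominated_convergence (fun y => 4 * C * (1 + y ^ 2)⁻¹) ?_ ?_
    (integrable_inv_one_add_sq.const_mul _) ?_
  · filter_upwards [hchart] with r ⟨h1, _⟩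
    exact ((h1.sub hV0).div_const r).aestronglyMeasurable
  · filter_upwards [hray, hsmall, eventually_pos_le_one_mul_le_one C]
      with r h1 ⟨hr0, hr1, hr⟩ ⟨_, _, hr'⟩
    refine Eventually.of_forall fun y => ?_
    have hC0 : 0 ≤ C := by have := quadBound_nonneg (D := D); positivity
    have hn0 := h.slope_pos y τ
    rw [h1, norm_mul, Real.norm_of_nonneg (inv_pos.2 hn0).le]
    have h2 : ‖∫ x, D.rayDiff N r y ((N (slopeWeight y) τ)⁻¹ + (N (slopeWeight y) τ)⁻¹ * r * x)‖
        ≤ ∫ x, (Icc (-C) C).indicator (fun _ => 2 * (N (slopeWeight y) τ)⁻¹) x := by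
      refine norm_integral_le_of_norm_le ?_
        (Eventually.of_forall fun x => abs_rayDiff_le h hD hr0 hr1 hr hr' y x)
      exact (integrable_indicator_iff measurableSet_Icc).2
        (integrableOn_const measure_Icc_lt_top.ne)
    rw [integral_indicator_const _ measurableSet_Icc, Real.volume_real_Icc_of_le (by linarith),
      smul_eq_mul] at h2
    have h3 := h.inv_slope_pow_le (le_refl 2) y τ
    calc (N (slopeWeight y) τ)⁻¹ * _
        ≤ (N (slopeWeight y) τ)⁻¹ * ((C - -C) * (2 * (N (slopeWeight y) τ)⁻¹)) := by gcongr
      _ = 4 * C * (N (slopeWeight y) τ ^ 2)⁻¹ := by rw [← inv_pow]; ring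
      _ ≤ 4 * C * (1 + y ^ 2)⁻¹ := by gcongr
  · filter_upwards [h.ae_hasDerivAt_slope hτ] with y hy
    have h1 := (tendsto_integral_rayDiff (D := D) h hD hy.1).const_mul (N (slopeWeight y) τ)⁻¹
    have e : (N (slopeWeight y) τ)⁻¹ * ((N (slopeWeight y) τ)⁻¹ *
        -((N (slopeWeight y) τ ^ 2)⁻¹ * (slopeDeriv N D.slope y * (D.quad (1, y) / 2))))
        = -((N (slopeWeight y) τ ^ 4)⁻¹ * slopeDeriv N τ y * (D.quad (1, y) / 2)) := by
      have := h.slope_pos y τ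
      rw [← hτdef]
      field_simp
    rw [e] at h1
    refine h1.congr' ?_
    filter_upwards [hray] with r hr
    rw [hr]

lemma integral_eq_integral_Ioi_add_neg {f : ℝ → ℝ} (hf : Integrable f) :
    ∫ y, f y = ∫ y in Ioi (0 : ℝ), (f y + f (-y)) := by
  rw [integral_add hf.integrableOn hf.comp_neg.integrableOn, integral_comp_neg_Ioi, neg_zero,
    add_comm, ← intervalIntegral.integral_Iic_add_Ioi hf.integrableOn hf.integrableOn]

/-- The first-order expansion of the volume of the part of the model amoeba above a level. -/
theorem tendsto_volume_level (h : IsAbsoluteNorm N) (hτ : 0 < D.slope)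
    (hD : |D.spread| ≤ 1 / 2) (M M' : ℝ) :
    Tendsto (fun r => (volume.real (D.ball N r ∩ {v | 0 < D.level M M' r v})
      - ∫ y, (N (slopeWeight y) D.slope ^ 2)⁻¹ / 2) / r) (𝓝[>] 0)
      (𝓝 ((D.slope * deriv (ballMoment N) D.slope * D.a + ballMoment N D.slope * D.c - 6 * M)
        / (3 * D.slope))) := by
  have h1 := (tendsto_volume_level_sub (D := D) h hτ M M').add (tendsto_volume_half_sub h hτ hD)
  set τ := D.slope with hτdef
  have i0 := h.integrable_inv_mul_slopeDeriv τ
  have i2 := h.integrable_sq_mul_slopeDeriv τ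
  set W : ℝ → ℝ := fun y => (N (slopeWeight y) τ ^ 4)⁻¹ * slopeDeriv N τ y with hW
  have hWneg : ∀ y, W (-y) = W y := fun y => by simp only [hW, slopeWeight_neg, slopeDeriv_neg]
  have i1 : Integrable fun y => y * W y := by
    refine (i0.norm.add i2.norm).mono' ?_ (Eventually.of_forall fun y => ?_)
    · exact aestronglyMeasurable_id.mul i0.aestronglyMeasurable
    · have e : ‖y ^ 2 * W y‖ = ‖y‖ ^ 2 * ‖W y‖ := by rw [norm_mul, norm_pow]
      change ‖y * W y‖ ≤ ‖W y‖ + ‖y ^ 2 * W y‖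
      rw [e, norm_mul]
      nlinarith [mul_nonneg (norm_nonneg (W y)) (sq_nonneg (‖y‖ - 1)),
        mul_nonneg (norm_nonneg (W y)) (sq_nonneg ‖y‖), norm_nonneg (W y)]
  have e : ∀ y, W y * (D.quad (1, y) / 2)
      = D.a / 2 * W y + D.b * (y * W y) + D.c / 2 * (y ^ 2 * W y) := fun y => by
    simp only [quad]; ring
  have hint : Integrable fun y => W y * (D.quad (1, y) / 2) := by
    simp only [e]
    exact ((i0.const_mul _).add (i1.const_mul _)).add (i2.const_mul _)
  -- W is even, so the mixed coefficient b drops out when the line is folded at 0.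
  have hI : ∫ y, W y * (D.quad (1, y) / 2)
      = D.a * (∫ y in Ioi (0 : ℝ), W y) + D.c * ∫ y in Ioi (0 : ℝ), y ^ 2 * W y := by
    rw [integral_eq_integral_Ioi_add_neg hint, ← integral_const_mul, ← integral_const_mul,
      ← integral_add (i0.integrableOn.const_mul _) (i2.integrableOn.const_mul _)]
    congr 1
    ext y
    rw [hWneg]
    simp only [quad]
    ring
  have hd : deriv (ballMoment N) τ = -3 * ∫ y in Ioi (0 : ℝ), W y :=
    (h.hasDerivAt_ballMoment hτ).deriv
  have hp : 3 * τ * ∫ y in Ioi (0 : ℝ), y ^ 2 * W y = 1 - ballMoment N τ :=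
    h.integral_sq_mul_slopeDeriv hτ
  -- The second moment is (1 - G)/(3τ) with G = `ballMoment N τ`; its constant 1 cancels the term
  -- c/3 of the strip and leaves Gc/(3τ).
  have hval : (D.c / 3 - 2 * M) / τ + -∫ y, W y * (D.quad (1, y) / 2)
      = (τ * deriv (ballMoment N) τ * D.a + ballMoment N τ * D.c - 6 * M) / (3 * τ) := by
    rw [hI, hd]
    field_simp
    linear_combination (-D.c) * hp
  rw [hval] at h1
  refine h1.congr fun r => ?_
  ring

end QuadraticModel

/-! ### Taylor estimates and bounds for the amoeba distance -/

/-- Second-order Taylor estimates for a function and its derivative. -/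
lemma exists_taylor_bound {E : Type*} [NormedAddCommGroup E] [NormedSpace ℝ E] {u : E → ℝ} {x : E}
    (hu : ∀ᶠ y in 𝓝 x, ContDiffAt ℝ ∞ u y) :
    ∃ δ > 0, ∃ K ≥ 0, ∀ w : E, ‖w‖ < δ → ContDiffAt ℝ ∞ u (x + w) ∧
      (∀ k : E, |fderiv ℝ u (x + w) k - fderiv ℝ u x k - fderiv ℝ (fderiv ℝ u) x w k|
        ≤ K * ‖w‖ ^ 2 * ‖k‖) ∧
      |u (x + w) - u x - fderiv ℝ u x w - 1 / 2 * fderiv ℝ (fderiv ℝ u) x w w| ≤ K * ‖w‖ ^ 3 := by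
  set F := fderiv ℝ u with hF
  set B := fderiv ℝ F x with hB
  have hF2 : ContDiffAt ℝ 2 F x := hu.self_of_nhds.fderiv_right (by norm_cast)
  obtain ⟨K, t, ht, hK⟩ := (hF2.fderiv_right (m := 1) (by norm_num)).exists_lipschitzOnWith
  obtain ⟨δ, hδ, hball⟩ := Metric.eventually_nhds_iff_ball.1
    (((hF2.eventually (by simp)).and (eventually_mem_nhds_iff.2 ht)).and hu)
  have hxt : x ∈ t := mem_of_mem_nhds ht
  have hT1 : ∀ w : E, ‖w‖ < δ → ∀ k : E, |F (x + w) k - F x k - B w k| ≤ K * ‖w‖ ^ 2 * ‖k‖ := by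
    intro w hw k
    have hsub : Metric.closedBall x ‖w‖ ⊆ Metric.ball x δ := Metric.closedBall_subset_ball hw
    have h1 := (convex_closedBall x ‖w‖).norm_image_sub_le_of_norm_fderiv_le' (𝕜 := ℝ) (f := F)
      (φ := B) (C := K * ‖w‖) (x := x) (y := x + w)
      (fun y hy => (hball y (hsub hy)).1.1.differentiableAt (by norm_num))
      (fun y hy => by
        have h2 := hK.dist_le_mul y (mem_of_mem_nhds (hball y (hsub hy)).1.2) x hxt
        rw [dist_eq_norm] at h2
        refine h2.trans ?_
        gcongr
        exact Metric.mem_closedBall.1 hy)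
      (Metric.mem_closedBall_self (norm_nonneg w)) (by simp)
    rw [add_sub_cancel_left] at h1
    calc |F (x + w) k - F x k - B w k| = ‖(F (x + w) - F x - B w) k‖ := by
          rw [Real.norm_eq_abs]; rfl
      _ ≤ ‖F (x + w) - F x - B w‖ * ‖k‖ := ContinuousLinearMap.le_opNorm _ _
      _ ≤ (K * ‖w‖ * ‖w‖) * ‖k‖ := by gcongr
      _ = K * ‖w‖ ^ 2 * ‖k‖ := by ring
  refine ⟨δ, hδ, K, K.2, fun w hwδ => ⟨(hball _ ?_).2, hT1 w hwδ, ?_⟩⟩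
  · rwa [mem_ball_iff_norm, add_sub_cancel_left]
  have hder : ∀ s ∈ Icc (0 : ℝ) 1, HasDerivWithinAt
      (fun s : ℝ => u (x + s • w) - s * F x w - s ^ 2 / 2 * B w w)
      (F (x + s • w) w - F x w - s * B w w) (Icc 0 1) s := by
    intro s hs
    have hsw : x + s • w ∈ Metric.ball x δ := by
      rw [mem_ball_iff_norm, add_sub_cancel_left, norm_smul, Real.norm_of_nonneg hs.1]
      exact (mul_le_of_le_one_left (norm_nonneg w) hs.2).trans_lt hwδ
    have h1 : HasDerivAt (fun s : ℝ => x + s • w) w s := by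
      simpa using ((hasDerivAt_id s).smul_const w).const_add x
    have h2 := (((hball _ hsw).2.differentiableAt (by simp)).hasFDerivAt).comp_hasDerivAt s h1
    have h3 := (h2.sub ((hasDerivAt_id s).mul_const (F x w))).sub
      ((((hasDerivAt_id s).pow 2).div_const 2).mul_const (B w w))
    refine (h3.congr_deriv ?_).hasDerivWithinAt
    simp [hF]
  -- The estimate for the derivative is integrated along the segment by the mean value inequality;
  -- the same K serves both bounds, since no sharp constant is needed.
  have hbd := norm_image_sub_le_of_norm_deriv_le_segment_01' (C := K * ‖w‖ ^ 3) hder (by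
    intro s hs
    have hsw : ‖s • w‖ ≤ ‖w‖ := by
      rw [norm_smul, Real.norm_of_nonneg hs.1]
      exact mul_le_of_le_one_left (norm_nonneg w) hs.2.le
    have h1 := hT1 (s • w) (hsw.trans_lt hwδ) w
    rw [map_smul, smul_apply, smul_eq_mul] at h1
    refine h1.trans ?_
    calc (K : ℝ) * ‖s • w‖ ^ 2 * ‖w‖ ≤ K * ‖w‖ ^ 2 * ‖w‖ := by gcongr
      _ = K * ‖w‖ ^ 3 := by ring)
  rw [Real.norm_eq_abs] at hbd
  convert hbd using 2
  simp
  ring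

/-- Jensen's inequality for the convex function N on the probability space (0, 1] bounds the length
below by N at the mean speeds. These dominate the chord and the increment of v, and N is monotone in
both moduli. -/
lemma amoebaPhi_norm_le_integral {E : Type*} [NormedAddCommGroup E] [NormedSpace ℝ E]
    [CompleteSpace E] {N : ℝ → ℝ → ℝ} (h : IsAbsoluteNorm N) {β : ℝ} (hβ : 0 ≤ β) {c : ℝ → E}
    {v : ℝ → ℝ} (hc : ContDiffOn ℝ 1 c (Icc 0 1)) (hv : ContDiffOn ℝ 1 v (Icc 0 1)) :
    N ‖c 1 - c 0‖ (β * (v 1 - v 0))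
      ≤ ∫ t in (0 : ℝ)..1, N ‖derivWithin c (Icc 0 1) t‖ (β * |derivWithin v (Icc 0 1) t|) := by
  have hud : UniqueDiffOn ℝ (Icc (0 : ℝ) 1) := uniqueDiffOn_Icc zero_lt_one
  have hc' : ContinuousOn (fun t => ‖derivWithin c (Icc 0 1) t‖) (Icc 0 1) :=
    (hc.continuousOn_derivWithin hud le_rfl).norm
  have hv' : ContinuousOn (fun t => β * |derivWithin v (Icc 0 1) t|) (Icc 0 1) :=
    continuousOn_const.mul (hv.continuousOn_derivWithin hud le_rfl).abs
  have i1 : IntegrableOn (fun t => ‖derivWithin c (Icc 0 1) t‖) (Ioc 0 1) :=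
    (hc'.integrableOn_compact isCompact_Icc).mono_set Ioc_subset_Icc_self
  have i2 : IntegrableOn (fun t => β * |derivWithin v (Icc 0 1) t|) (Ioc 0 1) :=
    (hv'.integrableOn_compact isCompact_Icc).mono_set Ioc_subset_Icc_self
  have i3 : IntegrableOn (fun t => N ‖derivWithin c (Icc 0 1) t‖
      (β * |derivWithin v (Icc 0 1) t|)) (Ioc 0 1) :=
    ((h.continuous.comp_continuousOn (hc'.prodMk hv')).integrableOn_compact
      isCompact_Icc).mono_set Ioc_subset_Icc_self
  have : IsProbabilityMeasure (volume.restrict (Ioc (0 : ℝ) 1)) := ⟨by simp⟩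
  have hconv : ConvexOn ℝ univ fun p : ℝ × ℝ => N p.1 p.2 := by
    refine ⟨convex_univ, fun p _ q _ a b ha hb hab => ?_⟩
    have h1 := h.convex hb (by linarith) p.1 p.2 q.1 q.2
    rw [show 1 - b = a by linarith] at h1
    exact h1
  have hJ := hconv.map_integral_le (μ := volume.restrict (Ioc (0 : ℝ) 1))
    (f := fun t => (‖derivWithin c (Icc 0 1) t‖, β * |derivWithin v (Icc 0 1) t|))
    h.continuous.continuousOn isClosed_univ (by simp) (i1.prodMk i2) i3
  rw [integral_pair i1 i2] at hJ
  rw [intervalIntegral.integral_of_le zero_le_one]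
  refine le_trans ?_ hJ
  have e1 := intervalIntegral.integral_derivWithin_Icc_of_contDiffOn_Icc hc zero_le_one
  have e2 := intervalIntegral.integral_derivWithin_Icc_of_contDiffOn_Icc hv zero_le_one
  rw [intervalIntegral.integral_of_le zero_le_one] at e1 e2
  refine h.mono ?_ ?_
  · rw [abs_norm, ← e1]
    exact (norm_integral_le_integral_norm _).trans (le_abs_self _)
  · rw [abs_mul, abs_of_nonneg hβ, ← e2, integral_const_mul, abs_mul, abs_of_nonneg hβ]
    exact mul_le_mul_of_nonneg_left (abs_integral_le_integral_abs.trans (le_abs_self _)) hβ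

/-- A lower bound for the amoeba distance. -/
lemma amoebaPhi_le_of_mem_amoeba {ν : ℝ → ℝ} (hν : IsAmoebaProfile ν) {β : ℝ} (hβ : 0 ≤ β)
    {Ω : Set Plane} {u : Plane → ℝ} (hu : ContDiffOn ℝ ∞ u Ω) {ρ : ℝ} (hρ : 0 ≤ ρ) {p q : Plane}
    (hq : q ∈ amoeba ν β Ω u ρ p) : amoebaPhi ν ‖q - p‖ (β * (u q - u p)) ≤ ρ := by
  rw [← ENNReal.ofReal_le_ofReal_iff hρ]
  refine le_trans (le_iInf₂ fun c hc => ENNReal.ofReal_le_ofReal ?_) hq.2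
  have hv : ContDiffOn ℝ 1 (u ∘ c) (Icc 0 1) :=
    (hu.of_le (by norm_cast)).comp hc.contDiffOn hc.mapsTo
  have h1 := amoebaPhi_norm_le_integral hν.isAbsoluteNorm hβ hc.contDiffOn hv
  rw [Function.comp, Function.comp, hc.source, hc.target] at h1
  exact h1

/-- A sufficient condition for a point to lie in an amoeba. -/
lemma add_mem_amoeba {ν : ℝ → ℝ} (hν : IsAmoebaProfile ν) {β : ℝ}
    {Ω : Set Plane} {u : Plane → ℝ} {x w : Plane} (hw : w ≠ 0)
    (hΩ : ∀ t ∈ Icc (0 : ℝ) 1, x + t • w ∈ Ω)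
    (hu : ∀ t ∈ Icc (0 : ℝ) 1, ContDiffAt ℝ ∞ u (x + t • w)) {ρ A B : ℝ}
    (hAB : (A + B) / 2 ≤ ρ)
    (hle : ∀ t ∈ Icc (0 : ℝ) 1,
      amoebaPhi ν ‖w‖ (β * |fderiv ℝ u (x + t • w) w|) ≤ (1 - t) * A + t * B) :
    x + w ∈ amoeba ν β Ω u ρ x := by
  have h := hν.isAbsoluteNorm
  set c : ℝ → Plane := fun t => x + t • w with hc
  have hcd : ∀ t, HasDerivAt c w t := fun t => by
    simpa [hc] using ((hasDerivAt_id t).smul_const w).const_add x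
  have hud : ∀ t ∈ Icc (0 : ℝ) 1, UniqueDiffWithinAt ℝ (Icc (0 : ℝ) 1) t :=
    uniqueDiffOn_Icc zero_lt_one
  have hcw : ∀ t ∈ Icc (0 : ℝ) 1, derivWithin c (Icc 0 1) t = w := fun t ht =>
    (hcd t).hasDerivWithinAt.derivWithin (hud t ht)
  have huw : ∀ t ∈ Icc (0 : ℝ) 1, derivWithin (u ∘ c) (Icc 0 1) t = fderiv ℝ u (x + t • w) w :=
    fun t ht => by
      have h1 : HasFDerivAt u (fderiv ℝ u (c t)) (c t) :=
        ((hu t ht).differentiableAt (by simp)).hasFDerivAt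
      exact (h1.comp_hasDerivAt t (hcd t)).hasDerivWithinAt.derivWithin (hud t ht)
  -- The segment is regular only because w ≠ 0. The centre itself is therefore left out here and
  -- later discarded as a null set.
  have hreg : IsRegularCurve Ω x (x + w) c :=
    ⟨by simp only [hc]; fun_prop, fun t ht => by rw [hcw t ht]; exact hw, hΩ, by simp [hc],
      by simp [hc]⟩
  refine ⟨by simpa using hΩ 1 (by simp), (iInf₂_le c hreg).trans (ENNReal.ofReal_le_ofReal ?_)⟩
  have hcont : ContinuousOn (fun t : ℝ => fderiv ℝ u (x + t • w) w) (Icc 0 1) := by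
    intro t ht
    have h1 : ContinuousAt (fderiv ℝ u) (x + t • w) :=
      ((hu t ht).fderiv_right (m := 0) (by norm_cast)).continuousAt
    have h2 : ContinuousAt (fun t : ℝ => fderiv ℝ u (x + t • w)) t :=
      ContinuousAt.comp (f := c) h1 (hcd t).continuousAt
    exact (h2.clm_apply continuousAt_const).continuousWithinAt
  calc amoebaLength ν β u c
      = ∫ t in (0 : ℝ)..1, amoebaPhi ν ‖w‖ (β * |fderiv ℝ u (x + t • w) w|) := by
        refine intervalIntegral.integral_congr fun t ht => ?_
        rw [uIcc_of_le zero_le_one] at ht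
        simp only [hcw t ht, huw t ht]
    _ ≤ ∫ t in (0 : ℝ)..1, ((1 - t) * A + t * B) := by
        refine intervalIntegral.integral_mono_on zero_le_one ?_ ?_ hle
        · refine ContinuousOn.intervalIntegrable ?_
          rw [uIcc_of_le zero_le_one]
          exact h.continuous.comp_continuousOn
            (continuousOn_const.prodMk (continuousOn_const.mul hcont.abs))
        · apply Continuous.intervalIntegrable; fun_prop
    _ = (A + B) / 2 := by
        have e : ∀ t : ℝ, (1 - t) * A + t * B = A + t * (B - A) := fun t => by ring
        simp only [e]
        rw [intervalIntegral.integral_add (by simp)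
          (by apply Continuous.intervalIntegrable; fun_prop),
          intervalIntegral.integral_mul_const, integral_id]
        simp
        ring
    _ ≤ ρ := hAB

/-! ### Comparison of amoebas with model amoebas -/

/-- The linear isometry `(s, t) ↦ s b₀ + t b₁` of an orthonormal frame. -/
noncomputable def frameMap (b : OrthonormalBasis (Fin 2) ℝ Plane) (v : ℝ × ℝ) : Plane :=
  v.1 • b 0 + v.2 • b 1

lemma norm_frameMap (b : OrthonormalBasis (Fin 2) ℝ Plane) (v : ℝ × ℝ) :
    ‖frameMap b v‖ = planeNorm v := by
  have h1 : ‖frameMap b v‖ ^ 2 = planeNorm v ^ 2 := by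
    rw [planeNorm_sq, frameMap, norm_add_sq_real, norm_smul, norm_smul, b.norm_eq_one,
      b.norm_eq_one, inner_smul_left, inner_smul_right, b.inner_eq_zero (by decide)]
    simp
  exact (pow_left_inj₀ (norm_nonneg _) (planeNorm_nonneg v) two_ne_zero).1 h1

lemma exists_frameMap_eq (b : OrthonormalBasis (Fin 2) ℝ Plane) (w : Plane) :
    ∃ v, frameMap b v = w :=
  ⟨(b.repr w 0, b.repr w 1), by
    have := b.sum_repr w
    rw [Fin.sum_univ_two] at this
    exact this⟩

/-- Valid for sets that need not be measurable and for r of either sign; a negative r realizes the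
point reflection used for the part below a level. -/
lemma volume_image_frameMap (b : OrthonormalBasis (Fin 2) ℝ Plane) (x : Plane) (r : ℝ)
    (S : Set (ℝ × ℝ)) :
    volume ((fun v => x + r • frameMap b v) '' S) = ENNReal.ofReal (r ^ 2) * volume S := by
  let e : ℝ × ℝ ≃ᵐ Plane := (MeasurableEquiv.finTwoArrow (α := ℝ)).symm.trans
    ((MeasurableEquiv.toLp 2 (Fin 2 → ℝ)).trans b.repr.symm.toMeasurableEquiv)
  have he : ⇑e = frameMap b := by
    ext1 v
    have : e v = b.repr.symm (WithLp.toLp 2 ![v.1, v.2]) := rfl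
    rw [this, ← b.sum_repr_symm, Fin.sum_univ_two]
    rfl
  have hmp : MeasurePreserving e volume volume :=
    (b.measurePreserving_repr_symm.comp (PiLp.volume_preserving_toLp (Fin 2))).comp
      (volume_preserving_finTwoArrow ℝ).symm
  have h1 : volume (frameMap b '' S) = volume S := by
    rw [← he, MeasurableEquiv.image_eq_preimage_symm]
    exact hmp.symm.measure_preimage_equiv S
  have h2 : (fun v => x + r • frameMap b v) '' S
      = (fun w => x + w) '' ((fun w => r • w) '' (frameMap b '' S)) := by
    rw [image_image, image_image]
  rw [h2, image_add_left, measure_preimage_add, image_smul, Measure.addHaar_smul, h1,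
    finrank_euclideanSpace_fin, abs_of_nonneg (sq_nonneg r)]

/-- In rescaled coordinates a superlevel part of an amoeba lies in a superlevel part of a model
amoeba. -/
lemma amoeba_level_subset {ν : ℝ → ℝ} (hν : IsAmoebaProfile ν) {β : ℝ} (hβ : 0 < β)
    {Ω : Set Plane} {u : Plane → ℝ} (hu : ContDiffOn ℝ ∞ u Ω) {x : Plane}
    (b : OrthonormalBasis (Fin 2) ℝ Plane) {z : ℝ}
    (hF : ∀ v, fderiv ℝ u x (frameMap b v) = z * v.1) {D : QuadraticModel}
    (hslope : D.slope = β * z) (hspread : D.spread = 0)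
    (hquad : ∀ v, D.quad v
      = β * fderiv ℝ (fderiv ℝ u) x (frameMap b v) (frameMap b v)) {K : ℝ} (hK : 0 ≤ K)
    (hshift : D.shift = β * K) {ρ : ℝ} (hρ : 0 < ρ)
    (hT : ∀ w : Plane, ‖w‖ ≤ ρ →
      |u (x + w) - u x - fderiv ℝ u x w - 1 / 2 * fderiv ℝ (fderiv ℝ u) x w w| ≤ K * ‖w‖ ^ 3)
    (M : ℝ) :
    {q ∈ amoeba ν β Ω u ρ x | u x + ρ ^ 2 * M < u q} ⊆ (fun v => x + ρ • frameMap b v) ''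
      (D.ball (amoebaPhi ν) ρ ∩ {v | 0 < D.level (β * M) (-(β * K)) ρ v}) := by
  have h := hν.isAbsoluteNorm
  rintro q ⟨hq, hqM⟩
  obtain ⟨v, hv⟩ := exists_frameMap_eq b (ρ⁻¹ • (q - x))
  have hw : q = x + ρ • frameMap b v := by rw [hv, smul_inv_smul₀ hρ.ne', add_sub_cancel]
  have hwn : ‖ρ • frameMap b v‖ = ρ * planeNorm v := by
    rw [norm_smul, norm_frameMap, Real.norm_of_nonneg hρ.le]
  have hN1 := amoebaPhi_le_of_mem_amoeba hν hβ.le hu hρ.le hq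
  rw [hw, add_sub_cancel_left, hwn] at hN1
  have he1 : planeNorm v ≤ 1 := by
    have h1 := (le_abs_self _).trans ((h.abs_left_le _ _).trans hN1)
    exact le_of_mul_le_mul_left (by rwa [mul_one]) hρ
  have hwρ : ‖ρ • frameMap b v‖ ≤ ρ := by rw [hwn]; exact mul_le_of_le_one_right hρ.le he1
  have hTu := (hT _ hwρ).trans (mul_le_mul_of_nonneg_left (pow_le_pow_left₀ (norm_nonneg _) hwρ 3) hK)
  rw [hw] at hqM
  set w := ρ • frameMap b v with hwdef
  have hFw : fderiv ℝ u x w = ρ * (z * v.1) := by rw [hwdef, map_smul, hF, smul_eq_mul]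
  have hBw : β * fderiv ℝ (fderiv ℝ u) x w w = ρ ^ 2 * D.quad v := by
    rw [hquad]
    simp only [hwdef, map_smul, smul_apply, smul_eq_mul]
    ring
  -- The Taylor error βKρ³ is what the shift βK of the gauge and the correction -βK of the level pay
  -- for.
  have hbd : |β * (u (x + w) - u x) - ρ * (D.slope * v.1 + ρ * (1 / 2 * D.quad v))|
      ≤ β * K * ρ ^ 3 := by
    have e : β * (u (x + w) - u x) - ρ * (D.slope * v.1 + ρ * (1 / 2 * D.quad v))
        = β * (u (x + w) - u x - fderiv ℝ u x w - 1 / 2 * fderiv ℝ (fderiv ℝ u) x w w) := by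
      rw [hslope, hFw]
      linear_combination (1 / 2) * hBw
    rw [e, abs_mul, abs_of_pos hβ, mul_assoc]
    exact mul_le_mul_of_nonneg_left hTu hβ.le
  refine ⟨v, ⟨?_, ?_⟩, hw.symm⟩
  · have h1 := h.le_add_right (ρ * planeNorm v) (ρ * (D.slope * v.1 + ρ * (1 / 2 * D.quad v)))
      (β * (u (x + w) - u x))
    rw [abs_sub_comm, h.mul_left_of_nonneg hρ.le] at h1
    have h2 : ρ * amoebaPhi ν (planeNorm v) (D.slope * v.1 + ρ * (1 / 2 * D.quad v))
        ≤ ρ * (1 + β * K * ρ ^ 2) := by linarith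
    have h3 := le_of_mul_le_mul_left h2 hρ
    change D.gauge _ ρ v ≤ 1
    rw [QuadraticModel.gauge, hspread, hshift, sub_zero, add_zero]
    linarith
  · change 0 < D.level (β * M) (-(β * K)) ρ v
    have h1 := (abs_le.1 hbd).2
    have h2 : β * (ρ ^ 2 * M) < β * (u (x + w) - u x) :=
      mul_lt_mul_of_pos_left (by linarith) hβ
    have h3 : 0 < ρ * D.level (β * M) (-(β * K)) ρ v := by
      have e : ρ * D.level (β * M) (-(β * K)) ρ v
          = ρ * (D.slope * v.1 + ρ * (1 / 2 * D.quad v)) + β * K * ρ ^ 3 - β * (ρ ^ 2 * M) := by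
        simp only [QuadraticModel.level]
        ring
      rw [e]
      linarith
    exact pos_of_mul_pos_right h3 hρ.le

/-- In rescaled coordinates a superlevel part of a model amoeba lies in a sublevel part of an
amoeba. -/
lemma image_level_subset_amoeba {ν : ℝ → ℝ} (hν : IsAmoebaProfile ν) {β : ℝ} (hβ : 0 < β)
    {Ω : Set Plane} {u : Plane → ℝ} {x : Plane}
    (b : OrthonormalBasis (Fin 2) ℝ Plane) {z : ℝ}
    (hF : ∀ v, fderiv ℝ u x (frameMap b v) = z * v.1) {D : QuadraticModel}
    (hslope : D.slope = β * z) (hspread : D.spread = 1 / 2)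
    (hquad : ∀ v, D.quad v
      = -(β * fderiv ℝ (fderiv ℝ u) x (frameMap b v) (frameMap b v))) {K : ℝ} (hK : 0 ≤ K)
    (hshift : D.shift = -(β * K)) {ρ : ℝ} (hρ : 0 < ρ)
    (hΩ : ∀ w : Plane, ‖w‖ ≤ ρ → x + w ∈ Ω)
    (hC : ∀ w : Plane, ‖w‖ ≤ ρ → ContDiffAt ℝ ∞ u (x + w))
    (hT' : ∀ w : Plane, ‖w‖ ≤ ρ → ∀ k,
      |fderiv ℝ u (x + w) k - fderiv ℝ u x k - fderiv ℝ (fderiv ℝ u) x w k| ≤ K * ‖w‖ ^ 2 * ‖k‖)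
    (hT : ∀ w : Plane, ‖w‖ ≤ ρ →
      |u (x + w) - u x - fderiv ℝ u x w - 1 / 2 * fderiv ℝ (fderiv ℝ u) x w w| ≤ K * ‖w‖ ^ 3)
    (M : ℝ) :
    (fun v => x + (-ρ) • frameMap b v) ''
        ((D.ball (amoebaPhi ν) ρ ∩ {v | 0 < D.level (-(β * M)) (β * K) ρ v}) \ {0})
      ⊆ {q ∈ amoeba ν β Ω u ρ x | u q < u x + ρ ^ 2 * M} := by
  have h := hν.isAbsoluteNorm
  rintro _ ⟨v, ⟨⟨hvb, hvl⟩, hv0⟩, rfl⟩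
  have hg : D.gauge (amoebaPhi ν) ρ v ≤ 1 := hvb
  have hl : 0 < D.level (-(β * M)) (β * K) ρ v := hvl
  have he1 : planeNorm v ≤ 1 := by
    have h1 := QuadraticModel.planeNorm_le_gauge (D := D) h ρ v
    have h2 : 0 ≤ β * K * ρ ^ 2 := by positivity
    rw [hshift] at h1
    linarith
  have hwn : ‖(-ρ) • frameMap b v‖ = ρ * planeNorm v := by
    rw [norm_smul, norm_frameMap, norm_neg, Real.norm_of_nonneg hρ.le]
  have hwρ : ‖(-ρ) • frameMap b v‖ ≤ ρ := by rw [hwn]; exact mul_le_of_le_one_right hρ.le he1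
  have hw0 : (-ρ) • frameMap b v ≠ 0 := by
    rw [← norm_ne_zero_iff, hwn]
    refine mul_ne_zero hρ.ne' fun h0 => hv0 ?_
    have h1 := abs_fst_le_planeNorm v
    have h2 := abs_snd_le_planeNorm v
    rw [h0] at h1 h2
    exact Prod.ext (abs_nonpos_iff.1 h1) (abs_nonpos_iff.1 h2)
  have hFw : fderiv ℝ u x ((-ρ) • frameMap b v) = -(ρ * (z * v.1)) := by
    rw [map_smul, hF, smul_eq_mul, neg_mul]
  have hBw : β * fderiv ℝ (fderiv ℝ u) x ((-ρ) • frameMap b v) ((-ρ) • frameMap b v)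
      = -(ρ ^ 2 * D.quad v) := by
    rw [hquad]
    simp only [map_smul, smul_apply, smul_eq_mul]
    ring
  set w := (-ρ) • frameMap b v with hw
  have hwn3 : K * ‖w‖ ^ 3 ≤ K * ρ ^ 3 := by gcongr
  have htw : ∀ t ∈ Icc (0 : ℝ) 1, ‖t • w‖ ≤ ρ := fun t ht => by
    rw [norm_smul, Real.norm_of_nonneg ht.1]
    exact (mul_le_of_le_one_left (norm_nonneg w) ht.2).trans hwρ
  constructor
  -- A and B bound the integrand at the two ends of the segment, where the scaled slope of u is, up
  -- to sign and Taylor error, τv₁ and τv₁ + ρ quad(v). Their mean is exactly the gauge with spread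
  -- 1/2.
  · refine add_mem_amoeba hν (A := ρ * amoebaPhi ν (planeNorm v) (D.slope * v.1) + β * K * ρ ^ 3)
      (B := ρ * amoebaPhi ν (planeNorm v) (D.slope * v.1 + ρ * D.quad v) + β * K * ρ ^ 3)
      hw0 (fun t ht => hΩ _ (htw t ht)) (fun t ht => hC _ (htw t ht)) ?_ ?_
    · rw [QuadraticModel.gauge, hspread, hshift, sub_self, zero_mul, mul_zero, add_zero,
        show (1 / 2 + 1 / 2 : ℝ) = 1 by norm_num, one_mul] at hg
      have := mul_le_mul_of_nonneg_left hg hρ.le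
      linarith
    · intro t ht
      have h1 := hT' _ (htw t ht) w
      have h2 : K * ‖t • w‖ ^ 2 * ‖w‖ ≤ K * ρ ^ 3 := by
        calc K * ‖t • w‖ ^ 2 * ‖w‖ ≤ K * ρ ^ 2 * ρ := by
              have := htw t ht
              gcongr
          _ = K * ρ ^ 3 := by ring
      rw [map_smul (fderiv ℝ (fderiv ℝ u) x), smul_apply, smul_eq_mul] at h1
      have h4 : |β * fderiv ℝ u (x + t • w) w - ρ * (-(D.slope * v.1 + t * (ρ * D.quad v)))|
          ≤ β * K * ρ ^ 3 := by
        have e : β * fderiv ℝ u (x + t • w) w - ρ * (-(D.slope * v.1 + t * (ρ * D.quad v)))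
            = β * (fderiv ℝ u (x + t • w) w - fderiv ℝ u x w
              - t * fderiv ℝ (fderiv ℝ u) x w w) := by
          rw [hslope, hFw]
          linear_combination t * hBw
        rw [e, abs_mul, abs_of_pos hβ, mul_assoc]
        exact mul_le_mul_of_nonneg_left (h1.trans h2) hβ.le
      have h5 := h.le_add_right (ρ * planeNorm v) (β * fderiv ℝ u (x + t • w) w)
        (ρ * (-(D.slope * v.1 + t * (ρ * D.quad v))))
      rw [h.mul_left_of_nonneg hρ.le, h.neg_right] at h5
      -- To leading order the slope of u is affine in t, so convexity of N bounds the integrand by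
      -- the interpolation of its end values.
      have h6 := h.convex ht.1 ht.2 (planeNorm v) (D.slope * v.1) (planeNorm v)
        (D.slope * v.1 + ρ * D.quad v)
      rw [show (1 - t) * planeNorm v + t * planeNorm v = planeNorm v by ring,
        show (1 - t) * (D.slope * v.1) + t * (D.slope * v.1 + ρ * D.quad v)
          = D.slope * v.1 + t * (ρ * D.quad v) by ring] at h6
      have h7 : amoebaPhi ν ‖w‖ (β * |fderiv ℝ u (x + t • w) w|)
          = amoebaPhi ν (ρ * planeNorm v) (β * fderiv ℝ u (x + t • w) w) := by
        rw [hwn, ← h.abs_right _ (β * fderiv ℝ u (x + t • w) w), abs_mul, abs_of_pos hβ]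
      rw [h7]
      have h8 := mul_le_mul_of_nonneg_left h6 hρ.le
      linarith
  · have h1 := mul_le_mul_of_nonneg_left (abs_le.1 ((hT w hwρ).trans hwn3)).2 hβ.le
    have h2 := mul_pos hρ hl
    rw [QuadraticModel.level, hslope] at h2
    rw [hFw] at h1
    have h3 : β * (u (x + w) - u x) < β * (ρ ^ 2 * M) := by linarith
    have h4 := lt_of_mul_lt_mul_left h3 hβ.le
    change u (x + w) < _
    linarith

/-- If `M` exceeds one sixth of the self-snakes operator, then the part of the amoeba above the
level `u x + ρ² M` is smaller than the part below. -/
theorem eventually_volume_gt_lt_volume_lt {ν : ℝ → ℝ} (hν : IsAmoebaProfile ν) {β : ℝ} (hβ : 0 < β)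
    {Ω : Set Plane} {u : Plane → ℝ} (hu : ContDiffOn ℝ ∞ u Ω) {x : Plane} (hx : x ∈ interior Ω)
    (b : OrthonormalBasis (Fin 2) ℝ Plane) {z : ℝ} (hz : 0 < z) (hb0 : fderiv ℝ u x (b 0) = z)
    (hb1 : fderiv ℝ u x (b 1) = 0) {M : ℝ}
    (hM : z * (β * deriv (ballMoment (amoebaPhi ν)) (β * z)) *
        fderiv ℝ (fderiv ℝ u) x (b 0) (b 0)
      + ballMoment (amoebaPhi ν) (β * z) * fderiv ℝ (fderiv ℝ u) x (b 1) (b 1) < 6 * M) :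
    ∀ᶠ ρ in 𝓝[>] (0 : ℝ), volume {q ∈ amoeba ν β Ω u ρ x | u x + ρ ^ 2 * M < u q}
      < volume {q ∈ amoeba ν β Ω u ρ x | u q < u x + ρ ^ 2 * M} := by
  have h := hν.isAbsoluteNorm
  set N := amoebaPhi ν with hN
  set B := fderiv ℝ (fderiv ℝ u) x with hB
  have hΩ : ∀ᶠ y in 𝓝 x, y ∈ Ω := mem_interior_iff_mem_nhds.1 hx
  have hu' : ∀ᶠ y in 𝓝 x, ContDiffAt ℝ ∞ u y := by
    filter_upwards [eventually_mem_nhds_iff.2 (mem_interior_iff_mem_nhds.1 hx)] with y hy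
    exact hu.contDiffAt hy
  obtain ⟨δ, hδ, K, hK, hT⟩ := exists_taylor_bound hu'
  obtain ⟨δ', hδ', hΩ'⟩ := Metric.eventually_nhds_iff_ball.1 hΩ
  have hτ : 0 < β * z := mul_pos hβ hz
  -- D₀ is the outer model for the part above the level; D₁ is the inner model for the part below
  -- it, with opposite quadratic form since the plane is reflected. Averaging the two mixed entries
  -- avoids any appeal to the symmetry of the second derivative.
  let D₀ : QuadraticModel :=
    ⟨β * z, β * B (b 0) (b 0), β * ((B (b 0) (b 1) + B (b 1) (b 0)) / 2), β * B (b 1) (b 1), 0,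
      β * K⟩
  let D₁ : QuadraticModel :=
    ⟨β * z, -(β * B (b 0) (b 0)), -(β * ((B (b 0) (b 1) + B (b 1) (b 0)) / 2)),
      -(β * B (b 1) (b 1)), 1 / 2, -(β * K)⟩
  have hq0 : ∀ v, D₀.quad v = β * B (frameMap b v) (frameMap b v) := by
    intro v
    simp only [D₀, QuadraticModel.quad, frameMap, map_add, map_smul, add_apply, smul_apply,
      smul_eq_mul]
    ring
  have hq1 : ∀ v, D₁.quad v = -(β * B (frameMap b v) (frameMap b v)) := by
    intro v
    rw [← hq0]
    simp only [D₀, D₁, QuadraticModel.quad]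
    ring
  have hFT : ∀ v, fderiv ℝ u x (frameMap b v) = z * v.1 := by
    intro v
    simp only [frameMap, map_add, map_smul, hb0, hb1, smul_eq_mul]
    ring
  have hlim0 := QuadraticModel.tendsto_volume_level (D := D₀) h hτ (by norm_num [D₀])
    (β * M) (-(β * K))
  have hlim1 := QuadraticModel.tendsto_volume_level (D := D₁) h hτ (by norm_num [D₁, abs_of_pos])
    (-(β * M)) (β * K)
  have hlt : (D₀.slope * deriv (ballMoment N) D₀.slope * D₀.a + ballMoment N D₀.slope * D₀.c
        - 6 * (β * M)) / (3 * D₀.slope)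
      < (D₁.slope * deriv (ballMoment N) D₁.slope * D₁.a + ballMoment N D₁.slope * D₁.c
        - 6 * -(β * M)) / (3 * D₁.slope) := by
    simp only [D₀, D₁]
    refine div_lt_div_of_pos_right ?_ (by positivity)
    nlinarith
  -- The factor 2 makes the resulting inequalities ρ < δ and ρ < δ' strict.
  have hsmall := eventually_pos_le_one_mul_le_one (2 * (δ⁻¹ + δ'⁻¹))
  filter_upwards [hlim0.eventually_lt hlim1 hlt, hsmall,
    eventually_pos_le_one_mul_le_one |D₀.shift|, eventually_pos_le_one_mul_le_one |D₁.shift|]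
    with ρ hρlt ⟨hρ0, hρ1, hρδ⟩ ⟨_, _, hs0⟩ ⟨_, _, hs1⟩
  have hρδ1 : ρ < δ := by
    have : 0 < δ'⁻¹ * ρ := by positivity
    have h1 : δ⁻¹ * ρ < 1 := by nlinarith [mul_pos (inv_pos.2 hδ) hρ0]
    rwa [inv_mul_lt_iff₀ hδ, mul_one] at h1
  have hρδ2 : ρ < δ' := by
    have : 0 < δ⁻¹ * ρ := by positivity
    have h1 : δ'⁻¹ * ρ < 1 := by nlinarith [mul_pos (inv_pos.2 hδ') hρ0]
    rwa [inv_mul_lt_iff₀ hδ', mul_one] at h1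
  set S₀ := D₀.ball N ρ ∩ {v | 0 < D₀.level (β * M) (-(β * K)) ρ v} with hS₀
  set S₁ := D₁.ball N ρ ∩ {v | 0 < D₁.level (-(β * M)) (β * K) ρ v} with hS₁
  have hf0 : volume S₀ ≠ ⊤ := measure_ne_top_of_subset inter_subset_left
    (QuadraticModel.volume_ball_ne_top h hρ0 hρ1 hs0)
  have hf1 : volume S₁ ≠ ⊤ := measure_ne_top_of_subset inter_subset_left
    (QuadraticModel.volume_ball_ne_top h hρ0 hρ1 hs1)
  -- Both models have the same slope, hence the same limit area; after its cancellation the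
  -- first-order terms decide.
  have hSlt : volume S₀ < volume S₁ := by
    rw [div_lt_div_iff_of_pos_right hρ0] at hρlt
    exact (ENNReal.toReal_lt_toReal hf0 hf1).1 ((sub_lt_sub_iff_right _).1 hρlt)
  have hsub0 := amoeba_level_subset hν hβ hu b hFT (D := D₀) rfl rfl hq0 hK rfl hρ0
    (fun w hw => (hT w (hw.trans_lt hρδ1)).2.2) M
  have hsub1 := image_level_subset_amoeba (Ω := Ω) hν hβ b hFT (D := D₁) rfl rfl hq1 hK rfl hρ0
    (fun w hw => hΩ' _ (by rw [mem_ball_iff_norm, add_sub_cancel_left]; exact hw.trans_lt hρδ2))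
    (fun w hw => (hT w (hw.trans_lt hρδ1)).1) (fun w hw => (hT w (hw.trans_lt hρδ1)).2.1)
    (fun w hw => (hT w (hw.trans_lt hρδ1)).2.2) M
  calc volume {q ∈ amoeba ν β Ω u ρ x | u x + ρ ^ 2 * M < u q}
      ≤ ENNReal.ofReal (ρ ^ 2) * volume S₀ :=
        (measure_mono hsub0).trans_eq (volume_image_frameMap b x ρ S₀)
    _ < ENNReal.ofReal (ρ ^ 2) * volume S₁ :=
        (ENNReal.mul_lt_mul_iff_right (by simp; positivity) ENNReal.ofReal_ne_top).2 hSlt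
    _ = ENNReal.ofReal ((-ρ) ^ 2) * volume (S₁ \ {0}) := by
        rw [neg_sq, measure_sdiff_null (by simp)]
    _ ≤ volume {q ∈ amoeba ν β Ω u ρ x | u q < u x + ρ ^ 2 * M} :=
        (volume_image_frameMap b x (-ρ) _).symm.trans_le (measure_mono hsub1)

lemma amoeba_neg (ν : ℝ → ℝ) (β : ℝ) (Ω : Set Plane) (u : Plane → ℝ) (ρ : ℝ) (p : Plane) :
    amoeba ν β Ω (-u) ρ p = amoeba ν β Ω u ρ p := by
  have h : ∀ c : ℝ → Plane, amoebaLength ν β (-u) c = amoebaLength ν β u c := by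
    intro c
    have e : (-u) ∘ c = -(u ∘ c) := rfl
    simp only [amoebaLength, e, derivWithin.neg, abs_neg]
  simp only [amoeba, amoebaDist, h]

/-- If `M` is less than one sixth of the self-snakes operator, then the part of the amoeba below the
level `u x + ρ² M` is smaller than the part above. -/
theorem eventually_volume_lt_lt_volume_gt {ν : ℝ → ℝ} (hν : IsAmoebaProfile ν) {β : ℝ} (hβ : 0 < β)
    {Ω : Set Plane} {u : Plane → ℝ} (hu : ContDiffOn ℝ ∞ u Ω) {x : Plane} (hx : x ∈ interior Ω)
    (b : OrthonormalBasis (Fin 2) ℝ Plane) {z : ℝ} (hz : 0 < z) (hb0 : fderiv ℝ u x (b 0) = z)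
    (hb1 : fderiv ℝ u x (b 1) = 0) {M : ℝ}
    (hM : 6 * M < z * (β * deriv (ballMoment (amoebaPhi ν)) (β * z)) *
        fderiv ℝ (fderiv ℝ u) x (b 0) (b 0)
      + ballMoment (amoebaPhi ν) (β * z) * fderiv ℝ (fderiv ℝ u) x (b 1) (b 1)) :
    ∀ᶠ ρ in 𝓝[>] (0 : ℝ), volume {q ∈ amoeba ν β Ω u ρ x | u q < u x + ρ ^ 2 * M}
      < volume {q ∈ amoeba ν β Ω u ρ x | u x + ρ ^ 2 * M < u q} := by
  have hd : fderiv ℝ (-u) = -fderiv ℝ u := funext fun y => fderiv_neg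
  have hdd : fderiv ℝ (fderiv ℝ (-u)) x = -fderiv ℝ (fderiv ℝ u) x := by rw [hd, fderiv_neg]
  -- The gradient of -u points the other way. Negating the frame restores the hypotheses, and the
  -- Hessian entries only change sign because they are quadratic in the frame.
  have hb : ∀ i, (b.map (LinearIsometryEquiv.neg ℝ)) i = -b i := fun i => by simp
  have := eventually_volume_gt_lt_volume_lt hν hβ (u := -u) hu.neg hx
    (b.map (LinearIsometryEquiv.neg ℝ)) hz
    (by simp [hd, hb, hb0]) (by simp [hd, hb, hb1]) (M := -M) (by
      simp only [hdd, hb, map_neg, neg_apply, neg_neg]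
      linarith)
  filter_upwards [this] with ρ hρ
  simp only [amoeba_neg, Pi.neg_apply, mul_neg, ← neg_add, neg_lt_neg_iff] at hρ
  exact hρ

/-! ### Medians: existence, bounds and uniqueness -/

/-- Every finite measure on the real line has a median. -/
lemma exists_median (μ : Measure ℝ) [IsFiniteMeasure μ] :
    ∃ m, μ univ ≤ 2 * μ (Iic m) ∧ μ univ ≤ 2 * μ (Ici m) := by
  rcases eq_or_ne (μ univ) 0 with h0 | h0
  · exact ⟨0, by simp [h0], by simp [h0]⟩
  have hlt : μ univ < 2 * μ univ := by
    rw [two_mul]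
    exact ENNReal.lt_add_right (measure_ne_top μ univ) h0
  -- The median is the infimum of S; continuity of μ from above passes both half-mass conditions to
  -- the limit, from the right and from the left.
  set S : Set ℝ := {y | μ univ ≤ 2 * μ (Iic y)} with hS
  have hup : ∀ y ∈ S, ∀ y', y ≤ y' → y' ∈ S := fun y hy y' hyy' =>
    hy.trans (mul_le_mul_right (measure_mono (Iic_subset_Iic.2 hyy')) 2)
  have hne : S.Nonempty := by
    have h1 := ENNReal.Tendsto.const_mul (a := 2) (tendsto_measure_Iic_atTop μ)
      (Or.inr (by simp))
    obtain ⟨y, hy⟩ := (h1.eventually (lt_mem_nhds hlt)).exists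
    exact ⟨y, hy.le⟩
  have hbdd : BddBelow S := by
    have h1 := ENNReal.Tendsto.const_mul (a := 2) (tendsto_measure_Ici_atBot μ)
      (Or.inr (by simp))
    obtain ⟨y, hy⟩ := (h1.eventually (lt_mem_nhds hlt)).exists
    refine ⟨y, fun y' hy' => le_of_not_gt fun h => ?_⟩
    have h2 : μ univ = μ (Iio y) + μ (Ici y) := by
      rw [← measure_union (Iio_disjoint_Ici le_rfl) measurableSet_Ici, Iio_union_Ici]
    rw [h2, two_mul, ENNReal.add_lt_add_iff_right (measure_ne_top _ _)] at hy
    have h3 : μ univ ≤ μ (Iio y) + μ (Iio y) := by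
      rw [← two_mul]
      exact hy'.trans (mul_le_mul_right (measure_mono (Iic_subset_Iio.2 h)) 2)
    rw [h2] at h3
    exact ((ENNReal.add_lt_add_iff_left (measure_ne_top _ _)).2 hy).not_ge h3
  set m := sInf S with hm
  have hin : ∀ r > 0, m + r ∈ S := fun r hr => by
    obtain ⟨y, hy, hyr⟩ := exists_lt_of_csInf_lt hne (lt_add_of_pos_right m hr)
    exact hup y hy _ hyr.le
  have hout : ∀ r > 0, m - r ∉ S := fun r hr h => by
    have := csInf_le hbdd h
    linarith
  refine ⟨m, ?_, ?_⟩
  · have e : ⋂ r > (0 : ℝ), Iic (m + r) = Iic m := by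
      ext y
      simp only [mem_iInter, mem_Iic]
      exact ⟨fun h => le_of_forall_pos_le_add h, fun h r hr => h.trans (by linarith)⟩
    have h1 := tendsto_measure_biInter_gt (μ := μ) (s := fun r => Iic (m + r)) (a := 0)
      (fun r _ => measurableSet_Iic.nullMeasurableSet)
      (fun i j _ hij => Iic_subset_Iic.2 (by linarith)) ⟨1, one_pos, measure_ne_top _ _⟩
    rw [e] at h1
    refine ge_of_tendsto (ENNReal.Tendsto.const_mul (a := 2) h1 (Or.inr (by simp))) ?_
    filter_upwards [self_mem_nhdsWithin] with r hr using hin r hr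
  · have e : ⋂ r > (0 : ℝ), Ioi (m - r) = Ici m := by
      ext y
      simp only [mem_iInter, mem_Ioi, mem_Ici]
      refine ⟨fun h => le_of_forall_pos_le_add fun r hr => ?_, fun h r hr => by linarith⟩
      have := h r hr
      linarith
    have h1 := tendsto_measure_biInter_gt (μ := μ) (s := fun r => Ioi (m - r)) (a := 0)
      (fun r _ => measurableSet_Ioi.nullMeasurableSet)
      (fun i j _ hij => Ioi_subset_Ioi (by linarith)) ⟨1, one_pos, measure_ne_top _ _⟩
    rw [e] at h1
    refine ge_of_tendsto (ENNReal.Tendsto.const_mul (a := 2) h1 (Or.inr (by simp))) ?_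
    filter_upwards [self_mem_nhdsWithin] with r hr
    have h2 : 2 * μ (Iic (m - r)) < μ univ := not_le.1 (hout r hr)
    have h3 : μ univ = μ (Iic (m - r)) + μ (Ioi (m - r)) := by
      rw [← measure_union (Iic_disjoint_Ioi le_rfl) measurableSet_Ioi, Iic_union_Ioi]
    rw [h3, two_mul, ENNReal.add_lt_add_iff_left (measure_ne_top _ _)] at h2
    rw [h3, two_mul]
    exact add_le_add_left h2.le _

/-- The distribution of the values of a continuous function on a subset of a compact set. -/
lemma exists_measure_eq_volume_sep {A K : Set Plane} {u : Plane → ℝ} (hK : IsCompact K)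
    (hu : ContinuousOn u K) (hA : A ⊆ K) :
    ∃ μ : Measure ℝ, IsFiniteMeasure μ ∧
      ∀ s, MeasurableSet s → volume {q ∈ A | u q ∈ s} = μ s := by
  classical
  have hf : Measurable (K.indicator u) := by
    have h1 := hu.measurable_piecewise (continuous_const (y := (0 : ℝ))).continuousOn
      hK.measurableSet
    rwa [← piecewise_eq_indicator]
  have hfin : IsFiniteMeasure (volume.restrict A) :=
    ⟨by rw [Measure.restrict_apply_univ]; exact (measure_mono hA).trans_lt hK.measure_lt_top⟩
  -- A need not be measurable: for a restricted measure it suffices that the preimage is. Cutting u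
  -- off outside K makes it measurable on the whole plane.
  refine ⟨(volume.restrict A).map (K.indicator u), inferInstance, fun s hs => ?_⟩
  rw [Measure.map_apply hf hs, Measure.restrict_apply (hf hs)]
  congr 1
  ext q
  simp only [mem_ofPred_eq, mem_inter_iff, mem_preimage]
  refine ⟨fun ⟨h1, h2⟩ => ⟨by rwa [indicator_of_mem (hA h1)], h1⟩, fun ⟨h1, h2⟩ => ⟨h2, ?_⟩⟩
  rwa [indicator_of_mem (hA h2)] at h1

lemma isMedianOn_iff {A : Set Plane} {u : Plane → ℝ} {μ : Measure ℝ}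
    (hμ : ∀ s, MeasurableSet s → volume {q ∈ A | u q ∈ s} = μ s) (m : ℝ) :
    IsMedianOn u A m ↔ μ univ ≤ 2 * μ (Iic m) ∧ μ univ ≤ 2 * μ (Ici m) := by
  rw [← hμ _ MeasurableSet.univ, ← hμ _ measurableSet_Iic, ← hμ _ measurableSet_Ici]
  simp [IsMedianOn]

lemma median_le_of_measure_Ioi_lt {μ : Measure ℝ} {a m : ℝ} (h : μ (Ioi a) < μ (Iio a))
    (hm : μ univ ≤ 2 * μ (Ici m)) : m ≤ a := by
  by_contra! ham
  have h1 : μ (Ici m) ≤ μ (Ioi a) := measure_mono (Ici_subset_Ioi.2 ham)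
  have h2 : μ (Ioi a) + μ (Iio a) ≤ μ univ := by
    rw [← measure_union (by grind) measurableSet_Iio]
    exact measure_mono (subset_univ _)
  have h3 : 2 * μ (Ici m) ≤ μ (Ioi a) + μ (Ioi a) := by
    rw [two_mul]; exact add_le_add h1 h1
  exact ((hm.trans h3).trans_lt
    ((ENNReal.add_lt_add_iff_left (h.trans_le le_top).ne).2 h)).not_ge h2

lemma le_median_of_measure_Iio_lt {μ : Measure ℝ} {a m : ℝ} (h : μ (Iio a) < μ (Ioi a))
    (hm : μ univ ≤ 2 * μ (Iic m)) : a ≤ m := by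
  by_contra! ham
  have h1 : μ (Iic m) ≤ μ (Iio a) := measure_mono (Iic_subset_Iio.2 ham)
  have h2 : μ (Iio a) + μ (Ioi a) ≤ μ univ := by
    rw [← measure_union (by grind) measurableSet_Ioi]
    exact measure_mono (subset_univ _)
  have h3 : 2 * μ (Iic m) ≤ μ (Iio a) + μ (Iio a) := by
    rw [two_mul]; exact add_le_add h1 h1
  exact ((hm.trans h3).trans_lt
    ((ENNReal.add_lt_add_iff_left (h.trans_le le_top).ne).2 h)).not_ge h2

/-- The two outer half lines are disjoint and each carries at least half of the mass. -/
lemma measure_Ioo_eq_zero_of_medians {μ : Measure ℝ} [IsFiniteMeasure μ] {m₁ m₂ : ℝ}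
    (hlt : m₁ < m₂) (h₁ : μ univ ≤ 2 * μ (Iic m₁)) (h₂ : μ univ ≤ 2 * μ (Ici m₂)) :
    μ (Ioo m₁ m₂) = 0 := by
  have h : μ univ = μ (Iic m₁) + (μ (Ioo m₁ m₂) + μ (Ici m₂)) := by
    rw [← measure_union (by grind) measurableSet_Ici,
      Ioo_union_Ici_eq_Ioi hlt,
      ← measure_union (Iic_disjoint_Ioi le_rfl) measurableSet_Ioi, Iic_union_Ioi]
  have h' : μ.real univ = μ.real (Iic m₁) + (μ.real (Ioo m₁ m₂) + μ.real (Ici m₂)) := by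
    simp only [Measure.real]
    rw [h, ENNReal.toReal_add (by simp) (by simp), ENNReal.toReal_add (by simp) (by simp)]
  have h₁' := ENNReal.toReal_mono (by finiteness) h₁
  have h₂' := ENNReal.toReal_mono (by finiteness) h₂
  simp only [ENNReal.toReal_mul, ENNReal.toReal_ofNat] at h₁' h₂'
  change μ.real univ ≤ 2 * μ.real _ at h₁' h₂'
  have h3 : μ.real (Ioo m₁ m₂) = 0 := le_antisymm (by linarith) measureReal_nonneg
  exact (measureReal_eq_zero_iff (by finiteness)).1 h3

lemma amoeba_subset_closedBall {ν : ℝ → ℝ} (hν : IsAmoebaProfile ν) {β : ℝ} (hβ : 0 ≤ β)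
    {Ω : Set Plane} {u : Plane → ℝ} (hu : ContDiffOn ℝ ∞ u Ω) {ρ : ℝ} (hρ : 0 ≤ ρ) (x : Plane) :
    amoeba ν β Ω u ρ x ⊆ Metric.closedBall x ρ := fun q hq => by
  rw [mem_closedBall_iff_norm]
  exact (le_abs_self _).trans ((hν.isAbsoluteNorm.abs_left_le _ _).trans
    (amoebaPhi_le_of_mem_amoeba hν hβ hu hρ hq))

/-- Amoebas contain (punctured) discs whose radius is proportional to that of the amoeba. -/
lemma exists_forall_add_mem_amoeba {ν : ℝ → ℝ} (hν : IsAmoebaProfile ν) {β : ℝ} (hβ : 0 < β)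
    {Ω : Set Plane} {u : Plane → ℝ} {x : Plane} (hΩ : ∀ᶠ y in 𝓝 x, y ∈ Ω)
    (hu : ∀ᶠ y in 𝓝 x, ContDiffAt ℝ ∞ u y) :
    ∃ L > 0, ∀ᶠ ρ in 𝓝[>] (0 : ℝ), ∀ w : Plane, ‖w‖ ≤ L * ρ → w ≠ 0 →
      x + w ∈ amoeba ν β Ω u ρ x := by
  have h := hν.isAbsoluteNorm
  set C := ‖fderiv ℝ u x‖ + 1 with hC
  have hcont : ContinuousAt (fderiv ℝ u) x :=
    (hu.self_of_nhds.fderiv_right (m := 0) (by norm_cast)).continuousAt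
  have hCx : ∀ᶠ y in 𝓝 x, ‖fderiv ℝ u y‖ < C := hcont.norm.eventually (gt_mem_nhds (by simp [hC]))
  obtain ⟨δ, hδ, hball⟩ := Metric.eventually_nhds_iff_ball.1 (hΩ.and (hu.and hCx))
  have hC0 : 0 < 1 + β * C := by positivity
  -- C bounds the gradient near x, so a segment w has amoeba length at most (1 + βC)‖w‖.
  refine ⟨(1 + β * C)⁻¹, inv_pos.2 hC0, ?_⟩
  filter_upwards [Ioo_mem_nhdsGT hδ] with ρ hρ w hw hw0
  have hwρ : ‖w‖ * (1 + β * C) ≤ ρ := by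
    rw [mul_comm]; exact (le_inv_mul_iff₀ hC0).1 hw
  have hwδ : ‖w‖ < δ :=
    ((le_mul_of_one_le_right (norm_nonneg w) (by simp; positivity)).trans hwρ).trans_lt hρ.2
  have hb : ∀ t ∈ Icc (0 : ℝ) 1, x + t • w ∈ Metric.ball x δ := fun t ht => by
    rw [mem_ball_iff_norm, add_sub_cancel_left, norm_smul, Real.norm_of_nonneg ht.1]
    exact (mul_le_of_le_one_left (norm_nonneg w) ht.2).trans_lt hwδ
  refine add_mem_amoeba hν hw0 (fun t ht => (hball _ (hb t ht)).1)
    (fun t ht => (hball _ (hb t ht)).2.1) (A := ρ) (B := ρ) (by linarith) fun t ht => ?_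
  have h1 := h.le_add_right ‖w‖ (β * |fderiv ℝ u (x + t • w) w|) 0
  have h2 : |fderiv ℝ u (x + t • w) w| ≤ C * ‖w‖ :=
    (ContinuousLinearMap.le_opNorm _ _).trans
      (mul_le_mul_of_nonneg_right (hball _ (hb t ht)).2.2.le (norm_nonneg w))
  have h3 := mul_le_mul_of_nonneg_left h2 hβ.le
  rw [h.zero_right, abs_norm, sub_zero,
    abs_of_nonneg (mul_nonneg hβ.le (abs_nonneg (fderiv ℝ u (x + t • w) w)))] at h1
  linarith

/-- Two distinct numbers close to `u x` cannot both be medians of `u` on a small amoeba. -/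
lemma eventually_median_unique {ν : ℝ → ℝ} (hν : IsAmoebaProfile ν) {β : ℝ} (hβ : 0 < β)
    {Ω : Set Plane} {u : Plane → ℝ} {x : Plane} (hΩ : ∀ᶠ y in 𝓝 x, y ∈ Ω)
    (hu : ∀ᶠ y in 𝓝 x, ContDiffAt ℝ ∞ u y) (hx : fderiv ℝ u x ≠ 0) (k : ℝ) :
    ∀ᶠ ρ in 𝓝[>] (0 : ℝ), ∀ m₁ m₂ : ℝ, u x - ρ ^ 2 * k ≤ m₁ → m₂ ≤ u x + ρ ^ 2 * k → m₁ < m₂ →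
      volume {q ∈ amoeba ν β Ω u ρ x | u q ∈ Ioo m₁ m₂} ≠ 0 := by
  obtain ⟨L, hL, hA⟩ := exists_forall_add_mem_amoeba hν hβ hΩ hu
  obtain ⟨v, hv⟩ : ∃ v, 0 < fderiv ℝ u x v := by
    by_contra! hneg
    refine hx (ContinuousLinearMap.ext fun v => le_antisymm (hneg v) ?_)
    have := hneg (-v)
    rw [map_neg] at this
    simpa using this
  have hv0 : 0 < ‖v‖ := norm_pos_iff.2 fun h0 => by simp [h0] at hv
  -- The length L/2 keeps the segment from x - ρn to x + ρn inside the disc of radius Lρ.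
  set n : Plane := (L / (2 * ‖v‖)) • v with hn
  have hnn : ‖n‖ = L / 2 := by
    rw [hn, norm_smul, Real.norm_of_nonneg (by positivity)]
    field_simp
  have hnpos : 0 < fderiv ℝ u x n := by
    rw [hn, map_smul, smul_eq_mul]
    positivity
  set z := fderiv ℝ u x n with hz
  have hline : ∀ c : Plane, HasDerivAt (fun r : ℝ => u (x + r • c)) (fderiv ℝ u x c) 0 := by
    intro c
    have h1 : HasDerivAt (fun r : ℝ => x + r • c) c 0 := by
      simpa using ((hasDerivAt_id (0 : ℝ)).smul_const c).const_add x
    have h2 : HasFDerivAt u (fderiv ℝ u x) (x + (0 : ℝ) • c) := by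
      rw [zero_smul, add_zero]
      exact (hu.self_of_nhds.differentiableAt (by simp)).hasFDerivAt
    exact h2.comp_hasDerivAt 0 h1
  have hsq : HasDerivAt (fun r : ℝ => u x + r ^ 2 * k) 0 0 :=
    ((((hasDerivAt_id (0 : ℝ)).pow 2).mul_const k).const_add (u x)).congr_deriv (by simp)
  have hsq' : HasDerivAt (fun r : ℝ => u x - r ^ 2 * k) 0 0 :=
    ((((hasDerivAt_id (0 : ℝ)).pow 2).mul_const k).const_sub (u x)).congr_deriv (by simp)
  -- Along ±n the image changes linearly in ρ and so leaves the window of half-width kρ²; by the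
  -- intermediate value theorem it attains every value in between.
  have hup := eventually_lt_of_hasDerivAt_pos ((hline n).sub hsq) (by simpa using hnpos)
  have hdown := eventually_lt_of_hasDerivAt_pos (hsq'.sub (hline (-n))) (by simpa using hnpos)
  obtain ⟨δ, hδ, hball⟩ := Metric.eventually_nhds_iff_ball.1 hu
  filter_upwards [hA, hup, hdown, Ioo_mem_nhdsGT (show 0 < δ / L by positivity)]
    with ρ hAρ hupρ hdownρ hρ m₁ m₂ hm₁ hm₂ hlt
  simp only [zero_smul, add_zero, zero_pow two_ne_zero, zero_mul, sub_zero, sub_self,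
    Pi.sub_apply] at hupρ hdownρ
  have hLρ : L * ρ < δ := by rw [mul_comm]; exact (lt_div_iff₀ hL).1 hρ.2
  have hcont : ContinuousOn u (Metric.ball x (L * ρ)) := fun y hy =>
    (hball y (Metric.ball_subset_ball hLρ.le hy)).continuousAt.continuousWithinAt
  have hmem : ∀ t ∈ Icc (-ρ) ρ, x + t • n ∈ Metric.ball x (L * ρ) := fun t ht => by
    rw [mem_ball_iff_norm, add_sub_cancel_left, norm_smul, hnn, Real.norm_eq_abs]
    have := abs_le.2 ht
    have h1 : |t| * (L / 2) ≤ ρ * (L / 2) := by gcongr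
    have h2 : 0 < L * ρ := mul_pos hL hρ.1
    linarith
  have hivt := intermediate_value_Icc (show -ρ ≤ ρ by linarith [hρ.1])
    (f := fun t : ℝ => u (x + t • n)) (hcont.comp (by fun_prop) hmem)
  obtain ⟨t, ht, htm⟩ := hivt (show (m₁ + m₂) / 2 ∈ Icc _ _ by
    constructor
    · rw [neg_smul, ← smul_neg]
      linarith
    · linarith)
  set O := Metric.ball x (L * ρ) ∩ u ⁻¹' Ioo m₁ m₂ with hO
  have hOo : IsOpen O := hcont.isOpen_inter_preimage Metric.isOpen_ball isOpen_Ioo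
  have hOn : O.Nonempty := ⟨x + t • n, hmem t ht, by
    simp only [mem_preimage, mem_Ioo]
    simp only at htm
    constructor <;> linarith⟩
  have hsub : O \ {x} ⊆ {q ∈ amoeba ν β Ω u ρ x | u q ∈ Ioo m₁ m₂} := by
    rintro q ⟨⟨hq1, hq2⟩, hqx⟩
    refine ⟨?_, hq2⟩
    have := hAρ (q - x) (mem_ball_iff_norm.1 hq1).le (sub_ne_zero.2 hqx)
    rwa [add_sub_cancel] at this
  refine ((hOo.measure_pos volume hOn).trans_le ?_).ne'
  rw [← measure_sdiff_null (s := O) (measure_singleton x)]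
  exact measure_mono hsub

/-- The expansion of the amoeba median, with the self-snakes operator in gauge coordinates. -/
theorem exists_median_isLittleO {ν : ℝ → ℝ} (hν : IsAmoebaProfile ν) {β : ℝ} (hβ : 0 < β)
    {Ω : Set Plane} {u : Plane → ℝ} (hu : ContDiffOn ℝ ∞ u Ω) {x : Plane} (hx : x ∈ interior Ω)
    (b : OrthonormalBasis (Fin 2) ℝ Plane) {z : ℝ} (hz : 0 < z) (hb0 : fderiv ℝ u x (b 0) = z)
    (hb1 : fderiv ℝ u x (b 1) = 0) {κ : ℝ}
    (hκ : κ = z * (β * deriv (ballMoment (amoebaPhi ν)) (β * z)) *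
        fderiv ℝ (fderiv ℝ u) x (b 0) (b 0)
      + ballMoment (amoebaPhi ν) (β * z) * fderiv ℝ (fderiv ℝ u) x (b 1) (b 1)) :
    ∃ m : ℝ → ℝ,
      (∀ᶠ ρ in 𝓝[>] (0 : ℝ), ∀ y : ℝ, IsMedianOn u (amoeba ν β Ω u ρ x) y ↔ y = m ρ) ∧
      (fun ρ : ℝ => m ρ - (u x + ρ ^ 2 / 6 * κ)) =o[𝓝[>] (0 : ℝ)] (fun ρ : ℝ => ρ ^ 2) := by
  have hΩ : ∀ᶠ y in 𝓝 x, y ∈ Ω := mem_interior_iff_mem_nhds.1 hx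
  have hu' : ∀ᶠ y in 𝓝 x, ContDiffAt ℝ ∞ u y := by
    filter_upwards [eventually_mem_nhds_iff.2 (mem_interior_iff_mem_nhds.1 hx)] with y hy
    exact hu.contDiffAt hy
  have hdu : fderiv ℝ u x ≠ 0 := fun h0 => by simp [h0, hz.ne] at hb0
  obtain ⟨δ, hδ, hball⟩ := Metric.eventually_nhds_iff_ball.1 hu'
  have hdist : ∀ᶠ ρ in 𝓝[>] (0 : ℝ), ∃ μ : Measure ℝ, IsFiniteMeasure μ ∧
      ∀ s, MeasurableSet s → volume {q ∈ amoeba ν β Ω u ρ x | u q ∈ s} = μ s := by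
    filter_upwards [Ioo_mem_nhdsGT hδ] with ρ hρ
    exact exists_measure_eq_volume_sep (isCompact_closedBall x ρ)
      (fun y hy => (hball y (Metric.closedBall_subset_ball hρ.2 hy)).continuousAt.continuousWithinAt)
      (amoeba_subset_closedBall hν hβ.le hu hρ.1.le x)
  have hbound : ∀ ε > 0, ∀ᶠ ρ in 𝓝[>] (0 : ℝ), ∀ y, IsMedianOn u (amoeba ν β Ω u ρ x) y →
      |y - (u x + ρ ^ 2 / 6 * κ)| ≤ ε * ρ ^ 2 := by
    intro ε hε
    filter_upwards [hdist,
      eventually_volume_gt_lt_volume_lt hν hβ hu hx b hz hb0 hb1 (M := κ / 6 + ε) (by linarith),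
      eventually_volume_lt_lt_volume_gt hν hβ hu hx b hz hb0 hb1 (M := κ / 6 - ε) (by linarith)]
      with ρ ⟨μ, _, hμ⟩ h1 h2 y hy
    rw [isMedianOn_iff hμ] at hy
    have e1 := hμ _ (measurableSet_Ioi (a := u x + ρ ^ 2 * (κ / 6 + ε)))
    have e2 := hμ _ (measurableSet_Iio (a := u x + ρ ^ 2 * (κ / 6 + ε)))
    have e3 := hμ _ (measurableSet_Ioi (a := u x + ρ ^ 2 * (κ / 6 - ε)))
    have e4 := hμ _ (measurableSet_Iio (a := u x + ρ ^ 2 * (κ / 6 - ε)))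
    simp only [mem_Ioi, mem_Iio] at e1 e2 e3 e4
    rw [e1, e2] at h1
    rw [e3, e4] at h2
    have h3 := median_le_of_measure_Ioi_lt h1 hy.2
    have h4 := le_median_of_measure_Iio_lt h2 hy.1
    rw [abs_le]
    constructor <;> linarith
  -- Any choice of a median works, since the bound holds for all medians. With ε = 1 it puts them
  -- all in a window of half-width (|κ|/6 + 1)ρ², where they are unique.
  refine ⟨fun ρ => Classical.epsilon fun y => IsMedianOn u (amoeba ν β Ω u ρ x) y, ?_, ?_⟩
  · filter_upwards [hdist, hbound 1 one_pos, eventually_median_unique hν hβ hΩ hu' hdu (|κ| / 6 + 1)]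
      with ρ ⟨μ, _, hμ⟩ hb hun
    have hex : ∃ y, IsMedianOn u (amoeba ν β Ω u ρ x) y := by
      obtain ⟨y, hy⟩ := exists_median μ
      exact ⟨y, (isMedianOn_iff hμ y).2 hy⟩
    have hnlt : ∀ y₁ y₂, IsMedianOn u (amoeba ν β Ω u ρ x) y₁ →
        IsMedianOn u (amoeba ν β Ω u ρ x) y₂ → ¬ y₁ < y₂ := by
      intro y₁ y₂ h₁ h₂ hlt
      have b1 := abs_le.1 (hb y₁ h₁)
      have b2 := abs_le.1 (hb y₂ h₂)
      have b3 : ρ ^ 2 / 6 * κ ≤ ρ ^ 2 / 6 * |κ| := by gcongr; exact le_abs_self κ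
      have b4 : ρ ^ 2 / 6 * -|κ| ≤ ρ ^ 2 / 6 * κ := by gcongr; exact neg_abs_le κ
      refine hun y₁ y₂ (by linarith) (by linarith) hlt ?_
      rw [hμ _ measurableSet_Ioo]
      exact measure_Ioo_eq_zero_of_medians hlt ((isMedianOn_iff hμ _).1 h₁).1
        ((isMedianOn_iff hμ _).1 h₂).2
    have hspec := Classical.epsilon_spec hex
    intro y
    refine ⟨fun hy => le_antisymm (not_lt.1 (hnlt _ _ hspec hy)) (not_lt.1 (hnlt _ _ hy hspec)), ?_⟩
    rintro rfl
    exact hspec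
  · refine isLittleO_iff.2 fun ε hε => ?_
    filter_upwards [hdist, hbound ε hε] with ρ ⟨μ, _, hμ⟩ hb
    have hex : ∃ y, IsMedianOn u (amoeba ν β Ω u ρ x) y := by
      obtain ⟨y, hy⟩ := exists_median μ
      exact ⟨y, (isMedianOn_iff hμ y).2 hy⟩
    rw [Real.norm_eq_abs, Real.norm_of_nonneg (sq_nonneg ρ)]
    exact hb _ (Classical.epsilon_spec hex)

/-! ### The self-snakes operator in the gradient frame, and the theorem -/

/-- The divergence is the trace of the derivative, hence independent of the orthonormal basis. -/
lemma planeDiv_eq_sum_inner (X : Plane → Plane) (x : Plane)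
    (b : OrthonormalBasis (Fin 2) ℝ Plane) :
    planeDiv X x = ∑ i, inner ℝ (b i) (fderiv ℝ X x (b i)) := by
  have h1 := LinearMap.trace_eq_sum_inner (fderiv ℝ X x : Plane →ₗ[ℝ] Plane) b
  rw [LinearMap.trace_eq_sum_inner _ (EuclideanSpace.basisFun (Fin 2) ℝ)] at h1
  simpa [planeDiv, EuclideanSpace.inner_single_left] using h1

/-- The derivative of a vector field of the form `q(|∇u|) ∇u`. -/
lemma hasFDerivAt_comp_norm_gradient_smul {u : Plane → ℝ} {x : Plane} (hu : ContDiffAt ℝ 2 u x)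
    (hx : gradient u x ≠ 0) {q : ℝ → ℝ} {q' : ℝ} (hq : HasDerivAt q q' ‖gradient u x‖) :
    ∃ X' : Plane →L[ℝ] Plane,
      HasFDerivAt (fun y => q ‖gradient u y‖ • gradient u y) X' x ∧
      ∀ w k, inner ℝ k (X' w) = q ‖gradient u x‖ * fderiv ℝ (fderiv ℝ u) x w k
        + q' / ‖gradient u x‖ * fderiv ℝ (fderiv ℝ u) x w (gradient u x) * fderiv ℝ u x k := by
  let J : StrongDual ℝ Plane →L[ℝ] Plane :=
    { toFun := (InnerProductSpace.toDual ℝ Plane).symm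
      map_add' := map_add _
      map_smul' := fun c f => by simp
      cont := (InnerProductSpace.toDual ℝ Plane).symm.continuous }
  have hJ : ∀ (f : StrongDual ℝ Plane) (k : Plane), inner ℝ (J f) k = f k := fun f k =>
    InnerProductSpace.toDual_symm_apply
  have hF : HasFDerivAt (fderiv ℝ u) (fderiv ℝ (fderiv ℝ u) x) x :=
    ((hu.fderiv_right (m := 1) (by norm_num)).differentiableAt (by norm_num)).hasFDerivAt
  have hG : HasFDerivAt (gradient u) (J ∘L fderiv ℝ (fderiv ℝ u) x) x :=
    J.hasFDerivAt.comp x hF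
  have hpos : 0 < ‖gradient u x‖ := norm_pos_iff.2 hx
  have hr := hG.norm_sq.sqrt (by positivity)
  simp only [Real.sqrt_sq (norm_nonneg _)] at hr
  refine ⟨_, (hq.comp_hasFDerivAt x hr).smul hG, fun w k => ?_⟩
  have e1 : inner ℝ k (gradient u x) = fderiv ℝ u x k := by
    rw [real_inner_comm, inner_gradient_left]
  have e2 : inner ℝ k (J (fderiv ℝ (fderiv ℝ u) x w)) = fderiv ℝ (fderiv ℝ u) x w k := by
    rw [real_inner_comm, hJ]
  have e3 : inner ℝ (gradient u x) (J (fderiv ℝ (fderiv ℝ u) x w))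
      = fderiv ℝ (fderiv ℝ u) x w (gradient u x) := by
    rw [real_inner_comm, hJ]
  simp [inner_add_right, inner_smul_right, e1, e2, e3]
  field_simp
  simp

/-- An orthonormal frame whose first vector is the direction of the gradient. -/
lemma exists_gradient_frame {u : Plane → ℝ} {x : Plane} (hx : gradient u x ≠ 0) :
    ∃ b : OrthonormalBasis (Fin 2) ℝ Plane, gradient u x = ‖gradient u x‖ • b 0 ∧
      fderiv ℝ u x (b 0) = ‖gradient u x‖ ∧ fderiv ℝ u x (b 1) = 0 := by
  have hpos : 0 < ‖gradient u x‖ := norm_pos_iff.2 hx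
  have hn : ‖‖gradient u x‖⁻¹ • gradient u x‖ = 1 := by
    rw [norm_smul, norm_inv, norm_norm, inv_mul_cancel₀ hpos.ne']
  obtain ⟨b, hb⟩ := Orthonormal.exists_orthonormalBasis_extension_of_card_eq (𝕜 := ℝ)
    (E := Plane) (ι := Fin 2) (by simp) (v := fun _ => ‖gradient u x‖⁻¹ • gradient u x) (s := {0})
    ⟨fun _ => hn, fun i j hij => (hij (Subsingleton.elim i j)).elim⟩
  have hb0 : gradient u x = ‖gradient u x‖ • b 0 := by
    rw [hb 0 rfl, smul_inv_smul₀ hpos.ne']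
  refine ⟨b, hb0, ?_, ?_⟩
  · rw [← inner_gradient_left, hb0, inner_smul_left, real_inner_self_eq_norm_sq, b.norm_eq_one,
      norm_smul, b.norm_eq_one]
    simp
  · rw [← inner_gradient_left, hb0, inner_smul_left, b.inner_eq_zero (by decide), mul_zero]

theorem mainTheorem1 (ν : ℝ → ℝ) (hν : IsAmoebaProfile ν) (β : ℝ) (hβ : 0 < β) :
    (∀ z, 0 ≤ z → 0 ≤ edgeStopping ν β z) ∧
    AntitoneOn (edgeStopping ν β) (Ici 0) ∧
    Tendsto (edgeStopping ν β) (𝓝[>] 0) (𝓝 (edgeStopping ν β 0)) ∧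
    ∀ (Ω : Set Plane) (u : Plane → ℝ), ContDiffOn ℝ ∞ u Ω →
      ∀ x ∈ interior Ω, gradient u x ≠ 0 →
        DifferentiableAt ℝ (snakesField (edgeStopping ν β) u) x ∧
        ∃ m : ℝ → ℝ,
          (∀ᶠ ρ in 𝓝[>] (0 : ℝ), ∀ y : ℝ, IsMedianOn u (amoeba ν β Ω u ρ x) y ↔ y = m ρ) ∧
          (fun ρ : ℝ => m ρ - (u x + ρ ^ 2 / 6 * selfSnakes (edgeStopping ν β) u x))
            =o[𝓝[>] (0 : ℝ)] (fun ρ : ℝ => ρ ^ 2) := by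
  have h := hν.isAbsoluteNorm
  have hg : ∀ z, 0 ≤ z → edgeStopping ν β z = ballMoment (amoebaPhi ν) (β * z) := fun z hz =>
    hν.edgeStopping_eq hβ hz
  refine ⟨fun z hz => ?_, fun z hz z' hz' hzz' => ?_, ?_, fun Ω u hu x hx hx0 => ?_⟩
  · rw [hg z hz]
    exact h.nonneg_ballMoment _
  · rw [hg z hz, hg z' hz']
    exact h.antitoneOn_ballMoment (mul_nonneg hβ.le hz) (mul_nonneg hβ.le hz')
      (mul_le_mul_of_nonneg_left hzz' hβ.le)
  · have h1 : Tendsto (fun z => ballMoment (amoebaPhi ν) (β * z)) (𝓝[>] 0)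
        (𝓝 (ballMoment (amoebaPhi ν) (β * 0))) :=
      (h.continuous_ballMoment.comp (continuous_const_mul β)).continuousAt.tendsto.mono_left
        nhdsWithin_le_nhds
    rw [hg 0 le_rfl]
    refine h1.congr' ?_
    filter_upwards [self_mem_nhdsWithin] with z hz using (hg z (le_of_lt hz)).symm
  obtain ⟨b, hb, hb0, hb1⟩ := exists_gradient_frame hx0
  have hpos : 0 < ‖gradient u x‖ := norm_pos_iff.2 hx0
  have hux : ContDiffAt ℝ 2 u x :=
    (hu.contDiffAt (mem_interior_iff_mem_nhds.1 hx)).of_le (by norm_cast)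
  have hG : HasDerivAt (fun z => ballMoment (amoebaPhi ν) (β * z))
      (β * deriv (ballMoment (amoebaPhi ν)) (β * ‖gradient u x‖)) ‖gradient u x‖ := by
    have h1 := (h.hasDerivAt_ballMoment (mul_pos hβ hpos)).differentiableAt.hasDerivAt
    exact (h1.comp _ ((hasDerivAt_id _).const_mul β)).congr_deriv (by ring)
  obtain ⟨X', hX, hX'⟩ := hasFDerivAt_comp_norm_gradient_smul hux hx0
    (hG.div (hasDerivAt_id _) hpos.ne')
  have hfield : snakesField (edgeStopping ν β) u = fun y =>
      (ballMoment (amoebaPhi ν) (β * ‖gradient u y‖) / ‖gradient u y‖) • gradient u y :=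
    funext fun y => by rw [snakesField, hg _ (norm_nonneg _)]
  have hX2 : HasFDerivAt (snakesField (edgeStopping ν β) u) X' x := by rw [hfield]; exact hX
  refine ⟨hX2.differentiableAt, exists_median_isLittleO hν hβ hu hx b hpos hb0 hb1 ?_⟩
  have hBb : fderiv ℝ (fderiv ℝ u) x (b 0) (gradient u x)
      = ‖gradient u x‖ * fderiv ℝ (fderiv ℝ u) x (b 0) (b 0) := by
    conv_lhs => rw [hb, map_smul, smul_eq_mul]
  -- With z = |∇u| and q(z) = G(βz)/z, the second derivative along the gradient gets the factor q +
  -- zq' = βG'(βz), the one across it the factor q. Multiplication by z gives the coefficients in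
  -- the expansion of the median.
  rw [selfSnakes, planeDiv_eq_sum_inner _ _ b, Fin.sum_univ_two, hX2.fderiv, hX', hX', hb0, hb1, hBb]
  simp only [Pi.div_apply, id_eq]
  field_simp
  ring
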